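/- All graphs are finite and simple. **Definitions.** A graph $G$ is *$k$-connected* if $|V(G)|>k$ and $G-S$ is connected for every $S\subseteq V(G)$ with $|S|<k$. A $3$-connected graph $G$ on at least five vertices is *internally $4$-connected* if either $G\cong K_{3,3}$, or every set $S$ of three vertices for which $G-S$ is disconnected is independent and separates $G$ into a single vertex and one remaining component. $F_4$ is the graph with the ten vertices $f^i, f^i_1,f^i_2,f^i_3,f^i_4$ ($i=1,2$) and the sixteen edges $f^if^i_j$ and $f^i_3f^i_j$ ($i=1,2$; $j=1,2,4$) and $f^1_jf^2_{5-j}$ ($j=1,2,3,4$). $\mathfrak Q^+$ is the graph obtained from the cube by adding a new vertex and joining it to three vertices of one of the two colour classes of the cube. A *subdivision* $\eta$ of $H$ in $G$ maps the vertices of $H$ to distinct vertices of $G$, and each edge $uv$ of $H$ to a path $\eta(uv)$ of $G$ (a *segment*) with ends $\eta(u)$ and $\eta(v)$, such that the segments are pairwise internally disjoint and no internal vertex of a segment lies in $\eta(V(H))$. The union of its images is the subgraph $\eta(H)$ of $G$. A *bridge* of $\eta(H)$ consists of a component $A$ of $G-V(\eta(H))$, the vertices of $\eta(H)$ adjacent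 to $A$ (its *attachments*), and the edges joining them to $A$; its *size* is $|V(A)|$. A bridge is *unstable* if all its attachments are contained in one of the following: the union of $\eta(v)$ and $\eta(e)$ for some $v\in V(H)$, $e\in E(H)$; the union of two segments with a common end; the union of the three segments at a vertex of degree three. Otherwise it is *stable*. A subdivision $\eta$ of $H$ in $G$ is a *JT-subdivision* (is *lexicographically maximal*) if the non-increasing sequence of the sizes of all stable bridges of $\eta(H)$ is lexicographically maximal among all subdivisions of $H$ in $G$, where a proper initial part of a sequence is smaller than the sequence. **Proposition.** Let $G$ be an internally $4$-connected graph without a $K_{3,4}$ minor. Suppose that $G$ has no $\mathfrak Q^+$ minor or that $G$ is $4$-connected. Then for every JT-subdivision $\eta$ of $F_4$ in $G$, the graph $\eta(F_4)$ is a spanning subgraph of $G$, that is, $V(\eta(F_4))=V(G)$. -/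

import Mathlib

namespace GraphF4

variable {V W : Type*}

/-! ### Minors and connectivity -/

/-- `H` is a minor of `G`: there are pairwise disjoint (nonempty) connected branch sets in `G`, one
for each vertex of `H`, with an edge of `G` between any two branch sets of adjacent vertices. -/
def IsMinor (H : SimpleGraph W) (G : SimpleGraph V) : Prop :=
  ∃ μ : W → Set V,
    (∀ w, (G.induce (μ w)).Connected) ∧
    (∀ u w, u ≠ w → Disjoint (μ u) (μ w)) ∧
    (∀ u w, H.Adj u w → ∃ x ∈ μ u, ∃ y ∈ μ w, G.Adj x y)

/-- `G - S` is disconnected (it has two vertices that are joined by no path). -/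
def IsCut (G : SimpleGraph V) (S : Set V) : Prop :=
  ¬ (G.induce Sᶜ).Preconnected

/-- `G` is `k`-connected: it has more than `k` vertices and no cut with fewer than `k` vertices. -/
def KConnected (k : ℕ) (G : SimpleGraph V) : Prop :=
  k < Nat.card V ∧ ∀ S : Set V, S.ncard < k → ¬ IsCut G S

/-- `G` is internally `4`-connected: it is `3`-connected with at least five vertices, and either it
is isomorphic to `K_{3,3}` or every `3`-cut is independent and separates `G` into a single vertex
`v` and one remaining component. -/
def InternallyFourConnected (G : SimpleGraph V) : Prop :=
  KConnected 3 G ∧ 5 ≤ Nat.card V ∧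
    (Nonempty (G ≃g completeBipartiteGraph (Fin 3) (Fin 3)) ∨
      ∀ S : Set V, S.ncard = 3 → IsCut G S →
        G.IsIndepSet S ∧
        ∃ v, v ∉ S ∧ G.neighborSet v ⊆ S ∧ (G.induce (insert v S)ᶜ).Connected)

/-! ### The graphs -/

/-- `K_{3,4}`. -/
abbrev K34 : SimpleGraph (Fin 3 ⊕ Fin 4) := completeBipartiteGraph (Fin 3) (Fin 4)

/-- The graph `𝔔⁺`: the cube together with a new vertex joined to three vertices of one of the two
colour classes of the cube. The cube is formed by `inl i` (`i < 4`) and `inr j` (`j < 4`), where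
`inl i` is adjacent to `inr j` iff `i ≠ j`; the new vertex `inr 4` is adjacent to
`inl 0`, `inl 1`, `inl 2`. -/
def Qplus : SimpleGraph (Fin 4 ⊕ Fin 5) :=
  SimpleGraph.fromRel fun a b =>
    ∃ (i : Fin 4) (j : Fin 5), a = Sum.inl i ∧ b = Sum.inr j ∧ i.val ≠ min j.val 3

/-- The graph `F₄`, with ten vertices and sixteen edges. With `i` in `{0, 1}` standing for the
superscript `1`, `2`, the vertex `(i, 0)` is `fⁱ` and `(i, j)` is `fⁱ_j` for `j = 1, 2, 3, 4`.
The edges are `fⁱ fⁱ_j` and `fⁱ_3 fⁱ_j` for `j = 1, 2, 4`, and `f¹_j f²_{5-j}` for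
`j = 1, 2, 3, 4`. -/
def F4 : SimpleGraph (Fin 2 × Fin 5) :=
  SimpleGraph.fromRel fun a b =>
    (a.1 = b.1 ∧ (a.2 = 0 ∨ a.2 = 3) ∧ (b.2 = 1 ∨ b.2 = 2 ∨ b.2 = 4)) ∨
    (a.1 ≠ b.1 ∧ a.2.val + b.2.val = 5)

/-! ### Subdivisions -/

/-- A subdivision `η` of `H` in `G`: distinct vertices of `G` for the vertices of `H`, and
internally disjoint paths of `G` (the segments) for the edges of `H`. An edge of `H` is given by an
ordered adjacent pair; reversing the pair reverses the path. -/
structure Subdivision (H : SimpleGraph W) (G : SimpleGraph V) where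
  vert : W → V
  vert_injective : Function.Injective vert
  seg : ∀ {u v : W}, H.Adj u v → G.Walk (vert u) (vert v)
  seg_isPath : ∀ {u v : W} (h : H.Adj u v), (seg h).IsPath
  seg_symm : ∀ {u v : W} (h : H.Adj u v), seg h.symm = (seg h).reverse
  /-- No internal vertex of a segment is the image of a vertex of `H`. -/
  eq_or_eq_of_vert_mem : ∀ {u v w : W} (h : H.Adj u v),
    vert w ∈ (seg h).support → w = u ∨ w = v
  /-- A common vertex of two distinct segments is not internal. -/
  mem_range_of_mem_of_mem : ∀ {u v u' v' : W} (h : H.Adj u v) (h' : H.Adj u' v') {x : V},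
    s(u, v) ≠ s(u', v') → x ∈ (seg h).support → x ∈ (seg h').support → x ∈ Set.range vert

namespace Subdivision

variable {H : SimpleGraph W} {G : SimpleGraph V} (η : Subdivision H G)

/-- The subgraph `η(H)` of `G`. -/
def image : G.Subgraph :=
  (⨆ w : W, G.singletonSubgraph (η.vert w)) ⊔
    ⨆ (u : W) (v : W) (h : H.Adj u v), (η.seg h).toSubgraph

/-- The vertex set of a segment. -/
def segVerts {u v : W} (h : H.Adj u v) : Set V := {x | x ∈ (η.seg h).support}

/-- The vertex sets of the unstable fragments of `η`. -/
inductive IsUnstableFragment : Set V → Prop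
  /-- The union of `η(w)` and `η(e)`, for a vertex `w` and an edge `e` of `H`. -/
  | vertexSegment (w : W) {u v : W} (h : H.Adj u v) :
      IsUnstableFragment (insert (η.vert w) (η.segVerts h))
  /-- The union of two segments with a common end. -/
  | twoSegments {u v v' : W} (h : H.Adj u v) (h' : H.Adj u v') :
      IsUnstableFragment (η.segVerts h ∪ η.segVerts h')
  /-- The union of the three segments at a vertex of degree three. -/
  | threeSegments (u : W) (hu : (H.neighborSet u).ncard = 3) :
      IsUnstableFragment (⋃ (v : W) (h : H.Adj u v), η.segVerts h)

/-- The bridges of `η(H)` in `G`. A bridge is determined by a component `A` of `G - V(η(H))`, and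
is represented by it. -/
abbrev Bridge : Type _ := (G.induce (η.image.verts)ᶜ).ConnectedComponent

/-- The attachments of a bridge: the vertices of `η(H)` adjacent to the component. -/
def attachments (A : η.Bridge) : Set V :=
  {x | x ∈ η.image.verts ∧ ∃ a ∈ A.supp, G.Adj x a}

/-- A bridge is unstable if its attachments lie in an unstable fragment, and otherwise stable. -/
def IsStable (A : η.Bridge) : Prop :=
  ¬ ∃ F : Set V, η.IsUnstableFragment F ∧ η.attachments A ⊆ F

/-- The sizes (numbers of vertices outside `η(H)`) of all stable bridges of `η(H)`, listed with
multiplicity in non-increasing order. -/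
noncomputable def stableSizes [Finite V] : List ℕ :=
  ((Set.toFinite {A : η.Bridge | η.IsStable A}).toFinset.val.map
    fun A => A.supp.ncard).sort (· ≥ ·)

/-- `η` is a JT-subdivision, that is, lexicographically maximal: no subdivision of `H` in `G` has a
lexicographically larger sequence of sizes of stable bridges (a proper prefix of a sequence being
smaller than the sequence). -/
def IsJT [Finite V] : Prop :=
  ∀ η' : Subdivision H G, ¬ η.stableSizes < η'.stableSizes

end Subdivision

end GraphF4

/-!
Suppose that a subdivision of `F₄` in `G` misses a vertex, and let `bs` be a component of the rest.
By connectivity `bs` has at least three attachments on the subdivision, and at least four if `G` is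
`4`-connected (`le_ncard_attached`). Whatever its attachments are, a minor results.

All the `K_{3,4}` minors are found by one device. The part of the subdivision that is not involved
is contracted onto the branch vertices (`Home`), the sets that are involved are added to the sets of
some branch vertices or become new vertices, and what results is a graph on at most `13` vertices
that consists of `F₄` and a few further vertices and edges. There are finitely many such graphs, up
to the automorphisms of `F₄`, and for each of them one of a short list of certificates gives a
`K_{3,4}` minor, by evaluation (`hasCert`).

The main step is that `bs` has no two attachments `t` and `x` on one segment `a b`
(`PathConfig.false`). By the certificates, a third attachment elsewhere is either an *exceptional*
branch vertex for `a b`, or it is on another segment at an end of `a b` of degree three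
(`IsModel.exists_exceptional`). The latter is impossible by `Config.false`: for a claw whose legs
end on the rest of the subdivision, no connected set is attached to the claw at two vertices `x` and
`y` of different legs and at a vertex between them. To see this, the claw and the set are chosen so
that the set is as large as possible. As three vertices of an internally `4`-connected graph do not
separate two large sets (`exists_jump`), there is a path from the part of the claw between `x` and
`y` to the rest of the subdivision that avoids `x`, `y` and the centre. Most positions of its other
end give a `K_{3,4}` minor, or allow to reroute the claw and to enlarge the set; what remains is
that it is on the third leg (`Extremal.exists_foot`). This case is excluded by induction on the
length of the third leg behind this end, which now takes the role of the centre in the cut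
(`Extremal.no_foot`).

With `Config.false` at hand, `bs` is again chosen as large as possible, where the segment `a b` may
be rerouted as well. A path that avoids `t` and `x` yields one exceptional branch vertex `w`
attached to `bs`, possibly after `bs` and the part of the segment between `t` and `x` have exchanged
their roles. A path that avoids `t`, `x` and `w` yields a second one, and this gives a `K_{3,4}`
minor.

So each segment has at most one attachment. If an inner vertex of a segment is one, then there is a
`K_{3,4}` minor (`IsModel.false_of_inner_attached`). Otherwise there are three pairwise non-adjacent
branch vertices that are attachments; they give a `K_{3,4}` minor, except for two triples, which are
exchanged by an automorphism of `F₄` and give a `Qplus` minor. If there are four attachments, then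
some three of them do not form an exceptional triple.
-/

namespace GraphF4

variable {V : Type*}

/-! ### Branch sets and certificates for minors -/

/-- A family of vertex sets of `G`, indexed by `ℕ`, that are pairwise disjoint, connected unless
empty, and joined by an edge of `G` for every pair in `E`. So the graph with edge list `E` is a
minor of `G`. -/
structure BranchSets (G : SimpleGraph V) (E : List (ℕ × ℕ)) (μ : ℕ → Set V) : Prop where
  conn : ∀ i, (μ i).Nonempty → (G.induce (μ i)).Connected
  disj : ∀ i j, i ≠ j → Disjoint (μ i) (μ j)
  adj : ∀ e ∈ E, ∃ x ∈ μ e.1, ∃ y ∈ μ e.2, G.Adj x y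

/-- `List.any`, defined by the recursor: this evaluates faster in the kernel. -/
def anyR {α : Type*} (p : α → Bool) (l : List α) : Bool :=
  List.rec false (fun a _ ih => or (p a) ih) l

/-- `List.all`, defined by the recursor: this evaluates faster in the kernel. -/
def allR {α : Type*} (p : α → Bool) (l : List α) : Bool :=
  List.rec true (fun a _ ih => and (p a) ih) l

lemma anyR_iff {α : Type*} {p : α → Bool} {l : List α} :
    anyR p l = true ↔ ∃ a ∈ l, p a = true := by
  induction l with
  | nil => simp [anyR]
  | cons a l ih =>
    have : anyR p (a :: l) = (p a || anyR p l) := rfl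
    simp [this, ih]

lemma allR_iff {α : Type*} {p : α → Bool} {l : List α} :
    allR p l = true ↔ ∀ a ∈ l, p a = true := by
  induction l with
  | nil => simp [allR]
  | cons a l ih =>
    have : allR p (a :: l) = (p a && allR p l) := rfl
    simp [this, ih]

/-- The adjacency matrix of the graph with edge list `E` on vertices below `16`, renumbered by `σ`,
as the bits of a natural number: the bit `16 * a + b` is set if `a` and `b` are adjacent. -/
def code (σ : ℕ → ℕ) (E : List (ℕ × ℕ)) : ℕ :=
  List.rec 0 (fun e _ m => Nat.lor (Nat.lor m
    (Nat.shiftLeft 1 (Nat.add (Nat.mul 16 (σ e.1)) (σ e.2))))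
    (Nat.shiftLeft 1 (Nat.add (Nat.mul 16 (σ e.2)) (σ e.1)))) E

/-- Adjacency in the graph with matrix `M`. -/
def adjM (M x y : ℕ) : Bool :=
  Nat.beq (Nat.land 1 (Nat.shiftRight M (Nat.add (Nat.mul 16 x) y))) 1

lemma adjM_eq_testBit (M x y : ℕ) : adjM M x y = M.testBit (16 * x + y) := by
  have h1 : adjM M x y = Nat.beq (1 &&& (M >>> (16 * x + y))) 1 := rfl
  rw [h1, Nat.testBit, Nat.one_and_eq_mod_two]
  rcases Nat.mod_two_eq_zero_or_one (M >>> (16 * x + y)) with h | h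
  · simp [h]
    rfl
  · simp [h]

/-- The list `l` can be built from its last entry by adding, one after the other, vertices adjacent
to a previous one. -/
def linked (M : ℕ) (l : List ℕ) : Bool :=
  List.rec true (fun x t ih =>
    and (List.rec true (fun _ _ _ => anyR (fun z => adjM M z x) t) t) ih) l

/-- A certificate for a `K_{3,4}` minor: the branch sets for the part of size three, and those for
the part of size four. -/
abbrev Cert := List (List ℕ) × List (List ℕ)

/-- The branch sets of a certificate are disjoint sets of numbers below `13`. -/
def Cert.wellFormed (c : Cert) : Bool :=
  c.1.length == 3 && c.2.length == 4 && (c.1 ++ c.2).flatten.Nodup &&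
    (c.1 ++ c.2).flatten.all fun x => x < 13

/-- The branch sets of a certificate are connected, and those for different parts are
adjacent. -/
def Cert.valid (M : ℕ) (c : Cert) : Bool :=
  and (allR (fun a => allR (fun b => anyR (fun x => anyR (fun y => adjM M x y) b) a) c.2) c.1)
    (and (allR (linked M) c.1) (allR (linked M) c.2))

/-- `f n`, with `n` evaluated first when the kernel computes this. -/
def force (n : ℕ) (f : ℕ → Bool) : Bool := Nat.rec (f 0) (fun k _ => f (k + 1)) n

lemma force_eq (n : ℕ) (f : ℕ → Bool) : force n f = f n := by cases n <;> rfl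

lemma exists_of_adjM_code {E : List (ℕ × ℕ)} {σ : ℕ → ℕ}
    (hE : ∀ e ∈ E, σ e.1 < 16 ∧ σ e.2 < 16) {a b : ℕ} (hb : b < 16)
    (h : adjM (code σ E) a b = true) :
    ∃ e ∈ E, (σ e.1 = a ∧ σ e.2 = b) ∨ (σ e.1 = b ∧ σ e.2 = a) := by
  rw [adjM_eq_testBit] at h
  induction E with
  | nil => simp [code] at h
  | cons e E ih =>
    have he := hE e (by simp)
    have hcons : code σ (e :: E) =
      code σ E ||| 1 <<< (16 * σ e.1 + σ e.2) ||| 1 <<< (16 * σ e.2 + σ e.1) := rfl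
    simp only [hcons, Nat.testBit_or, Bool.or_eq_true, Nat.one_shiftLeft,
      Nat.testBit_two_pow, decide_eq_true_eq] at h
    rcases h with (h | h) | h
    · obtain ⟨e', he', h⟩ := ih (fun e he => hE e (by simp [he])) h
      exact ⟨e', by simp [he'], h⟩
    · exact ⟨e, by simp, Or.inl (by omega)⟩
    · exact ⟨e, by simp, Or.inr (by omega)⟩

lemma induce_union_connected_of_adj {G : SimpleGraph V} {s t : Set V}
    (hs : (G.induce s).Connected) (ht : (G.induce t).Connected) {x y : V}
    (hx : x ∈ s) (hy : y ∈ t) (h : G.Adj x y) : (G.induce (s ∪ t)).Connected :=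
  SimpleGraph.connected_induce_union hs.preconnected ht.preconnected hx hy h

/-- The union of the branch sets with indices in a list. -/
def unionOver (μ : ℕ → Set V) (l : List ℕ) : Set V := {v | ∃ x ∈ l, v ∈ μ x}

section

variable {G : SimpleGraph V} {E : List (ℕ × ℕ)} {μ : ℕ → Set V}

lemma BranchSets.exists_adj (h : BranchSets G E μ) {σ : ℕ → ℕ} (hσ : ∀ i, σ (σ i) = i)
    (hE : ∀ e ∈ E, σ e.1 < 16 ∧ σ e.2 < 16) {a b : ℕ} (hb : b < 16)
    (hab : adjM (code σ E) a b = true) : ∃ x ∈ μ (σ a), ∃ y ∈ μ (σ b), G.Adj x y := by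
  obtain ⟨e, he, ⟨rfl, rfl⟩ | ⟨rfl, rfl⟩⟩ := exists_of_adjM_code hE hb hab <;> simp only [hσ]
  · exact h.adj _ he
  · obtain ⟨x, hx, y, hy, hxy⟩ := h.adj _ he
    exact ⟨y, hy, x, hx, hxy.symm⟩

/-- The renumbering `σ` moves a certificate by an automorphism: the branch sets are the unions of
the sets `μ (σ x)`. -/
lemma BranchSets.connected_of_linked (h : BranchSets G E μ) {σ : ℕ → ℕ} (hσ : ∀ i, σ (σ i) = i)
    (hE : ∀ e ∈ E, σ e.1 < 16 ∧ σ e.2 < 16) :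
    ∀ {l : List ℕ}, (∀ x ∈ l, x < 16) → linked (code σ E) l = true →
      (unionOver (μ ∘ σ) l).Nonempty → (G.induce (unionOver (μ ∘ σ) l)).Connected
  | [], _, _, hne => by obtain ⟨v, x, hx, -⟩ := hne; simp at hx
  | [x], _, _, hne => by
    have : unionOver (μ ∘ σ) [x] = μ (σ x) := by ext; simp [unionOver]
    rw [this] at hne ⊢
    exact h.conn _ hne
  | x :: y :: l, hl, hx, _ => by
    have hlk : linked (code σ E) (x :: y :: l) =
      (anyR (fun z => adjM (code σ E) z x) (y :: l) && linked (code σ E) (y :: l)) := rfl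
    simp only [hlk, Bool.and_eq_true, anyR_iff] at hx
    obtain ⟨⟨z, hz, hzx⟩, hrest⟩ := hx
    obtain ⟨v, hv, w, hw, hvw⟩ := h.exists_adj hσ hE (hl x (by simp)) hzx
    have hun : unionOver (μ ∘ σ) (x :: y :: l) = unionOver (μ ∘ σ) (y :: l) ∪ μ (σ x) := by
      ext
      simp only [unionOver, List.mem_cons, Set.mem_ofPred_eq, Set.mem_union, Function.comp]
      grind
    rw [hun]
    exact induce_union_connected_of_adj
      (h.connected_of_linked hσ hE (fun x hx => hl x (by simp [hx])) hrest ⟨v, z, hz, hv⟩)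
      (h.conn _ ⟨w, hw⟩) ⟨z, hz, hv⟩ hw hvw

/-- A valid certificate for the graph with edge list `E` gives a `K_{3,4}` minor of `G`. -/
lemma BranchSets.isMinor_K34 (h : BranchSets G E μ) {σ : ℕ → ℕ} (hσ : ∀ i, σ (σ i) = i)
    (hE : ∀ e ∈ E, σ e.1 < 16 ∧ σ e.2 < 16) {c : Cert} (hwf : c.wellFormed = true)
    (hc : c.valid (code σ E) = true) : IsMinor K34 G := by
  obtain ⟨A, B⟩ := c
  simp only [Cert.wellFormed, Bool.and_eq_true, beq_iff_eq, decide_eq_true_eq,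
    List.all_eq_true] at hwf
  obtain ⟨⟨⟨hA, hB⟩, hnd⟩, hlt⟩ := hwf
  simp only [Cert.valid, Bool.and_eq_true, allR_iff, anyR_iff] at hc
  obtain ⟨hadj, hlA, hlB⟩ := hc
  have hlt' : ∀ l ∈ A ++ B, ∀ x ∈ l, x < 16 := fun l hl x hx =>
    (hlt x (List.mem_flatten.2 ⟨l, hl, hx⟩)).trans (by norm_num)
  let k : Fin 3 ⊕ Fin 4 → Fin (A ++ B).length :=
    Sum.elim (fun i => ⟨i, by simp; omega⟩) (fun j => ⟨3 + j, by simp; omega⟩)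
  have hk : Function.Injective k := by
    rintro (i | i) (j | j) hij <;> simp [k, Fin.ext_iff] at hij ⊢ <;> omega
  have hkA : ∀ i, (A ++ B).get (k (.inl i)) ∈ A := fun i => by
    simp only [k, Sum.elim_inl, List.get_eq_getElem]
    rw [List.getElem_append_left (by omega)]
    exact List.getElem_mem _
  have hkB : ∀ j, (A ++ B).get (k (.inr j)) ∈ B := fun i => by
    simp only [k, Sum.elim_inr, List.get_eq_getElem]
    rw [List.getElem_append_right (by omega)]
    exact List.getElem_mem _
  have hK : ∀ (i : Fin 3) (j : Fin 4), ∃ x ∈ unionOver (μ ∘ σ) ((A ++ B).get (k (.inl i))),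
      ∃ y ∈ unionOver (μ ∘ σ) ((A ++ B).get (k (.inr j))), G.Adj x y := by
    intro i j
    obtain ⟨x, hx, y, hy, hxy⟩ := hadj _ (hkA i) _ (hkB j)
    obtain ⟨v, hv, w, hw, hvw⟩ := h.exists_adj hσ hE (hlt' _ (List.get_mem _ _) y hy) hxy
    exact ⟨v, ⟨x, hx, hv⟩, w, ⟨y, hy, hw⟩, hvw⟩
  refine ⟨fun w => unionOver (μ ∘ σ) ((A ++ B).get (k w)), fun w => ?_, fun u w huw => ?_, ?_⟩
  · rcases w with i | j
    · obtain ⟨x, hx, -⟩ := hK i 0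
      exact h.connected_of_linked hσ hE (hlt' _ (List.get_mem _ _)) (hlA _ (hkA i)) ⟨x, hx⟩
    · obtain ⟨x, hx, y, hy, -⟩ := hK 0 j
      exact h.connected_of_linked hσ hE (hlt' _ (List.get_mem _ _)) (hlB _ (hkB j)) ⟨y, hy⟩
  · rw [Set.disjoint_left]
    rintro v ⟨x, hx, hvx⟩ ⟨y, hy, hvy⟩
    have hxy : x ≠ y := by
      rintro rfl
      have := (List.nodup_flatten.1 hnd).2
      rw [List.pairwise_iff_get] at this
      rcases lt_or_gt_of_ne (fun he => huw (hk he)) with hlt | hlt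
      · exact this _ _ hlt hx hy
      · exact this _ _ hlt hy hx
    exact Set.disjoint_left.1 (h.disj (σ x) (σ y) fun he => hxy (by rw [← hσ x, he, hσ])) hvx hvy
  · rintro (i | i) (j | j) hij
    · simp at hij
    · exact hK i j
    · obtain ⟨x, hx, y, hy, hxy⟩ := hK j i
      exact ⟨y, hy, x, hx, hxy.symm⟩
    · simp at hij

end

/-! ### The graph `F₄` on the vertices `0, …, 9` -/

/-- The edges of `F₄`, with the number `5 * i + j` standing for the vertex `(i, j)`. -/
def baseEdges : List (ℕ × ℕ) :=
  [(0, 1), (0, 2), (0, 4), (3, 1), (3, 2), (3, 4), (5, 6), (5, 7), (5, 9), (8, 6), (8, 7), (8, 9),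
   (1, 9), (2, 8), (3, 7), (4, 6)]

/-- Adjacency in `F₄`. -/
def adjF (a b : ℕ) : Bool := adjM (code id baseEdges) a b

/-- The neighbours of a vertex of `F₄`. -/
def nbrs (u : ℕ) : List ℕ := (List.range 10).filter (adjF u)

/-- The vertices of degree three of `F₄`. -/
def cubic : List ℕ := [0, 1, 2, 4, 5, 6, 7, 9]

/-- The edges of the list `E` other than `ab`. -/
def edgesWithout (a b : ℕ) (E : List (ℕ × ℕ)) : List (ℕ × ℕ) :=
  E.filter fun e => e != (a, b) && e != (b, a)

/-- The automorphism of `F₄` that exchanges the two superscripts; the numbers from `10` on, which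
label further vertices, are fixed. -/
def autSwap (i : ℕ) : ℕ := bif Nat.ble 10 i then i else Nat.mod (Nat.add i 5) 10

/-- The automorphism of `F₄` that exchanges `f¹₁` with `f¹₄` and `f²₁` with `f²₄`. -/
def autFlip (i : ℕ) : ℕ :=
  bif or (Nat.beq i 1) (Nat.beq i 6) then Nat.add i 3 else
    bif or (Nat.beq i 4) (Nat.beq i 9) then Nat.sub i 3 else i

/-- Some certificate of the list is valid, up to an automorphism of `F₄`. -/
def hasCert (E : List (ℕ × ℕ)) (L : List Cert) : Bool :=
  anyR (fun σ => force (code σ E) fun M => anyR (Cert.valid M) L)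
    [id, autSwap, autFlip, fun i => autSwap (autFlip i)]

lemma isMinor_K34_of_hasCert {G : SimpleGraph V} {E : List (ℕ × ℕ)} {μ : ℕ → Set V}
    (h : BranchSets G E μ) {L : List Cert} (hE : ∀ e ∈ E, e.1 < 13 ∧ e.2 < 13)
    (hwf : L.all Cert.wellFormed = true) (hL : hasCert E L = true) : IsMinor K34 G := by
  obtain ⟨σ, hσ, hc⟩ := anyR_iff.1 hL
  rw [force_eq] at hc
  obtain ⟨c, hcL, hc⟩ := anyR_iff.1 hc
  have hinv : ∀ i, σ (σ i) = i := by
    intro i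
    rcases lt_or_ge i 10 with hi | hi
    · have key : ∀ i < 10, ∀ σ ∈ [id, autSwap, autFlip, fun i => autSwap (autFlip i)],
          σ (σ i) = i := by decide
      exact key i hi σ hσ
    · have h1 : autSwap i = i := by simp [autSwap, Nat.ble_eq_true_of_le hi]
      have h2 : autFlip i = i := by
        have : i.beq 1 = false ∧ i.beq 6 = false ∧ i.beq 4 = false ∧ i.beq 9 = false := by
          simp only [← Bool.not_eq_true, Nat.beq_eq]; omega
        simp [autFlip, this]
      simp only [List.mem_cons, List.not_mem_nil, or_false] at hσ
      rcases hσ with rfl | rfl | rfl | rfl <;> simp [h1, h2]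
  have hlt : ∀ i < 13, σ i < 16 := by
    simp only [List.mem_cons, List.not_mem_nil, or_false] at hσ
    rcases hσ with rfl | rfl | rfl | rfl <;> decide
  exact h.isMinor_K34 hinv (fun e he => ⟨hlt _ (hE e he).1, hlt _ (hE e he).2⟩)
    (List.all_eq_true.1 hwf c hcL) hc

/-! ### Certificates -/

/-- The pairs of an edge `ab` and a vertex `w` adjacent to neither end of it that are not covered by
`edgeVertex_cert`. -/
def exceptional (a b w : ℕ) : Bool :=
  [((1, 9), [4, 6]), ((2, 8), [1, 4]), ((3, 7), [6, 9]), ((4, 6), [1, 9]), ((1, 3), [5]),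
    ((3, 4), [5]), ((6, 8), [0]), ((8, 9), [0])].any fun x : (ℕ × ℕ) × List ℕ =>
      (x.1 == (a, b) || x.1 == (b, a)) && x.2.contains w

/-- The pairs of an edge `ab` and a vertex `w` that are not covered by `edgeVertex_cert`: the
exceptional pairs, and those with `w` adjacent to an end of `ab` of degree three. -/
def poor (a b w : ℕ) : Bool :=
  exceptional a b w || (cubic.contains a && adjF a w) || (cubic.contains b && adjF b w)

/-- `F₄` with a new vertex `10` on the edge `ab`. -/
def subdivided (a b : ℕ) : List (ℕ × ℕ) := [(10, a), (10, b)] ++ edgesWithout a b baseEdges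

/-- The certificates for `edgeVertex_cert`. -/
def edgeVertexCerts : List Cert :=
  [([[8, 2, 0], [3, 1], [6, 5]], [[4], [7], [9], [10]]),
   ([[10, 1], [8, 2], [5, 6, 4]], [[0], [3], [7], [9]]),
   ([[5, 6, 4, 0], [3, 1], [8]], [[2], [7], [9], [10]]),
   ([[9, 1], [10, 2], [6, 4]], [[0], [3], [7, 5], [8]]),
   ([[9, 1, 0], [7, 3, 2], [6]], [[4], [5], [8], [10]]),
   ([[5, 9, 1], [8, 2], [4, 3]], [[0], [6], [7], [10]]),
   ([[9, 1], [7, 3], [6, 4]], [[2, 0], [5], [8], [10]])]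

/-- The certificates for `edgeTwoVertices_cert`. -/
def edgeTwoVerticesCerts : List Cert :=
  [([[10, 5, 9, 1], [8, 2], [4, 3]], [[0], [6], [7], [11]]),
   ([[10, 9, 1], [7, 3], [6, 4]], [[2, 0], [5], [8], [11]]),
   ([[10, 6, 4, 0], [7, 3, 2], [9]], [[1], [5], [8], [11]]),
   ([[10, 8, 2, 0], [4, 3], [9, 5]], [[1], [6], [7], [11]]),
   ([[5, 9, 1], [10, 8, 2], [4, 3]], [[0], [6], [7], [11]]),
   ([[10, 5, 6, 4, 0], [3, 1], [8]], [[2], [7], [9], [11]]),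
   ([[8, 2, 0], [10, 4, 3], [9, 5]], [[1], [6], [7], [11]]),
   ([[5, 6, 4, 0], [10, 3], [9, 8]], [[1], [2], [7], [11]]),
   ([[8, 2, 0], [4, 3], [10, 9, 5]], [[1], [6], [7], [11]]),
   ([[5, 6, 4, 0], [3], [10, 9, 8]], [[1], [2], [7], [11]]),
   ([[8, 2, 0], [5, 7, 3], [11, 10]], [[1], [4], [6], [9]])]

/-- The certificates for `edgeEdge_cert`. -/
def edgeEdgeCerts : List Cert :=
  [([[10, 5, 9, 1], [8, 2], [4, 3]], [[0], [6], [7], [11]]),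
   ([[10, 9, 1], [7, 3], [6, 4]], [[2, 0], [5], [8], [11]]),
   ([[5, 9, 1], [10, 8, 2], [4, 3]], [[0], [6], [7], [11]]),
   ([[5, 6, 4, 0], [10, 3], [9, 8]], [[1], [2], [7], [11]]),
   ([[8, 2, 0], [4, 3], [10, 9, 5]], [[1], [6], [7], [11]]),
   ([[7, 3], [6, 4], [10, 9]], [[2, 1, 0], [5], [8], [11]]),
   ([[8, 2, 0], [5, 7, 3], [11, 10]], [[1], [4], [6], [9]])]

/-- The certificates for `triple_cert`. -/
def tripleCerts : List Cert :=
  [([[7, 5, 9, 1], [8, 2], [4]], [[0], [3], [6], [10]]),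
   ([[8, 2, 0], [4, 3, 1], [5]], [[6], [7], [9], [10]]),
   ([[9, 2, 1, 0], [6, 4], [7]], [[3], [5], [8], [10]])]

/-- The certificates for `pathFour_cert`. -/
def pathFourCerts : List Cert :=
  [([[8, 2, 0], [5, 7, 3], [10]], [[1], [4], [6], [9]]),
   ([[5, 9, 1, 0], [4, 3], [8]], [[2], [6], [7], [10]])]

/-- The certificates for `pathJump_cert`. -/
def pathJumpCerts : List Cert :=
  [([[7, 3, 2, 1, 0], [6, 4], [9]], [[5], [8], [10], [11]]),
   ([[4, 1, 0], [5, 7, 3, 2], [8]], [[6], [9], [10], [11]])]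

/-- The certificates for `clawAll_cert`. -/
def clawAllCerts : List Cert :=
  [([[3, 1], [8, 2], [5, 6, 4]], [[0], [7], [9], [10]])]

/-- The certificates for `clawFour_cert`. -/
def clawFourCerts : List Cert :=
  [([[5, 9, 1], [8, 2], [4, 3]], [[0], [6], [7], [10]]),
   ([[10, 1], [8, 2], [5, 6, 4]], [[0], [3], [7], [9]]),
   ([[5, 6, 4, 0], [3, 1], [8]], [[2], [7], [9], [10]]),
   ([[9, 1], [7, 3], [6, 4]], [[2, 0], [5], [8], [10]]),
   ([[8, 2, 0], [3, 1], [6, 5]], [[4], [7], [9], [10]]),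
   ([[9, 1], [6, 4], [7]], [[10, 2, 0], [3], [5], [8]])]

/-- The certificates for `clawJump_cert`. -/
def clawJumpCerts : List Cert :=
  [([[6, 4, 0], [9, 1], [7, 3, 2]], [[5], [8], [10], [11]]),
   ([[10, 8, 2, 0], [3, 1], [6, 5]], [[4], [7], [9], [11]]),
   ([[10, 5, 6, 4, 0], [3, 1], [8]], [[2], [7], [9], [11]]),
   ([[8, 2], [4, 3], [9, 5]], [[11, 0], [10, 1], [6], [7]]),
   ([[8, 2, 0], [5, 9, 1], [4, 3]], [[6], [7], [10], [11]]),
   ([[11, 10, 1], [8, 2], [5, 6, 4]], [[0], [3], [7], [9]]),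
   ([[7, 3], [6, 4], [9]], [[11, 2, 0], [10, 1], [5], [8]]),
   ([[5, 6, 4, 0], [3, 1], [8, 2]], [[7], [9], [10], [11]]),
   ([[9, 1, 0], [7, 3], [6]], [[11, 10, 2], [4], [5], [8]]),
   ([[9, 1], [11, 10, 2], [6, 4]], [[0], [3], [7, 5], [8]]),
   ([[10, 5, 9, 1], [4, 3], [8]], [[11, 0], [2], [6], [7]]),
   ([[8, 2], [4, 3], [9, 5]], [[10, 0], [11, 1], [6], [7]]),
   ([[7, 3], [6, 4], [9]], [[10, 2, 0], [11, 1], [5], [8]]),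
   ([[5, 6, 4, 0], [8, 9, 1], [3]], [[2], [7], [10], [11]]),
   ([[5, 9, 1], [8, 2], [10, 4, 3]], [[0], [6], [7], [11]]),
   ([[10, 9, 1], [7, 3], [6, 4]], [[2, 0], [5], [8], [11]]),
   ([[5, 6, 4, 0], [3, 1], [9, 8]], [[2], [7], [10], [11]]),
   ([[8, 2, 1, 0], [4, 3], [9, 5]], [[6], [7], [10], [11]]),
   ([[8, 2, 0], [10, 3], [6, 5]], [[11, 1], [4], [7], [9]]),
   ([[5, 6, 4, 0], [10, 3], [8]], [[11, 1], [2], [7], [9]]),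
   ([[5, 9, 1], [4, 3], [8]], [[10, 0], [11, 2], [6], [7]]),
   ([[5, 6, 4, 2, 0], [3, 1], [8]], [[7], [9], [10], [11]])]

/-- The certificates for `clawFootJump_cert`. -/
def clawFootJumpCerts : List Cert :=
  [([[9, 1], [7, 3], [6, 4]], [[10, 2, 0], [5], [8], [12, 11]]),
   ([[8, 2, 0], [3, 1], [6, 5]], [[4], [7], [9], [12, 11, 10]]),
   ([[3, 1], [5, 6, 4], [8]], [[10, 2, 0], [7], [9], [12, 11]]),
   ([[3, 4, 0], [10, 8, 2], [9, 5]], [[12, 1], [6], [7], [11]]),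
   ([[9, 1], [7, 3], [6, 4]], [[12, 2, 0], [5], [8], [11, 10]]),
   ([[3, 1], [5, 6, 4], [8]], [[12, 2, 0], [7], [9], [11, 10]]),
   ([[3, 4, 0], [12, 8, 2], [9, 5]], [[10, 1], [6], [7], [11]]),
   ([[4, 1, 0], [8, 2], [11, 5, 7, 3]], [[6], [9], [10], [12]]),
   ([[10, 3, 1, 0], [12, 5, 6, 4], [8]], [[2], [7], [9], [11]]),
   ([[5, 9, 1], [8, 2], [10, 4, 3]], [[12, 0], [6], [7], [11]]),
   ([[12, 10, 11, 1], [8, 2], [5, 6, 4]], [[0], [3], [7], [9]]),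
   ([[5, 9, 1], [8, 2], [12, 4, 3]], [[10, 0], [6], [7], [11]]),
   ([[4, 3, 1, 0], [11, 8, 2], [9, 5]], [[6], [7], [10], [12]]),
   ([[7, 3, 2, 1, 0], [11, 6, 4], [9]], [[5], [8], [10], [12]]),
   ([[9, 1], [12, 10, 7, 11, 2], [6, 4]], [[0], [3], [5], [8]])]

/-- The certificates for `clawLegJump_cert`. -/
def clawLegJumpCerts : List Cert :=
  [([[10, 8, 2, 0], [3, 1], [5, 6, 4]], [[7], [9], [11], [12]]),
   ([[6, 12, 0], [11, 10, 9, 1], [7, 3]], [[2], [4], [5], [8]]),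
   ([[12, 11, 0], [3], [9, 8]], [[10, 1], [2], [6, 4], [7, 5]]),
   ([[11, 5, 9, 1, 10, 0], [4, 3], [8]], [[2], [6], [7], [12]]),
   ([[10, 5, 6, 4, 0], [3, 1], [8, 2]], [[7], [9], [11], [12]]),
   ([[11, 5, 9, 1], [4, 3], [8]], [[12, 10, 0], [2], [6], [7]]),
   ([[10, 6, 4, 0], [9, 1], [7, 3, 2]], [[5], [8], [11], [12]]),
   ([[5, 6, 12, 0], [4, 3, 1], [8, 2]], [[7], [9], [10], [11]]),
   ([[10, 8, 2, 0], [4, 3, 1], [9, 5]], [[6], [7], [11], [12]]),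
   ([[7, 3], [6, 4], [11, 9]], [[10, 2, 0], [12, 1], [5], [8]]),
   ([[5, 6, 4, 0], [10, 3, 1], [9, 8]], [[2], [7], [11], [12]]),
   ([[12, 11, 1], [8, 2], [5, 6, 4]], [[10, 0], [3], [7], [9]]),
   ([[10, 5, 6, 4, 0], [8, 9, 1], [3]], [[2], [7], [11], [12]]),
   ([[10, 6, 4, 0], [11, 7, 3], [12, 9]], [[1], [2], [5], [8]]),
   ([[10, 8, 2, 1, 0], [4, 3], [9, 5]], [[6], [7], [11], [12]]),
   ([[9, 8, 2, 0], [5, 6, 12, 1], [3]], [[4], [7], [10], [11]]),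
   ([[9, 5, 6, 4, 0], [8, 12, 1], [3]], [[2], [7], [10], [11]]),
   ([[6, 4, 0], [12, 10, 9, 1], [7, 3]], [[2], [5], [8], [11]]),
   ([[8, 2, 0], [10, 5, 9, 1], [4, 3]], [[6], [7], [11], [12]]),
   ([[3, 4, 0], [8, 2, 12, 1], [9, 5]], [[6], [7], [10], [11]]),
   ([[7, 3], [6, 4], [9]], [[11, 2, 0], [12, 10, 1], [5], [8]]),
   ([[5, 9, 1], [4, 3], [8]], [[11, 0], [12, 10, 2], [6], [7]]),
   ([[9, 1], [12, 11, 10, 2], [6, 4]], [[0], [3], [7, 5], [8]]),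
   ([[10, 5, 6, 4, 2, 0], [3, 1], [8]], [[7], [9], [11], [12]]),
   ([[5, 6, 4, 0], [10, 3, 1], [8, 2]], [[7], [9], [11], [12]]),
   ([[8, 9, 1, 0], [5, 6, 12, 2], [3]], [[4], [7], [10], [11]]),
   ([[3, 4, 0], [2, 12, 5, 9, 1], [8]], [[6], [7], [10], [11]])]

/-- The certificates for `clawLegJump_cert'`. -/
def clawLegJumpCerts' : List Cert :=
  [([[3, 1], [8, 2], [5, 6, 4]], [[12, 0], [7], [9], [11, 10]]),
   ([[6, 12, 0], [11, 10, 9, 1], [7, 3]], [[2], [4], [5], [8]]),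
   ([[12, 11, 0], [3], [8]], [[10, 9, 1], [2], [6, 4], [7, 5]]),
   ([[10, 5, 9, 1, 11, 0], [4, 3], [8]], [[2], [6], [7], [12]]),
   ([[11, 10, 5, 9, 1], [4, 3], [8]], [[12, 0], [2], [6], [7]]),
   ([[9, 1, 0], [7, 3, 2], [6, 4]], [[5], [8], [11, 10], [12]]),
   ([[3, 1], [11, 10, 8, 2], [6, 5]], [[12, 0], [4], [7], [9]]),
   ([[8, 2, 0], [4, 3, 1], [9, 5]], [[6], [7], [11, 10], [12]]),
   ([[12, 5, 6, 4, 0], [3], [11, 9, 8]], [[1], [2], [7], [10]]),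
   ([[12, 10, 11, 1], [8, 2], [5, 6, 4]], [[0], [3], [7], [9]]),
   ([[8, 2, 0], [4, 3], [9, 5]], [[12, 1], [6], [7], [11, 10]]),
   ([[5, 6, 4, 0], [3], [9, 8]], [[12, 1], [2], [7], [11, 10]]),
   ([[10, 6, 4, 0], [11, 7, 3], [12, 9]], [[1], [2], [5], [8]]),
   ([[8, 2, 0], [11, 10, 3], [6, 5]], [[12, 1], [4], [7], [9]]),
   ([[5, 6, 4, 0], [11, 10, 3], [8]], [[12, 1], [2], [7], [9]]),
   ([[8, 2], [4, 3], [11, 10, 9, 5]], [[0], [12, 1], [6], [7]]),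
   ([[7, 3], [6, 4], [11, 10, 9]], [[2, 0], [12, 1], [5], [8]]),
   ([[9, 1], [12, 10, 11, 2], [6, 4]], [[0], [3], [7, 5], [8]]),
   ([[5, 6, 4, 0], [3, 1], [8]], [[12, 2], [7], [9], [11, 10]]),
   ([[9, 1, 0], [10, 7, 3, 11, 2], [6]], [[4], [5], [8], [12]]),
   ([[5, 9, 1], [4, 3], [11, 10, 8]], [[0], [12, 2], [6], [7]])]

section

-- The decidability instances for the nested bounded quantifiers below are large.
set_option synthInstance.maxSize 100000
set_option synthInstance.maxHeartbeats 400000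

/-- `F₄` with a vertex `10` on the edge `ab`, joined to `w`. -/
theorem edgeVertex_cert : ∀ a < 10, ∀ b ∈ nbrs a, ∀ w < 10, w ≠ a → w ≠ b → poor a b w = false →
    hasCert ((10, w) :: subdivided a b) edgeVertexCerts = true := by decide +kernel

/-- `F₄` with a vertex `10` on the edge `ab`, and a vertex `11` joined to `10` and to two poor
vertices. -/
theorem edgeTwoVertices_cert : ∀ a < 10, ∀ b ∈ nbrs a, ∀ w < 10, w ≠ a → w ≠ b →
    poor a b w = true → ∀ w' < 10, w' ≠ a → w' ≠ b → w' ≠ w → poor a b w' = true →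
    hasCert ([(11, 10), (11, w), (11, w')] ++ subdivided a b) edgeTwoVerticesCerts = true := by
  decide +kernel

/-- `F₄` with vertices `10` and `11` on disjoint edges `ab` and `cd`, joined by an edge, where `c`
and `d` are poor for `ab`. -/
theorem edgeEdge_cert : ∀ a < 10, ∀ b ∈ nbrs a, ∀ c < 10, c ≠ a → c ≠ b → poor a b c = true →
    ∀ d ∈ nbrs c, d ≠ a → d ≠ b → poor a b d = true →
    hasCert ([(11, 10), (11, c), (11, d)] ++ edgesWithout c d (subdivided a b)) edgeEdgeCerts
      = true := by
  decide +kernel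

/-- `F₄` with a vertex `10` joined to three pairwise non-adjacent vertices. The excluded triples are
those that give `Qplus`. -/
theorem triple_cert : ∀ a < 10, ∀ b < 10, a ≠ b → adjF a b = false → ∀ c < 10, a ≠ c → b ≠ c →
    adjF a c = false → adjF b c = false →
    (∀ x ∈ [[1, 4, 5], [6, 9, 0]], ∃ y ∈ [a, b, c], y ∉ x) →
    hasCert ([(10, a), (10, b), (10, c)] ++ baseEdges) tripleCerts = true := by
  decide +kernel

/-- `F₄` with a vertex `10` joined to the ends of an edge and to both exceptional vertices for this
edge. -/
theorem pathFour_cert : ∀ a < 10, ∀ b ∈ nbrs a, ∀ w < 10, exceptional a b w = true →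
    ∀ w' < 10, w' ≠ w → exceptional a b w' = true →
    hasCert ([(10, a), (10, b), (10, w), (10, w')] ++ baseEdges) pathFourCerts = true := by
  decide +kernel

/-- `F₄` with two paths of length two in place of the edge `ab`, and with their middle vertices `10`
and `11` joined to one exceptional vertex each. -/
theorem pathJump_cert : ∀ a < 10, ∀ b ∈ nbrs a, ∀ w < 10, exceptional a b w = true →
    ∀ w' < 10, w' ≠ w → exceptional a b w' = true →
    hasCert ([(11, a), (11, b), (11, w'), (10, w)] ++ subdivided a b) pathJumpCerts = true := by
  decide +kernel

/-- `F₄` with the edge at `u` to `v₀` subdivided by `11`, and with a vertex `10` joined to `v₀`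
and `v₁`. -/
def clawBase (u v₀ v₁ : ℕ) : List (ℕ × ℕ) :=
  [(11, u), (11, v₀), (10, v₀), (10, v₁)] ++ edgesWithout u v₀ baseEdges

/-- `F₄` with a vertex `10` joined to all neighbours of `u`. -/
theorem clawAll_cert : ∀ u ∈ cubic,
    hasCert ((nbrs u).map (fun v => (10, v)) ++ baseEdges) clawAllCerts = true := by
  decide +kernel

/-- `F₄` with a vertex `10` joined to `u`, to two neighbours of `u`, and to a vertex not adjacent to
`u`. -/
theorem clawFour_cert : ∀ u ∈ cubic, ∀ v₀ ∈ nbrs u, ∀ v₁ ∈ nbrs u, v₀ ≠ v₁ →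
    ∀ p < 10, p ≠ u → adjF u p = false →
    hasCert ([(10, u), (10, v₀), (10, v₁), (10, p)] ++ baseEdges) clawFourCerts = true := by
  decide +kernel

/-- `clawBase` with `10` joined to `u`, and `11` joined to a vertex not adjacent to `u`. -/
theorem clawJump_cert : ∀ u ∈ cubic, ∀ v₀ ∈ nbrs u, ∀ v₁ ∈ nbrs u, v₀ ≠ v₁ →
    ∀ p < 10, p ≠ u → adjF u p = false →
    hasCert ([(10, u), (11, p)] ++ clawBase u v₀ v₁) clawJumpCerts = true := by
  decide +kernel

/-- `F₄` with the edge `u v₀` replaced by the path `u`, `11`, `12`, `v₀`, with `11` joined to a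
vertex not adjacent to `u` and `12` joined to `v₂`, and with a vertex `10` joined to `v₀`, `v₁` and
`11`. -/
theorem clawFootJump_cert : ∀ u ∈ cubic, ∀ v₀ ∈ nbrs u, ∀ v₁ ∈ nbrs u, v₀ ≠ v₁ →
    ∀ v₂ ∈ nbrs u, v₂ ≠ v₀ → v₂ ≠ v₁ → ∀ p < 10, p ≠ u → adjF u p = false →
    hasCert ([(11, u), (11, 12), (11, p), (12, v₀), (12, v₂), (10, v₀), (10, v₁), (10, 11)] ++
      edgesWithout u v₀ baseEdges) clawFootJumpCerts = true := by
  decide +kernel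

/-- `clawBase` with `10` joined to `u`, with `11` joined to `v₂`, and with a vertex `12` on the edge
`u v₂` that is joined to a vertex not adjacent to `u`. -/
theorem clawLegJump_cert : ∀ u ∈ cubic, ∀ v₀ ∈ nbrs u, ∀ v₁ ∈ nbrs u, v₀ ≠ v₁ →
    ∀ v₂ ∈ nbrs u, v₂ ≠ v₀ → v₂ ≠ v₁ → ∀ p < 10, p ≠ u → adjF u p = false →
    hasCert ([(10, u), (11, v₂), (12, u), (12, v₂), (12, p)] ++
      edgesWithout u v₂ (clawBase u v₀ v₁)) clawLegJumpCerts = true := by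
  decide +kernel

/-- As in `clawLegJump_cert`, but with `10` joined to `11` instead of `u`. -/
theorem clawLegJump_cert' : ∀ u ∈ cubic, ∀ v₀ ∈ nbrs u, ∀ v₁ ∈ nbrs u, v₀ ≠ v₁ →
    ∀ v₂ ∈ nbrs u, v₂ ≠ v₀ → v₂ ≠ v₁ → ∀ p < 10, p ≠ u → adjF u p = false →
    hasCert ([(10, 11), (11, v₂), (12, u), (12, v₂), (12, p)] ++
      edgesWithout u v₂ (clawBase u v₀ v₁)) clawLegJumpCerts' = true := by
  decide +kernel

end

section

variable {G : SimpleGraph V}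

/-! ### Connected sets and lists of vertices -/

/-- The set of entries of a list. -/
def lset (l : List V) : Set V := {x | x ∈ l}

/-- There is an edge of `G` between the two sets. -/
def Joined (G : SimpleGraph V) (S T : Set V) : Prop := ∃ x ∈ S, ∃ y ∈ T, G.Adj x y

@[simp] lemma mem_lset {x : V} {l : List V} : x ∈ lset l ↔ x ∈ l := Iff.rfl

lemma Joined.symm {S T : Set V} (h : Joined G S T) : Joined G T S := by
  obtain ⟨x, hx, y, hy, hxy⟩ := h
  exact ⟨y, hy, x, hx, hxy.symm⟩

lemma Joined.mono {S T S' T' : Set V} (h : Joined G S T) (hS : S ⊆ S') (hT : T ⊆ T') :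
    Joined G S' T' := by
  obtain ⟨x, hx, y, hy, hxy⟩ := h
  exact ⟨x, hS hx, y, hT hy, hxy⟩

lemma induce_singleton_connected (v : V) : (G.induce {v}).Connected := by
  have : Subsingleton ({v} : Set V) := Set.subsingleton_singleton.coe_sort
  exact ⟨.of_subsingleton⟩

lemma connected_union_of_joined {S T : Set V} (hS : (G.induce S).Connected)
    (hT : (G.induce T).Connected) (h : Joined G S T) : (G.induce (S ∪ T)).Connected := by
  obtain ⟨x, hx, y, hy, hxy⟩ := h
  exact induce_union_connected_of_adj hS hT hx hy hxy

lemma connected_union_of_mem {S T : Set V} (hS : (G.induce S).Connected)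
    (hT : (G.induce T).Connected) {x : V} (hx : x ∈ S) (hx' : x ∈ T) :
    (G.induce (S ∪ T)).Connected :=
  SimpleGraph.induce_union_connected hS.preconnected hT.preconnected ⟨x, hx, hx'⟩

lemma connected_lset : ∀ {l : List V}, l.IsChain G.Adj → l ≠ [] → (G.induce (lset l)).Connected
  | [], _, h => absurd rfl h
  | [x], _, _ => by
    have : lset [x] = {x} := by ext; simp
    rw [this]
    exact induce_singleton_connected x
  | x :: y :: l, h, _ => by
    have : lset (x :: y :: l) = {x} ∪ lset (y :: l) := by ext; simp
    rw [this]
    rw [List.isChain_cons_cons] at h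
    exact connected_union_of_joined (induce_singleton_connected x)
      (connected_lset h.2 (by simp)) ⟨x, rfl, y, by simp, h.1⟩

lemma joined_of_isChain_append {l₁ l₂ : List V} (h : (l₁ ++ l₂).IsChain G.Adj) (h₁ : l₁ ≠ [])
    (h₂ : l₂ ≠ []) : Joined G (lset l₁) (lset l₂) := by
  rw [List.isChain_append] at h
  exact ⟨l₁.getLast h₁, List.getLast_mem h₁, l₂.head h₂, List.head_mem h₂,
    h.2.2 _ (List.getLast_mem_getLast? h₁) _ (List.head_mem_head? h₂)⟩

lemma lset_append (l₁ l₂ : List V) : lset (l₁ ++ l₂) = lset l₁ ∪ lset l₂ := by ext; simp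

lemma exists_first {α : Type*} {P : α → Prop} {l : List α} (h : ∃ x ∈ l, P x) :
    ∃ A x B, l = A ++ x :: B ∧ P x ∧ ∀ y ∈ A, ¬ P y := by
  induction l with
  | nil => simp at h
  | cons a l ih =>
    by_cases ha : P a
    · exact ⟨[], a, l, rfl, ha, by simp⟩
    · have : ∃ x ∈ l, P x := by
        obtain ⟨x, hx, hP⟩ := h
        rcases List.mem_cons.1 hx with rfl | hx
        · exact absurd hP ha
        · exact ⟨x, hx, hP⟩
      obtain ⟨A, x, B, rfl, hx, hA⟩ := ih this
      refine ⟨a :: A, x, B, rfl, hx, fun y hy => ?_⟩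
      rcases List.mem_cons.1 hy with rfl | hy
      · exact ha
      · exact hA y hy

lemma exists_last {α : Type*} {P : α → Prop} {l : List α} (h : ∃ x ∈ l, P x) :
    ∃ A x B, l = A ++ x :: B ∧ P x ∧ ∀ y ∈ B, ¬ P y := by
  obtain ⟨A, x, B, h1, h2, h3⟩ := exists_first (l := l.reverse) (P := P) (by simpa using h)
  refine ⟨B.reverse, x, A.reverse, ?_, h2, by simpa using h3⟩
  rw [← l.reverse_reverse, h1]
  simp

lemma exists_path_of_reachable {S : Set V} {x y : V} {hx : x ∈ S} {hy : y ∈ S}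
    (h : (G.induce S).Reachable ⟨x, hx⟩ ⟨y, hy⟩) :
    ∃ l : List V, l.IsChain G.Adj ∧ l.Nodup ∧ l.head? = some x ∧ l.getLast? = some y ∧
      ∀ z ∈ l, z ∈ S := by
  classical
  obtain ⟨w⟩ := h
  let w' := (w.toPath.1.map (SimpleGraph.Embedding.induce S).toHom)
  refine ⟨w'.support, w'.isChain_adj_support, ?_, ?_, ?_, ?_⟩
  · rw [← SimpleGraph.Walk.isPath_def]
    exact w.toPath.2.map (SimpleGraph.Embedding.induce (G := G) S).injective
  · rw [List.head?_eq_some_head w'.support_ne_nil, w'.head_support]; rfl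
  · rw [List.getLast?_eq_some_getLast w'.support_ne_nil, w'.getLast_support]; rfl
  · intro z hz
    rw [SimpleGraph.Walk.support_map, List.mem_map] at hz
    obtain ⟨z', -, rfl⟩ := hz
    exact z'.2

/-- Two vertices adjacent to a connected set are the ends of a path through it. -/
lemma exists_path_through {S : Set V} (hS : (G.induce S).Connected) {z p : V}
    (hz : Joined G {z} S) (hp : Joined G {p} S) :
    ∃ js : List V, (z :: js ++ [p]).IsChain G.Adj ∧ js.Nodup ∧ ∀ j ∈ js, j ∈ S := by
  obtain ⟨_, rfl, x, hx, hzx⟩ := hz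
  obtain ⟨_, rfl, y, hy, hpy⟩ := hp
  obtain ⟨l, h1, h2, h3, h4, h5⟩ := exists_path_of_reachable (hS.preconnected ⟨x, hx⟩ ⟨y, hy⟩)
  refine ⟨l, ?_, h2, h5⟩
  rw [List.cons_append, List.isChain_cons, List.isChain_append]
  refine ⟨fun a ha => ?_, h1, by simp, fun a ha b hb => ?_⟩
  · rw [List.head?_append, h3] at ha
    simp at ha; subst ha; exact hzx
  · rw [h4] at ha
    simp at ha hb; subst ha hb; exact hpy.symm

/-- A path that leaves `K` at `z` and first meets it again at `p`; `js` lists its inner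
vertices. -/
structure IsJump (G : SimpleGraph V) (K : Set V) (z : V) (js : List V) (p : V) : Prop where
  chain : (z :: js ++ [p]).IsChain G.Adj
  nodup : js.Nodup
  avoid : ∀ j ∈ js, j ∉ K

lemma IsJump.mono {K K' : Set V} {z p : V} {js : List V} (h : IsJump G K z js p)
    (hK : ∀ j ∈ js, j ∉ K') : IsJump G K' z js p := ⟨h.chain, h.nodup, hK⟩

lemma IsJump.symm {K : Set V} {z p : V} {js : List V} (h : IsJump G K z js p) :
    IsJump G K p js.reverse z := by
  refine ⟨?_, List.nodup_reverse.2 h.nodup, by simpa using h.avoid⟩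
  have := (List.isChain_reverse (R := G.Adj) (l := z :: js ++ [p])).2
  have h2 : (p :: js.reverse ++ [z]) = (z :: js ++ [p]).reverse := by simp
  rw [h2]
  exact this (h.chain.imp fun a b hab => hab.symm)

/-- Two jumps that meet can be combined. -/
lemma IsJump.trans_of_mem {K : Set V} {z p z' p' j : V} {js js' : List V}
    (h : IsJump G K z js p) (h' : IsJump G K z' js' p') (hj : j ∈ js) (hj' : j ∈ js') :
    ∃ l, IsJump G K z' l p ∧ ∀ i ∈ l, i ∈ js ∨ i ∈ js' := by
  have hjs : js ≠ [] := List.ne_nil_of_mem hj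
  have hjs' : js' ≠ [] := List.ne_nil_of_mem hj'
  have c : js.IsChain G.Adj := (List.isChain_append.1 (List.isChain_cons.1 h.chain).2).1
  have c' : js'.IsChain G.Adj := (List.isChain_append.1 (List.isChain_cons.1 h'.chain).2).1
  have hconn : (G.induce (lset js ∪ lset js')).Connected :=
    connected_union_of_mem (connected_lset c hjs) (connected_lset c' hjs') hj hj'
  have hz : Joined G {z'} (lset js ∪ lset js') := by
    have h1 := joined_of_isChain_append (l₁ := [z']) (l₂ := js' ++ [p']) (by simpa using h'.chain)
      (by simp) (by simp)
    have h2 : (z' :: js').IsChain G.Adj := (List.isChain_append.1 h'.chain).1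
    exact (joined_of_isChain_append (l₁ := [z']) (l₂ := js') h2 (by simp) hjs').mono
      (by intro x; simp) (by intro x hx; exact Or.inr hx)
  have hp : Joined G {p} (lset js ∪ lset js') := by
    have h2 : (js ++ [p]).IsChain G.Adj := (List.isChain_cons.1 h.chain).2
    exact (joined_of_isChain_append h2 hjs (by simp)).symm.mono
      (by intro x; simp) (by intro x hx; exact Or.inl hx)
  obtain ⟨l, h1, h2, h3⟩ := exists_path_through hconn hz hp
  refine ⟨l, ⟨h1, h2, fun i hi => ?_⟩, h3⟩
  rcases h3 i hi with h4 | h4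
  · exact h.avoid i h4
  · exact h'.avoid i h4

/-! ### Small cuts -/

/-- A path from `D` to a vertex of `K` off `D`, cut down to the piece between its first vertex of
this kind and the last vertex of `D` before. -/
lemma exists_jump_of_reachable {T D K : Set V} {d q : V} {hd : d ∈ T} {hq : q ∈ T}
    (h : (G.induce T).Reachable ⟨d, hd⟩ ⟨q, hq⟩) (hdD : d ∈ D) (hqK : q ∈ K) (hqD : q ∉ D) :
    ∃ z ∈ D, ∃ p ∈ K, p ∉ D ∧ p ∈ T ∧ ∃ js, IsJump G (K ∪ D) z js p ∧ ∀ j ∈ js, j ∈ T := by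
  obtain ⟨l, h1, h2, h3, h4, h5⟩ := exists_path_of_reachable h
  obtain ⟨A, p, B, rfl, hp, hA⟩ := exists_first (l := l) (P := fun x => x ∈ K ∧ x ∉ D)
    ⟨q, List.mem_of_getLast? h4, hqK, hqD⟩
  have hA0 : A ≠ [] := by
    rintro rfl
    simp at h3
    subst h3
    exact hp.2 hdD
  obtain ⟨A₁, z, js, rfl, hz, hjs⟩ := exists_last (l := A) (P := fun x => x ∈ D)
    ⟨d, by
      rw [List.head?_append_of_ne_nil _ hA0] at h3
      exact List.mem_of_head? h3, hdD⟩
  refine ⟨z, hz, p, hp.1, hp.2, h5 p (by simp), js, ⟨?_, ?_, ?_⟩, ?_⟩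
  · have e : A₁ ++ z :: js ++ p :: B = A₁ ++ ((z :: js ++ [p]) ++ B) := by simp
    rw [e] at h1
    exact (List.isChain_append.1 (List.isChain_append.1 h1).2.1).1
  · refine h2.sublist ?_
    simp only [List.append_assoc, List.cons_append]
    exact (List.sublist_append_left _ _).trans
      ((List.sublist_cons_self _ _).trans (List.sublist_append_right _ _))
  · rintro j hj (h | h)
    · exact hA j (by simp [hj]) ⟨h, hjs j hj⟩
    · exact hjs j hj h
  · exact fun j hj => h5 j (by simp [hj])

/-- In an internally `4`-connected graph, let `S` be a set of at most three vertices, and `D` a set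
disjoint from it, such that `S` is not independent or `D` is not a single vertex. If `K` has two
vertices off `S` and `D`, then a path that avoids `S` leads from `D` to such a vertex. One vertex
would not do, as `S` may cut off that vertex. -/
lemma exists_jump [Finite V] (hG : InternallyFourConnected G) (hcard : 6 < Nat.card V)
    {S D K : Set V} (hS : S.ncard ≤ 3) (hSD : Disjoint S D) (hD : D.Nonempty)
    (hD2 : (∃ x ∈ S, ∃ y ∈ S, G.Adj x y) ∨ ∃ x ∈ D, ∃ y ∈ D, x ≠ y)
    (hK : ∃ x ∈ K, ∃ y ∈ K, x ≠ y ∧ x ∉ D ∧ y ∉ D ∧ x ∉ S ∧ y ∉ S) :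
    ∃ z ∈ D, ∃ p ∈ K, p ∉ D ∧ p ∉ S ∧ ∃ js, IsJump G (K ∪ D ∪ S) z js p := by
  obtain ⟨k, hk, k', hk', hkk, hkD, hkD', hkS, hkS'⟩ := hK
  have main : ∀ T : Set V, T ⊆ Sᶜ → (G.induce T).Preconnected → (∃ d ∈ D, d ∈ T) →
      (∃ q ∈ K, q ∈ T ∧ q ∉ D) →
      ∃ z ∈ D, ∃ p ∈ K, p ∉ D ∧ p ∉ S ∧ ∃ js, IsJump G (K ∪ D ∪ S) z js p := by
    rintro T hTS hT ⟨d, hd, hdT⟩ ⟨q, hq, hqT, hqD⟩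
    obtain ⟨z, hz, p, hp, hpD, hpT, js, hjs, hjT⟩ :=
      exists_jump_of_reachable (hT ⟨d, hdT⟩ ⟨q, hqT⟩) hd hq hqD
    refine ⟨z, hz, p, hp, hpD, hTS hpT, js, hjs.mono fun j hj => ?_⟩
    rintro (h | h)
    · exact hjs.avoid j hj h
    · exact hTS (hjT j hj) h
  by_cases hcut : IsCut G S
  · rcases lt_or_eq_of_le hS with hlt | heq
    · exact absurd hcut (hG.1.2 S hlt)
    · rcases hG.2.2 with ⟨⟨e⟩⟩ | h
      · have := Nat.card_congr e.toEquiv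
        simp at this
        omega
      · obtain ⟨hind, v, hv, -, hconn⟩ := h S heq hcut
        have hD2 : ∃ x ∈ D, ∃ y ∈ D, x ≠ y := by
          rcases hD2 with ⟨x, hx, y, hy, hxy⟩ | h
          · exact absurd hxy (hind hx hy hxy.ne)
          · exact h
        refine main (insert v S)ᶜ (by intro x hx; simp at hx; simp [hx]) hconn.preconnected ?_ ?_
        · obtain ⟨x, hx, y, hy, hxy⟩ := hD2
          by_cases hxv : x = v
          · refine ⟨y, hy, ?_⟩
            have := Set.disjoint_right.1 hSD hy
            simp [this, ← hxv, hxy.symm]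
          · refine ⟨x, hx, ?_⟩
            have := Set.disjoint_right.1 hSD hx
            simp [this, hxv]
        · by_cases hkv : k = v
          · exact ⟨k', hk', by simp [hkS', ← hkv, hkk.symm], hkD'⟩
          · exact ⟨k, hk, by simp [hkS, hkv], hkD⟩
  · obtain ⟨d, hd⟩ := hD
    refine main Sᶜ subset_rfl (not_not.1 hcut) ⟨d, hd, Set.disjoint_right.1 hSD hd⟩
      ⟨k, hk, hkS, hkD⟩

end

section

variable {G : SimpleGraph V}

/-! ### Minors from a contraction of a part of a subdivision -/

/-- A contraction of a part of a subdivision of `F₄`: the vertex set `Out` of the part is divided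
into connected sets `N i`, for the vertices `i` of `F₄` with `alive i`; the branch vertex `vert i`
is in `N i`, and the sets of two vertices are joined if `keep` holds for them. -/
structure Home (G : SimpleGraph V) (alive : ℕ → Prop) (keep : ℕ → ℕ → Prop) (vert : ℕ → V)
    (Out : Set V) (N : ℕ → Set V) : Prop where
  conn : ∀ i, alive i → (G.induce (N i)).Connected
  vert_mem : ∀ i, alive i → vert i ∈ N i
  sub : ∀ i, N i ⊆ Out
  empty : ∀ i, ¬ alive i → N i = ∅
  disj : ∀ i j, i ≠ j → Disjoint (N i) (N j)
  joined : ∀ i j, keep i j → Joined G (N i) (N j)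

/-- The set with label `i` in a list of labelled sets. -/
def labelled (X : List (ℕ × Set V)) (i : ℕ) : Set V := {v | ∃ S, (i, S) ∈ X ∧ v ∈ S}

lemma subset_labelled {X : List (ℕ × Set V)} {i : ℕ} {S : Set V} (h : (i, S) ∈ X) :
    S ⊆ labelled X i := fun _ hv => ⟨S, h, hv⟩

lemma labelled_eq {X : List (ℕ × Set V)} (hX : (X.map Prod.fst).Nodup) {i : ℕ} {S : Set V}
    (h : (i, S) ∈ X) : labelled X i = S := by
  refine Set.Subset.antisymm ?_ (subset_labelled h)
  rintro v ⟨T, hT, hv⟩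
  have := List.inj_on_of_nodup_map hX h hT rfl
  simp only [Prod.mk.injEq, true_and] at this
  exact this ▸ hv

lemma labelled_eq_empty {X : List (ℕ × Set V)} {i : ℕ} (h : i ∉ X.map Prod.fst) :
    labelled X i = ∅ := by
  rw [Set.eq_empty_iff_forall_notMem]
  rintro v ⟨S, hS, -⟩
  exact h (List.mem_map.2 ⟨_, hS, rfl⟩)

/-- A connected set that meets `Out` in the vertex `a` only. -/
structure IsTail (G : SimpleGraph V) (Out : Set V) (a : V) (T : Set V) : Prop where
  conn : (G.induce T).Connected
  mem : a ∈ T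
  eq : ∀ y ∈ T, y ∈ Out → y = a

/-- A connected set disjoint from `Out`. -/
structure IsCore (G : SimpleGraph V) (Out : Set V) (S : Set V) : Prop where
  conn : (G.induce S).Connected
  disj : ∀ y ∈ S, y ∉ Out

/-- A set that can be added to the set of a branch vertex of a contraction, or be the set of a new
vertex. -/
def IsEntry (G : SimpleGraph V) (alive : ℕ → Prop) (vert : ℕ → V) (Out : Set V)
    (x : ℕ × Set V) : Prop :=
  (alive x.1 ∧ IsTail G Out (vert x.1) x.2) ∨ (¬ alive x.1 ∧ IsCore G Out x.2)

section

variable {alive : ℕ → Prop} {keep : ℕ → ℕ → Prop} {vert : ℕ → V} {Out : Set V} {N : ℕ → Set V}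
  {X : List (ℕ × Set V)} {E : List (ℕ × ℕ)}

lemma Home.joined_labelled {i j : ℕ} {S T : Set V} (N : ℕ → Set V) (hi : (i, S) ∈ X)
    (hj : (j, T) ∈ X) (h : Joined G S T) :
    Joined G (N i ∪ labelled X i) (N j ∪ labelled X j) :=
  h.mono ((subset_labelled hi).trans Set.subset_union_right)
    ((subset_labelled hj).trans Set.subset_union_right)

lemma Home.joined_labelled_left {i j : ℕ} {S : Set V} (hi : (i, S) ∈ X)
    (h : Joined G S (N j)) :
    Joined G (N i ∪ labelled X i) (N j ∪ labelled X j) :=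
  h.mono ((subset_labelled hi).trans Set.subset_union_right) Set.subset_union_left

/-- Adding the labelled sets `X` to the sets of a contraction. A pair in `E` is either an edge that
the contraction provides, or one due to the sets in `X`. -/
lemma Home.branchSets (h : Home G alive keep vert Out N) (hlab : (X.map Prod.fst).Nodup)
    (hdis : (X.map Prod.snd).Pairwise Disjoint)
    (hX : ∀ x ∈ X, IsEntry G alive vert Out x)
    (hE : ∀ e ∈ E, keep e.1 e.2 ∨
      Joined G (N e.1 ∪ labelled X e.1) (N e.2 ∪ labelled X e.2)) :
    BranchSets G E (fun i => N i ∪ labelled X i) := by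
  classical
  have hlabel : ∀ i, labelled X i = ∅ ∨ ∃ S, (i, S) ∈ X ∧ labelled X i = S := by
    intro i
    by_cases hi : i ∈ X.map Prod.fst
    · obtain ⟨⟨j, S⟩, hS, rfl⟩ := List.mem_map.1 hi
      exact Or.inr ⟨S, hS, labelled_eq hlab hS⟩
    · exact Or.inl (labelled_eq_empty hi)
  have hNX : ∀ i j, i ≠ j → Disjoint (N i) (labelled X j) := by
    intro i j hij
    rw [Set.disjoint_left]
    rintro v hv ⟨S, hS, hvS⟩
    rcases hX _ hS with ⟨hj, hT⟩ | ⟨-, hC⟩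
    · obtain rfl := hT.eq v hvS (h.sub i hv)
      exact Set.disjoint_left.1 (h.disj i j hij) hv (h.vert_mem j hj)
    · exact hC.disj v hvS (h.sub i hv)
  have hXX : ∀ i j, i ≠ j → Disjoint (labelled X i) (labelled X j) := by
    intro i j hij
    rw [Set.disjoint_left]
    rintro v ⟨S, hS, hvS⟩ ⟨T, hT, hvT⟩
    obtain ⟨m, hm, hmS⟩ := List.getElem_of_mem hS
    obtain ⟨n, hn, hnT⟩ := List.getElem_of_mem hT
    rw [List.pairwise_iff_getElem] at hdis
    have hmn : m ≠ n := by
      rintro rfl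
      rw [hmS] at hnT
      exact hij (congrArg Prod.fst hnT)
    have e1 : (X.map Prod.snd)[m]'(by simpa using hm) = S := by simp [hmS]
    have e2 : (X.map Prod.snd)[n]'(by simpa using hn) = T := by simp [hnT]
    rcases lt_or_gt_of_ne hmn with hlt | hlt
    · have := hdis m n (by simpa using hm) (by simpa using hn) hlt
      rw [e1, e2] at this
      exact Set.disjoint_left.1 this hvS hvT
    · have := hdis n m (by simpa using hn) (by simpa using hm) hlt
      rw [e1, e2] at this
      exact Set.disjoint_left.1 this hvT hvS
  refine ⟨fun i hi => ?_, fun i j hij => ?_, fun e he => ?_⟩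
  · by_cases ha : alive i
    · rcases hlabel i with h0 | ⟨S, hS, h0⟩
      · rw [h0, Set.union_empty]
        exact h.conn i ha
      · rw [h0]
        rcases hX _ hS with ⟨-, hT⟩ | ⟨hna, -⟩
        · exact connected_union_of_mem (h.conn i ha) hT.conn (h.vert_mem i ha) hT.mem
        · exact absurd ha hna
    · rw [h.empty i ha, Set.empty_union] at hi ⊢
      rcases hlabel i with h0 | ⟨S, hS, h0⟩
      · rw [h0] at hi
        simp at hi
      · rw [h0]
        rcases hX _ hS with ⟨ha', -⟩ | ⟨-, hC⟩
        · exact absurd ha' ha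
        · exact hC.conn
  · rw [Set.disjoint_union_left, Set.disjoint_union_right, Set.disjoint_union_right]
    exact ⟨⟨h.disj i j hij, hNX i j hij⟩, (hNX j i hij.symm).symm, hXX i j hij⟩
  · rcases hE e he with hk | hj
    · exact (h.joined _ _ hk).mono Set.subset_union_left Set.subset_union_left
    · exact hj

/-- If `F₄`, or a part of it, with the new vertices and edges that the labelled sets `X` provide has
a certificate, then `G` has a `K_{3,4}` minor. -/
lemma Home.isMinor_K34 (h : Home G alive keep vert Out N) {L : List Cert}
    (hL : hasCert E L = true) (hwf : L.all Cert.wellFormed = true)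
    (hE13 : ∀ e ∈ E, e.1 < 13 ∧ e.2 < 13)
    (hlab : (X.map Prod.fst).Nodup) (hdis : (X.map Prod.snd).Pairwise Disjoint)
    (hX : ∀ x ∈ X, IsEntry G alive vert Out x)
    (hE : ∀ e ∈ E, keep e.1 e.2 ∨
      Joined G (N e.1 ∪ labelled X e.1) (N e.2 ∪ labelled X e.2)) : IsMinor K34 G :=
  isMinor_K34_of_hasCert (h.branchSets hlab hdis hX hE) hE13 hwf hL

end

/-! ### Contractions of `F₄` minus a vertex of degree three -/

/-- `i` and `j` number adjacent vertices of `F₄`; `adjF` is meaningless outside this range. -/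
abbrev IsEdge (i j : ℕ) : Prop := adjF i j = true ∧ i < 10 ∧ j < 10

/-- The edges of `F₄` that are not incident with `u`. -/
def keepClaw (u i j : ℕ) : Prop := IsEdge i j ∧ i ≠ u ∧ j ≠ u

/-- A part `Out` of a graph that can be contracted to `F₄` minus the vertex `u` of degree three, so
that a given vertex of `Out` other than the branch vertices of the neighbours of `u` goes to a
vertex that is not adjacent to `u`. There are at least two such vertices of `Out`. -/
structure ClawContext (G : SimpleGraph V) (u : ℕ) (vert : ℕ → V) (Out : Set V) : Prop where
  cubic : u ∈ cubic
  home : ∃ N, Home G (fun i => i < 10 ∧ i ≠ u) (keepClaw u) vert Out N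
  home_of_mem : ∀ p ∈ Out, (∀ v ∈ nbrs u, p ≠ vert v) → ∃ N q,
    Home G (fun i => i < 10 ∧ i ≠ u) (keepClaw u) vert Out N ∧ p ∈ N q ∧ q < 10 ∧ q ≠ u ∧
      adjF u q = false
  two : ∃ x ∈ Out, ∃ y ∈ Out, x ≠ y ∧ (∀ v ∈ nbrs u, x ≠ vert v) ∧ ∀ v ∈ nbrs u, y ≠ vert v

/-- `v₀`, `v₁`, `v₂` are the neighbours of `u`. -/
structure IsNbrs (u v₀ v₁ v₂ : ℕ) : Prop where
  mem₀ : v₀ ∈ nbrs u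
  mem₁ : v₁ ∈ nbrs u
  mem₂ : v₂ ∈ nbrs u
  ne₀₁ : v₀ ≠ v₁
  ne₀₂ : v₀ ≠ v₂
  ne₁₂ : v₁ ≠ v₂

lemma IsNbrs.swap {u v₀ v₁ v₂ : ℕ} (h : IsNbrs u v₀ v₁ v₂) : IsNbrs u v₁ v₀ v₂ :=
  ⟨h.2, h.1, h.3, h.4.symm, h.6, h.5⟩

lemma mem_nbrs {u v : ℕ} : v ∈ nbrs u ↔ v < 10 ∧ adjF u v = true := by
  simp [nbrs]

lemma nbrs_cases : ∀ u ∈ cubic, ∀ v₀ ∈ nbrs u, ∀ v₁ ∈ nbrs u, v₀ ≠ v₁ → ∀ v₂ ∈ nbrs u, v₀ ≠ v₂ →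
    v₁ ≠ v₂ → ∀ w ∈ nbrs u, w = v₀ ∨ w = v₁ ∨ w = v₂ := by decide

lemma IsNbrs.eq_or {u v₀ v₁ v₂ w : ℕ} (h : IsNbrs u v₀ v₁ v₂) (hu : u ∈ cubic)
    (hw : w ∈ nbrs u) : w = v₀ ∨ w = v₁ ∨ w = v₂ :=
  nbrs_cases u hu v₀ h.1 v₁ h.2 h.4 v₂ h.3 h.5 h.6 w hw

lemma baseEdges_cases : ∀ u ∈ cubic, ∀ e ∈ baseEdges, (IsEdge e.1 e.2 ∧ e.1 ≠ u ∧ e.2 ≠ u) ∨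
    ∃ w ∈ nbrs u, e = (u, w) ∨ e = (w, u) := by decide

lemma baseEdges_lt : ∀ e ∈ baseEdges, e.1 < 13 ∧ e.2 < 13 := by decide

lemma cubic_lt : ∀ u ∈ cubic, u < 10 := by decide

lemma ne_of_mem_nbrs : ∀ u ∈ cubic, ∀ v ∈ nbrs u, v ≠ u := by decide

section

variable {u v₀ v₁ v₂ : ℕ} {vert : ℕ → V} {Out : Set V}

lemma ClawContext.entry_tail (h : ClawContext G u vert Out) {v : ℕ} (hv : v ∈ nbrs u) {T : Set V}
    (hT : IsTail G Out (vert v) T) : IsEntry G (fun i => i < 10 ∧ i ≠ u) vert Out (v, T) :=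
  Or.inl ⟨⟨(mem_nbrs.1 hv).1, ne_of_mem_nbrs u h.cubic v hv⟩, hT⟩

lemma entry_core {i : ℕ} (hi : i = u ∨ 10 ≤ i) {S : Set V} (hS : IsCore G Out S) :
    IsEntry G (fun i => i < 10 ∧ i ≠ u) vert Out (i, S) :=
  Or.inr ⟨by rintro ⟨h1, h2⟩; rcases hi with hi | hi <;> simp_all; omega, hS⟩

end

/-! ### Minors from a claw and a connected set attached to it -/

lemma pairwise_disjoint_lset {L : List (List V)} (h : L.flatten.Nodup) :
    (L.map lset).Pairwise Disjoint := by
  rw [List.pairwise_map]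
  refine (List.nodup_flatten.1 h).2.imp fun {a b} hab => ?_
  exact Set.disjoint_left.2 fun x hx hx' => hab hx hx'

section

variable {u v₀ v₁ v₂ : ℕ} {vert : ℕ → V} {Out : Set V}

lemma IsNbrs.edge_cases (hv : IsNbrs u v₀ v₁ v₂) (hu : u ∈ cubic) {e : ℕ × ℕ}
    (he : e ∈ baseEdges) : keepClaw u e.1 e.2 ∨ (e = (u, v₀) ∨ e = (v₀, u)) ∨
      (e = (u, v₁) ∨ e = (v₁, u)) ∨ (e = (u, v₂) ∨ e = (v₂, u)) := by
  rcases baseEdges_cases u hu e he with hk | ⟨w, hw, hE⟩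
  · exact Or.inl hk
  · rcases hv.eq_or hu hw with rfl | rfl | rfl <;> simp [hE]

/-- The labelled sets for a claw with ends `T₀`, `T₁`, `T₂` and centre `C`, and some further
sets. -/
def clawSets (u v₀ v₁ v₂ : ℕ) (T₀ T₁ T₂ C : List V) (R : List (ℕ × List V)) :
    List (ℕ × Set V) :=
  [(v₀, lset T₀), (v₁, lset T₁), (v₂, lset T₂), (u, lset C)] ++ R.map fun r => (r.1, lset r.2)

/-- The rest of the subdivision, the spokes, and the sets `R`, which become new vertices, are
contracted together. -/
lemma ClawContext.isMinor_K34 (h : ClawContext G u vert Out) (hv : IsNbrs u v₀ v₁ v₂)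
    {N : ℕ → Set V} (hN : Home G (fun i => i < 10 ∧ i ≠ u) (keepClaw u) vert Out N)
    {T₀ T₁ T₂ C : List V} {R : List (ℕ × List V)}
    (hnd : (T₀ ++ T₁ ++ T₂ ++ C ++ (R.map Prod.snd).flatten).Nodup)
    (h₀ : IsTail G Out (vert v₀) (lset T₀)) (h₁ : IsTail G Out (vert v₁) (lset T₁))
    (h₂ : IsTail G Out (vert v₂) (lset T₂)) (hC : IsCore G Out (lset C))
    (hR : ∀ r ∈ R, 10 ≤ r.1 ∧ r.1 < 13 ∧ IsCore G Out (lset r.2)) (hR' : (R.map Prod.fst).Nodup)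
    {E : List (ℕ × ℕ)} {L : List Cert} (hL : hasCert E L = true)
    (hwf : L.all Cert.wellFormed = true)
    (hE : ∀ e ∈ E, keepClaw u e.1 e.2 ∨
      Joined G (N e.1 ∪ labelled (clawSets u v₀ v₁ v₂ T₀ T₁ T₂ C R) e.1)
        (N e.2 ∪ labelled (clawSets u v₀ v₁ v₂ T₀ T₁ T₂ C R) e.2))
    (hE13 : ∀ e ∈ E, e.1 < 13 ∧ e.2 < 13) :
    IsMinor K34 G := by
  have hu := cubic_lt u h.cubic
  have l0 := (mem_nbrs.1 hv.mem₀).1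
  have l1 := (mem_nbrs.1 hv.mem₁).1
  have l2 := (mem_nbrs.1 hv.mem₂).1
  have n0 := ne_of_mem_nbrs u h.cubic _ hv.mem₀
  have n1 := ne_of_mem_nbrs u h.cubic _ hv.mem₁
  have n2 := ne_of_mem_nbrs u h.cubic _ hv.mem₂
  refine hN.isMinor_K34 (X := clawSets u v₀ v₁ v₂ T₀ T₁ T₂ C R) hL hwf hE13 ?_ ?_ ?_
    hE
  · have hRm : ∀ r ∈ R.map Prod.fst, 10 ≤ r := by
      intro r hr
      obtain ⟨r', hr', rfl⟩ := List.mem_map.1 hr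
      exact (hR r' hr').1
    have e1 : (clawSets u v₀ v₁ v₂ T₀ T₁ T₂ C R).map Prod.fst =
        [v₀, v₁, v₂, u] ++ R.map Prod.fst := by simp [clawSets, Function.comp_def]
    rw [e1, List.nodup_append]
    refine ⟨by simp [hv.ne₀₁, hv.ne₀₂, hv.ne₁₂, n0, n1, n2], hR', ?_⟩
    intro a ha b hb hab
    have := hRm b hb
    simp at ha
    omega
  · have e1 : (clawSets u v₀ v₁ v₂ T₀ T₁ T₂ C R).map Prod.snd =
        ([T₀, T₁, T₂, C] ++ R.map Prod.snd).map lset := by simp [clawSets, Function.comp_def]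
    rw [e1]
    apply pairwise_disjoint_lset
    simpa using hnd
  · intro x hx
    rw [clawSets, List.mem_append, List.mem_map] at hx
    rcases hx with hx | ⟨r, hr, rfl⟩
    · simp only [List.mem_cons, List.not_mem_nil, or_false] at hx
      rcases hx with rfl | rfl | rfl | rfl
      · exact h.entry_tail hv.mem₀ h₀
      · exact h.entry_tail hv.mem₁ h₁
      · exact h.entry_tail hv.mem₂ h₂
      · exact entry_core (Or.inl rfl) hC
    · exact entry_core (Or.inr (hR r hr).1) (hR r hr).2.2

lemma mem_edgesWithout {a b : ℕ} {E : List (ℕ × ℕ)} {e : ℕ × ℕ} :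
    e ∈ edgesWithout a b E ↔ e ∈ E ∧ e ≠ (a, b) ∧ e ≠ (b, a) := by
  simp [edgesWithout]

section

variable {T₀ T₁ T₂ C B Z Y : List V}

/-- A centre `C` and the ends `T₀`, `T₁`, `T₂` of the legs of a claw, as connected sets to be
contracted. The edges or sets that link them are not part of the structure. -/
structure Spokes (G : SimpleGraph V) (Out : Set V) (a₀ a₁ a₂ : V) (T₀ T₁ T₂ C : List V) :
    Prop where
  tail₀ : IsTail G Out a₀ (lset T₀)
  tail₁ : IsTail G Out a₁ (lset T₁)
  tail₂ : IsTail G Out a₂ (lset T₂)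
  core : IsCore G Out (lset C)

/-- A claw, and a second connected set joined to its three ends. -/
theorem ClawContext.isMinor_of_two_centres (h : ClawContext G u vert Out)
    (hv : IsNbrs u v₀ v₁ v₂) (hs : Spokes G Out (vert v₀) (vert v₁) (vert v₂) T₀ T₁ T₂ C)
    (hB : IsCore G Out (lset B)) (hnd : (T₀ ++ T₁ ++ T₂ ++ C ++ B).Nodup)
    (jCT₀ : Joined G (lset C) (lset T₀)) (jCT₁ : Joined G (lset C) (lset T₁))
    (jCT₂ : Joined G (lset C) (lset T₂)) (jBT₀ : Joined G (lset B) (lset T₀))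
    (jBT₁ : Joined G (lset B) (lset T₁)) (jBT₂ : Joined G (lset B) (lset T₂)) :
    IsMinor K34 G := by
  obtain ⟨N, hN⟩ := h.home
  have key : ∀ i j S T, (i, S) ∈ clawSets u v₀ v₁ v₂ T₀ T₁ T₂ C [(10, B)] →
      (j, T) ∈ clawSets u v₀ v₁ v₂ T₀ T₁ T₂ C [(10, B)] → Joined G S T →
      Joined G (N i ∪ labelled (clawSets u v₀ v₁ v₂ T₀ T₁ T₂ C [(10, B)]) i)
        (N j ∪ labelled (clawSets u v₀ v₁ v₂ T₀ T₁ T₂ C [(10, B)]) j) :=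
    fun i j S T hi hj hST => Home.joined_labelled N hi hj hST
  replace jCT₀ := key u v₀ _ _ (by simp [clawSets]) (by simp [clawSets]) jCT₀
  replace jCT₁ := key u v₁ _ _ (by simp [clawSets]) (by simp [clawSets]) jCT₁
  replace jCT₂ := key u v₂ _ _ (by simp [clawSets]) (by simp [clawSets]) jCT₂
  replace jBT₀ := key 10 v₀ _ _ (by simp [clawSets]) (by simp [clawSets]) jBT₀
  replace jBT₁ := key 10 v₁ _ _ (by simp [clawSets]) (by simp [clawSets]) jBT₁
  replace jBT₂ := key 10 v₂ _ _ (by simp [clawSets]) (by simp [clawSets]) jBT₂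
  refine h.isMinor_K34 hv hN (R := [(10, B)]) (by simpa using hnd) hs.1 hs.2 hs.3 hs.4
    (by simp [hB]) (by simp) (clawAll_cert u h.cubic) (by decide)
    (fun e he => ?_) (fun e he => ?_)
  · rw [List.mem_append, List.mem_map] at he
    rcases he with ⟨w, hw, rfl⟩ | he
    · rcases hv.eq_or h.cubic hw with rfl | rfl | rfl
      exacts [Or.inr jBT₀, Or.inr jBT₁, Or.inr jBT₂]
    · rcases hv.edge_cases h.cubic he with hk | (rfl | rfl) | (rfl | rfl) | (rfl | rfl)
      exacts [Or.inl hk, Or.inr jCT₀, Or.inr jCT₀.symm, Or.inr jCT₁, Or.inr jCT₁.symm,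
        Or.inr jCT₂, Or.inr jCT₂.symm]
  · rw [List.mem_append, List.mem_map] at he
    rcases he with ⟨w, hw, rfl⟩ | he
    · exact ⟨by simp, (mem_nbrs.1 hw).1.trans (by norm_num)⟩
    · exact baseEdges_lt e he

/-- A claw, and a connected set joined to its centre, to two of its ends, and to a vertex
elsewhere. -/
theorem ClawContext.isMinor_of_four (h : ClawContext G u vert Out)
    (hv : IsNbrs u v₀ v₁ v₂) (hs : Spokes G Out (vert v₀) (vert v₁) (vert v₂) T₀ T₁ T₂ C)
    (hB : IsCore G Out (lset B))
    (hnd : (T₀ ++ T₁ ++ T₂ ++ C ++ B).Nodup)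
    (jCT₀ : Joined G (lset C) (lset T₀))
    (jCT₁ : Joined G (lset C) (lset T₁))
    (jCT₂ : Joined G (lset C) (lset T₂))
    (jBC : Joined G (lset B) (lset C))
    (jBT₀ : Joined G (lset B) (lset T₀))
    (jBT₁ : Joined G (lset B) (lset T₁))
    {p : V} (hp : p ∈ Out) (hpv : ∀ v ∈ nbrs u, p ≠ vert v)
    (jp : Joined G {p} (lset B)) : IsMinor K34 G := by
  obtain ⟨N, q, hN, hpq, hq, hqu, hadj⟩ := h.home_of_mem p hp hpv
  have key : ∀ i j S T, (i, S) ∈ clawSets u v₀ v₁ v₂ T₀ T₁ T₂ C [(10, B)] →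
      (j, T) ∈ clawSets u v₀ v₁ v₂ T₀ T₁ T₂ C [(10, B)] → Joined G S T →
      Joined G (N i ∪ labelled (clawSets u v₀ v₁ v₂ T₀ T₁ T₂ C [(10, B)]) i)
        (N j ∪ labelled (clawSets u v₀ v₁ v₂ T₀ T₁ T₂ C [(10, B)]) j) :=
    fun i j S T hi hj hST => Home.joined_labelled N hi hj hST
  replace jCT₀ := key u v₀ _ _ (by simp [clawSets]) (by simp [clawSets]) jCT₀
  replace jCT₁ := key u v₁ _ _ (by simp [clawSets]) (by simp [clawSets]) jCT₁
  replace jCT₂ := key u v₂ _ _ (by simp [clawSets]) (by simp [clawSets]) jCT₂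
  replace jBC := key 10 u _ _ (by simp [clawSets]) (by simp [clawSets]) jBC
  replace jBT₀ := key 10 v₀ _ _ (by simp [clawSets]) (by simp [clawSets]) jBT₀
  replace jBT₁ := key 10 v₁ _ _ (by simp [clawSets]) (by simp [clawSets]) jBT₁
  replace jp := Home.joined_labelled_left (X := clawSets u v₀ v₁ v₂ T₀ T₁ T₂ C [(10, B)])
    (i := 10) (j := q) (by simp [clawSets])
      (jp.symm.mono subset_rfl (Set.singleton_subset_iff.2 hpq))
  refine h.isMinor_K34 hv hN (R := [(10, B)]) (by simpa using hnd) hs.1 hs.2 hs.3 hs.4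
    (by simp [hB]) (by simp)
    (clawFour_cert u h.cubic v₀ hv.mem₀ v₁ hv.mem₁ hv.ne₀₁ q hq hqu hadj) (by decide)
    (fun e he => ?_) (fun e he => ?_)
  · simp only [List.mem_append, List.mem_cons, List.not_mem_nil, or_false] at he
    rcases he with (rfl | rfl | rfl | rfl) | he
    pick_goal -1
    · rcases hv.edge_cases h.cubic he with hk | (rfl | rfl) | (rfl | rfl) | (rfl | rfl)
      · exact Or.inl hk
      all_goals first
        | exact Or.inr jCT₀ | exact Or.inr jCT₁ | exact Or.inr jCT₂ | exact Or.inr jBC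
        | exact Or.inr jBT₀ | exact Or.inr jBT₁ | exact Or.inr jCT₀.symm | exact Or.inr jCT₁.symm
        | exact Or.inr jCT₂.symm
    all_goals first
      | exact Or.inr jCT₀ | exact Or.inr jCT₁ | exact Or.inr jCT₂ | exact Or.inr jBC
      | exact Or.inr jBT₀ | exact Or.inr jBT₁ | exact Or.inr jCT₀.symm | exact Or.inr jCT₁.symm
      | exact Or.inr jCT₂.symm | exact Or.inr jp
  · have hu := cubic_lt u h.cubic
    have l0 := (mem_nbrs.1 hv.mem₀).1
    have l1 := (mem_nbrs.1 hv.mem₁).1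
    have l2 := (mem_nbrs.1 hv.mem₂).1
    simp only [List.mem_append, List.mem_cons, List.not_mem_nil, or_false] at he
    rcases he with (rfl | rfl | rfl | rfl) | he
    pick_goal -1
    · exact baseEdges_lt e he
    all_goals dsimp only; omega

/-- A claw with a connected set `Z` on its first leg that is joined to a vertex elsewhere, and a
connected set `B` joined to the centre and to the first two ends. -/
theorem ClawContext.isMinor_of_jump (h : ClawContext G u vert Out)
    (hv : IsNbrs u v₀ v₁ v₂) (hs : Spokes G Out (vert v₀) (vert v₁) (vert v₂) T₀ T₁ T₂ C)
    (hB : IsCore G Out (lset B)) (hZ : IsCore G Out (lset Z))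
    (hnd : (T₀ ++ T₁ ++ T₂ ++ C ++ (B ++ Z)).Nodup)
    (jCT₁ : Joined G (lset C) (lset T₁))
    (jCT₂ : Joined G (lset C) (lset T₂))
    (jCZ : Joined G (lset C) (lset Z))
    (jZT₀ : Joined G (lset Z) (lset T₀))
    (jBC : Joined G (lset B) (lset C))
    (jBT₀ : Joined G (lset B) (lset T₀))
    (jBT₁ : Joined G (lset B) (lset T₁))
    {p : V} (hp : p ∈ Out) (hpv : ∀ v ∈ nbrs u, p ≠ vert v)
    (jp : Joined G {p} (lset Z)) : IsMinor K34 G := by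
  obtain ⟨N, q, hN, hpq, hq, hqu, hadj⟩ := h.home_of_mem p hp hpv
  have key : ∀ i j S T, (i, S) ∈ clawSets u v₀ v₁ v₂ T₀ T₁ T₂ C [(10, B), (11, Z)] →
      (j, T) ∈ clawSets u v₀ v₁ v₂ T₀ T₁ T₂ C [(10, B), (11, Z)] → Joined G S T →
      Joined G (N i ∪ labelled (clawSets u v₀ v₁ v₂ T₀ T₁ T₂ C [(10, B), (11, Z)]) i)
        (N j ∪ labelled (clawSets u v₀ v₁ v₂ T₀ T₁ T₂ C [(10, B), (11, Z)]) j) :=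
    fun i j S T hi hj hST => Home.joined_labelled N hi hj hST
  replace jCT₁ := key u v₁ _ _ (by simp [clawSets]) (by simp [clawSets]) jCT₁
  replace jCT₂ := key u v₂ _ _ (by simp [clawSets]) (by simp [clawSets]) jCT₂
  replace jCZ := key u 11 _ _ (by simp [clawSets]) (by simp [clawSets]) jCZ
  replace jZT₀ := key 11 v₀ _ _ (by simp [clawSets]) (by simp [clawSets]) jZT₀
  replace jBC := key 10 u _ _ (by simp [clawSets]) (by simp [clawSets]) jBC
  replace jBT₀ := key 10 v₀ _ _ (by simp [clawSets]) (by simp [clawSets]) jBT₀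
  replace jBT₁ := key 10 v₁ _ _ (by simp [clawSets]) (by simp [clawSets]) jBT₁
  replace jp := Home.joined_labelled_left (X := clawSets u v₀ v₁ v₂ T₀ T₁ T₂ C [(10, B), (11, Z)])
    (i := 11) (j := q) (by simp [clawSets])
      (jp.symm.mono subset_rfl (Set.singleton_subset_iff.2 hpq))
  refine h.isMinor_K34 hv hN (R := [(10, B), (11, Z)]) (by simpa using hnd) hs.1 hs.2 hs.3 hs.4
    (by simp [hB, hZ]) (by simp)
    (clawJump_cert u h.cubic v₀ hv.mem₀ v₁ hv.mem₁ hv.ne₀₁ q hq hqu hadj) (by decide)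
    (fun e he => ?_) (fun e he => ?_)
  · simp only [clawBase, List.mem_append, List.mem_cons, List.not_mem_nil, or_false,
      mem_edgesWithout] at he
    rcases he with (rfl | rfl) | (rfl | rfl | rfl | rfl) | he
    pick_goal -1
    · rcases hv.edge_cases h.cubic he.1 with hk | (rfl | rfl) | (rfl | rfl) | (rfl | rfl)
      · exact Or.inl hk
      all_goals first
        | exact Or.inr jCT₁ | exact Or.inr jCT₂ | exact Or.inr jCZ | exact Or.inr jZT₀
        | exact Or.inr jBC | exact Or.inr jBT₀ | exact Or.inr jBT₁ | exact Or.inr jCT₁.symm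
        | exact Or.inr jCT₂.symm | exact Or.inr jCZ.symm | exact Or.inr jp
        | exact absurd rfl he.2.1 | exact absurd rfl he.2.2
    all_goals first
      | exact Or.inr jCT₁ | exact Or.inr jCT₂ | exact Or.inr jCZ | exact Or.inr jZT₀
      | exact Or.inr jBC | exact Or.inr jBT₀ | exact Or.inr jBT₁ | exact Or.inr jCT₁.symm
      | exact Or.inr jCT₂.symm | exact Or.inr jCZ.symm | exact Or.inr jp
  · have hu := cubic_lt u h.cubic
    have l0 := (mem_nbrs.1 hv.mem₀).1
    have l1 := (mem_nbrs.1 hv.mem₁).1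
    have l2 := (mem_nbrs.1 hv.mem₂).1
    simp only [clawBase, List.mem_append, List.mem_cons, List.not_mem_nil, or_false,
      mem_edgesWithout] at he
    rcases he with (rfl | rfl) | (rfl | rfl | rfl | rfl) | he
    pick_goal -1
    · exact baseEdges_lt e he.1
    all_goals dsimp only; omega

/-- A claw with two connected sets on its first leg: `Z`, joined to a vertex elsewhere, and behind
it `Y`, joined to the third end; and a connected set `B` joined to `Z` and to the first two
ends. -/
theorem ClawContext.isMinor_of_foot_jump (h : ClawContext G u vert Out)
    (hv : IsNbrs u v₀ v₁ v₂) (hs : Spokes G Out (vert v₀) (vert v₁) (vert v₂) T₀ T₁ T₂ C)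
    (hB : IsCore G Out (lset B)) (hZ : IsCore G Out (lset Z)) (hY : IsCore G Out (lset Y))
    (hnd : (T₀ ++ T₁ ++ T₂ ++ C ++ (B ++ Z ++ Y)).Nodup)
    (jCT₁ : Joined G (lset C) (lset T₁))
    (jCT₂ : Joined G (lset C) (lset T₂))
    (jCZ : Joined G (lset C) (lset Z))
    (jZY : Joined G (lset Z) (lset Y))
    (jYT₀ : Joined G (lset Y) (lset T₀))
    (jYT₂ : Joined G (lset Y) (lset T₂))
    (jBT₀ : Joined G (lset B) (lset T₀))
    (jBT₁ : Joined G (lset B) (lset T₁))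
    (jBZ : Joined G (lset B) (lset Z))
    {p : V} (hp : p ∈ Out) (hpv : ∀ v ∈ nbrs u, p ≠ vert v)
    (jp : Joined G {p} (lset Z)) : IsMinor K34 G := by
  obtain ⟨N, q, hN, hpq, hq, hqu, hadj⟩ := h.home_of_mem p hp hpv
  have key : ∀ i j S T, (i, S) ∈ clawSets u v₀ v₁ v₂ T₀ T₁ T₂ C [(10, B), (11, Z), (12, Y)] →
      (j, T) ∈ clawSets u v₀ v₁ v₂ T₀ T₁ T₂ C [(10, B), (11, Z), (12, Y)] → Joined G S T →
      Joined G (N i ∪ labelled (clawSets u v₀ v₁ v₂ T₀ T₁ T₂ C [(10, B), (11, Z), (12, Y)]) i)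
        (N j ∪ labelled (clawSets u v₀ v₁ v₂ T₀ T₁ T₂ C [(10, B), (11, Z), (12, Y)]) j) :=
    fun i j S T hi hj hST => Home.joined_labelled N hi hj hST
  replace jCT₁ := key u v₁ _ _ (by simp [clawSets]) (by simp [clawSets]) jCT₁
  replace jCT₂ := key u v₂ _ _ (by simp [clawSets]) (by simp [clawSets]) jCT₂
  replace jCZ := key u 11 _ _ (by simp [clawSets]) (by simp [clawSets]) jCZ
  replace jZY := key 11 12 _ _ (by simp [clawSets]) (by simp [clawSets]) jZY
  replace jYT₀ := key 12 v₀ _ _ (by simp [clawSets]) (by simp [clawSets]) jYT₀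
  replace jYT₂ := key 12 v₂ _ _ (by simp [clawSets]) (by simp [clawSets]) jYT₂
  replace jBT₀ := key 10 v₀ _ _ (by simp [clawSets]) (by simp [clawSets]) jBT₀
  replace jBT₁ := key 10 v₁ _ _ (by simp [clawSets]) (by simp [clawSets]) jBT₁
  replace jBZ := key 10 11 _ _ (by simp [clawSets]) (by simp [clawSets]) jBZ
  replace jp := Home.joined_labelled_left
    (X := clawSets u v₀ v₁ v₂ T₀ T₁ T₂ C [(10, B), (11, Z), (12, Y)]) (i := 11) (j := q)
      (by simp [clawSets])
      (jp.symm.mono subset_rfl (Set.singleton_subset_iff.2 hpq))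
  refine h.isMinor_K34 hv hN (R := [(10, B), (11, Z), (12, Y)]) (by simpa using hnd)
    hs.1 hs.2 hs.3 hs.4
    (by simp [hB, hZ, hY]) (by simp)
    (clawFootJump_cert u h.cubic v₀ hv.mem₀ v₁ hv.mem₁ hv.ne₀₁ v₂ hv.mem₂ hv.ne₀₂.symm
      hv.ne₁₂.symm q hq hqu hadj) (by decide)
    (fun e he => ?_) (fun e he => ?_)
  · simp only [List.mem_append, List.mem_cons, List.not_mem_nil, or_false,
      mem_edgesWithout] at he
    rcases he with (rfl | rfl | rfl | rfl | rfl | rfl | rfl | rfl) | he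
    pick_goal -1
    · rcases hv.edge_cases h.cubic he.1 with hk | (rfl | rfl) | (rfl | rfl) | (rfl | rfl)
      · exact Or.inl hk
      all_goals first
        | exact Or.inr jCT₁ | exact Or.inr jCT₂ | exact Or.inr jCZ | exact Or.inr jZY
        | exact Or.inr jYT₀ | exact Or.inr jYT₂ | exact Or.inr jBT₀ | exact Or.inr jBT₁
        | exact Or.inr jBZ | exact Or.inr jCT₁.symm | exact Or.inr jCT₂.symm
        | exact Or.inr jCZ.symm | exact Or.inr jp | exact absurd rfl he.2.1
        | exact absurd rfl he.2.2
    all_goals first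
      | exact Or.inr jCT₁ | exact Or.inr jCT₂ | exact Or.inr jCZ | exact Or.inr jZY
      | exact Or.inr jYT₀ | exact Or.inr jYT₂ | exact Or.inr jBT₀ | exact Or.inr jBT₁
      | exact Or.inr jBZ | exact Or.inr jCT₁.symm | exact Or.inr jCT₂.symm | exact Or.inr jCZ.symm
      | exact Or.inr jp
  · have hu := cubic_lt u h.cubic
    have l0 := (mem_nbrs.1 hv.mem₀).1
    have l1 := (mem_nbrs.1 hv.mem₁).1
    have l2 := (mem_nbrs.1 hv.mem₂).1
    simp only [List.mem_append, List.mem_cons, List.not_mem_nil, or_false,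
      mem_edgesWithout] at he
    rcases he with (rfl | rfl | rfl | rfl | rfl | rfl | rfl | rfl) | he
    pick_goal -1
    · exact baseEdges_lt e he.1
    all_goals dsimp only; omega

/-- A claw with a connected set `Z` on its first leg that is also joined to the third end, and a
connected set `Y` on its third leg that is joined to a vertex elsewhere; and a connected set `B`
joined to the centre and to the first two ends. -/
theorem ClawContext.isMinor_of_leg_jump (h : ClawContext G u vert Out)
    (hv : IsNbrs u v₀ v₁ v₂) (hs : Spokes G Out (vert v₀) (vert v₁) (vert v₂) T₀ T₁ T₂ C)
    (hB : IsCore G Out (lset B)) (hZ : IsCore G Out (lset Z)) (hY : IsCore G Out (lset Y))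
    (hnd : (T₀ ++ T₁ ++ T₂ ++ C ++ (B ++ Z ++ Y)).Nodup)
    (jCT₁ : Joined G (lset C) (lset T₁))
    (jCZ : Joined G (lset C) (lset Z))
    (jCY : Joined G (lset C) (lset Y))
    (jZT₀ : Joined G (lset Z) (lset T₀))
    (jZT₂ : Joined G (lset Z) (lset T₂))
    (jYT₂ : Joined G (lset Y) (lset T₂))
    (jBT₀ : Joined G (lset B) (lset T₀))
    (jBT₁ : Joined G (lset B) (lset T₁))
    (jBC : Joined G (lset B) (lset C))
    {p : V} (hp : p ∈ Out) (hpv : ∀ v ∈ nbrs u, p ≠ vert v)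
    (jp : Joined G {p} (lset Y)) : IsMinor K34 G := by
  obtain ⟨N, q, hN, hpq, hq, hqu, hadj⟩ := h.home_of_mem p hp hpv
  have key : ∀ i j S T, (i, S) ∈ clawSets u v₀ v₁ v₂ T₀ T₁ T₂ C [(10, B), (11, Z), (12, Y)] →
      (j, T) ∈ clawSets u v₀ v₁ v₂ T₀ T₁ T₂ C [(10, B), (11, Z), (12, Y)] → Joined G S T →
      Joined G (N i ∪ labelled (clawSets u v₀ v₁ v₂ T₀ T₁ T₂ C [(10, B), (11, Z), (12, Y)]) i)
        (N j ∪ labelled (clawSets u v₀ v₁ v₂ T₀ T₁ T₂ C [(10, B), (11, Z), (12, Y)]) j) :=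
    fun i j S T hi hj hST => Home.joined_labelled N hi hj hST
  replace jCT₁ := key u v₁ _ _ (by simp [clawSets]) (by simp [clawSets]) jCT₁
  replace jCZ := key u 11 _ _ (by simp [clawSets]) (by simp [clawSets]) jCZ
  replace jCY := key u 12 _ _ (by simp [clawSets]) (by simp [clawSets]) jCY
  replace jZT₀ := key 11 v₀ _ _ (by simp [clawSets]) (by simp [clawSets]) jZT₀
  replace jZT₂ := key 11 v₂ _ _ (by simp [clawSets]) (by simp [clawSets]) jZT₂
  replace jYT₂ := key 12 v₂ _ _ (by simp [clawSets]) (by simp [clawSets]) jYT₂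
  replace jBT₀ := key 10 v₀ _ _ (by simp [clawSets]) (by simp [clawSets]) jBT₀
  replace jBT₁ := key 10 v₁ _ _ (by simp [clawSets]) (by simp [clawSets]) jBT₁
  replace jBC := key 10 u _ _ (by simp [clawSets]) (by simp [clawSets]) jBC
  replace jp := Home.joined_labelled_left
    (X := clawSets u v₀ v₁ v₂ T₀ T₁ T₂ C [(10, B), (11, Z), (12, Y)]) (i := 12) (j := q)
      (by simp [clawSets])
      (jp.symm.mono subset_rfl (Set.singleton_subset_iff.2 hpq))
  refine h.isMinor_K34 hv hN (R := [(10, B), (11, Z), (12, Y)]) (by simpa using hnd)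
    hs.1 hs.2 hs.3 hs.4
    (by simp [hB, hZ, hY]) (by simp)
    (clawLegJump_cert u h.cubic v₀ hv.mem₀ v₁ hv.mem₁ hv.ne₀₁ v₂ hv.mem₂ hv.ne₀₂.symm
      hv.ne₁₂.symm q hq hqu hadj) (by decide)
    (fun e he => ?_) (fun e he => ?_)
  · simp only [clawBase, List.mem_append, List.mem_cons, List.not_mem_nil, or_false,
      mem_edgesWithout] at he
    rcases he with (rfl | rfl | rfl | rfl | rfl) | ⟨(rfl | rfl | rfl | rfl) | he, hne⟩
    pick_goal -1
    · rcases hv.edge_cases h.cubic he.1 with hk | (rfl | rfl) | (rfl | rfl) | (rfl | rfl)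
      · exact Or.inl hk
      all_goals first
        | exact Or.inr jCT₁ | exact Or.inr jCZ | exact Or.inr jCY | exact Or.inr jZT₀
        | exact Or.inr jZT₂ | exact Or.inr jYT₂ | exact Or.inr jBT₀ | exact Or.inr jBT₁
        | exact Or.inr jBC | exact Or.inr jCT₁.symm | exact Or.inr jCZ.symm
        | exact Or.inr jCY.symm | exact Or.inr jp | exact absurd rfl he.2.1
        | exact absurd rfl he.2.2 | exact absurd rfl hne.1 | exact absurd rfl hne.2
    all_goals first
      | exact Or.inr jCT₁ | exact Or.inr jCZ | exact Or.inr jCY | exact Or.inr jZT₀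
      | exact Or.inr jZT₂ | exact Or.inr jYT₂ | exact Or.inr jBT₀ | exact Or.inr jBT₁
      | exact Or.inr jBC | exact Or.inr jCT₁.symm | exact Or.inr jCZ.symm | exact Or.inr jCY.symm
      | exact Or.inr jp
  · have hu := cubic_lt u h.cubic
    have l0 := (mem_nbrs.1 hv.mem₀).1
    have l1 := (mem_nbrs.1 hv.mem₁).1
    have l2 := (mem_nbrs.1 hv.mem₂).1
    simp only [clawBase, List.mem_append, List.mem_cons, List.not_mem_nil, or_false,
      mem_edgesWithout] at he
    rcases he with (rfl | rfl | rfl | rfl | rfl) | ⟨(rfl | rfl | rfl | rfl) | he, hne⟩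
    pick_goal -1
    · exact baseEdges_lt e he.1
    all_goals dsimp only; omega

/-- As `ClawContext.isMinor_of_leg_jump`, but with `B` joined to `Z` instead of the centre. -/
theorem ClawContext.isMinor_of_leg_jump' (h : ClawContext G u vert Out)
    (hv : IsNbrs u v₀ v₁ v₂) (hs : Spokes G Out (vert v₀) (vert v₁) (vert v₂) T₀ T₁ T₂ C)
    (hB : IsCore G Out (lset B)) (hZ : IsCore G Out (lset Z)) (hY : IsCore G Out (lset Y))
    (hnd : (T₀ ++ T₁ ++ T₂ ++ C ++ (B ++ Z ++ Y)).Nodup)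
    (jCT₁ : Joined G (lset C) (lset T₁))
    (jCZ : Joined G (lset C) (lset Z))
    (jCY : Joined G (lset C) (lset Y))
    (jZT₀ : Joined G (lset Z) (lset T₀))
    (jZT₂ : Joined G (lset Z) (lset T₂))
    (jYT₂ : Joined G (lset Y) (lset T₂))
    (jBT₀ : Joined G (lset B) (lset T₀))
    (jBT₁ : Joined G (lset B) (lset T₁))
    (jBZ : Joined G (lset B) (lset Z))
    {p : V} (hp : p ∈ Out) (hpv : ∀ v ∈ nbrs u, p ≠ vert v)
    (jp : Joined G {p} (lset Y)) : IsMinor K34 G := by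
  obtain ⟨N, q, hN, hpq, hq, hqu, hadj⟩ := h.home_of_mem p hp hpv
  have key : ∀ i j S T, (i, S) ∈ clawSets u v₀ v₁ v₂ T₀ T₁ T₂ C [(10, B), (11, Z), (12, Y)] →
      (j, T) ∈ clawSets u v₀ v₁ v₂ T₀ T₁ T₂ C [(10, B), (11, Z), (12, Y)] → Joined G S T →
      Joined G (N i ∪ labelled (clawSets u v₀ v₁ v₂ T₀ T₁ T₂ C [(10, B), (11, Z), (12, Y)]) i)
        (N j ∪ labelled (clawSets u v₀ v₁ v₂ T₀ T₁ T₂ C [(10, B), (11, Z), (12, Y)]) j) :=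
    fun i j S T hi hj hST => Home.joined_labelled N hi hj hST
  replace jCT₁ := key u v₁ _ _ (by simp [clawSets]) (by simp [clawSets]) jCT₁
  replace jCZ := key u 11 _ _ (by simp [clawSets]) (by simp [clawSets]) jCZ
  replace jCY := key u 12 _ _ (by simp [clawSets]) (by simp [clawSets]) jCY
  replace jZT₀ := key 11 v₀ _ _ (by simp [clawSets]) (by simp [clawSets]) jZT₀
  replace jZT₂ := key 11 v₂ _ _ (by simp [clawSets]) (by simp [clawSets]) jZT₂
  replace jYT₂ := key 12 v₂ _ _ (by simp [clawSets]) (by simp [clawSets]) jYT₂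
  replace jBT₀ := key 10 v₀ _ _ (by simp [clawSets]) (by simp [clawSets]) jBT₀
  replace jBT₁ := key 10 v₁ _ _ (by simp [clawSets]) (by simp [clawSets]) jBT₁
  replace jBZ := key 10 11 _ _ (by simp [clawSets]) (by simp [clawSets]) jBZ
  replace jp := Home.joined_labelled_left
    (X := clawSets u v₀ v₁ v₂ T₀ T₁ T₂ C [(10, B), (11, Z), (12, Y)]) (i := 12) (j := q)
      (by simp [clawSets])
      (jp.symm.mono subset_rfl (Set.singleton_subset_iff.2 hpq))
  refine h.isMinor_K34 hv hN (R := [(10, B), (11, Z), (12, Y)]) (by simpa using hnd)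
    hs.1 hs.2 hs.3 hs.4
    (by simp [hB, hZ, hY]) (by simp)
    (clawLegJump_cert' u h.cubic v₀ hv.mem₀ v₁ hv.mem₁ hv.ne₀₁ v₂ hv.mem₂ hv.ne₀₂.symm
      hv.ne₁₂.symm q hq hqu hadj) (by decide)
    (fun e he => ?_) (fun e he => ?_)
  · simp only [clawBase, List.mem_append, List.mem_cons, List.not_mem_nil, or_false,
      mem_edgesWithout] at he
    rcases he with (rfl | rfl | rfl | rfl | rfl) | ⟨(rfl | rfl | rfl | rfl) | he, hne⟩
    pick_goal -1
    · rcases hv.edge_cases h.cubic he.1 with hk | (rfl | rfl) | (rfl | rfl) | (rfl | rfl)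
      · exact Or.inl hk
      all_goals first
        | exact Or.inr jCT₁ | exact Or.inr jCZ | exact Or.inr jCY | exact Or.inr jZT₀
        | exact Or.inr jZT₂ | exact Or.inr jYT₂ | exact Or.inr jBT₀ | exact Or.inr jBT₁
        | exact Or.inr jBZ | exact Or.inr jCT₁.symm | exact Or.inr jCZ.symm
        | exact Or.inr jCY.symm | exact Or.inr jp | exact absurd rfl he.2.1
        | exact absurd rfl he.2.2 | exact absurd rfl hne.1 | exact absurd rfl hne.2
    all_goals first
      | exact Or.inr jCT₁ | exact Or.inr jCZ | exact Or.inr jCY | exact Or.inr jZT₀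
      | exact Or.inr jZT₂ | exact Or.inr jYT₂ | exact Or.inr jBT₀ | exact Or.inr jBT₁
      | exact Or.inr jBZ | exact Or.inr jCT₁.symm | exact Or.inr jCZ.symm | exact Or.inr jCY.symm
      | exact Or.inr jp
  · have hu := cubic_lt u h.cubic
    have l0 := (mem_nbrs.1 hv.mem₀).1
    have l1 := (mem_nbrs.1 hv.mem₁).1
    have l2 := (mem_nbrs.1 hv.mem₂).1
    simp only [clawBase, List.mem_append, List.mem_cons, List.not_mem_nil, or_false,
      mem_edgesWithout] at he
    rcases he with (rfl | rfl | rfl | rfl | rfl) | ⟨(rfl | rfl | rfl | rfl) | he, hne⟩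
    pick_goal -1
    · exact baseEdges_lt e he.1
    all_goals dsimp only; omega

end

end

/-! ### Paths as lists -/

/-- `a`, followed by the entries of `E`, followed by `b`, is a walk of `G`. -/
def PathVia (G : SimpleGraph V) (a : V) (E : List V) (b : V) : Prop :=
  (a :: E ++ [b]).IsChain G.Adj

lemma pathVia_split {a b z : V} {E F : List V} :
    PathVia G a (E ++ z :: F) b ↔ PathVia G a E z ∧ PathVia G z F b := by
  have h : a :: (E ++ z :: F) ++ [b] = (a :: E) ++ z :: (F ++ [b]) := by simp
  rw [PathVia, h, List.isChain_split]
  rfl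

lemma PathVia.symm {a b : V} {E : List V} (h : PathVia G a E b) : PathVia G b E.reverse a := by
  have h2 : (b :: E.reverse ++ [a]) = (a :: E ++ [b]).reverse := by simp
  rw [PathVia, h2, List.isChain_reverse]
  exact h.imp fun a b hab => hab.symm

lemma PathVia.chain_left {a b : V} {E : List V} (h : PathVia G a E b) :
    (a :: E).IsChain G.Adj := (List.isChain_append.1 h).1

lemma PathVia.chain_right {a b : V} {E : List V} (h : PathVia G a E b) :
    (E ++ [b]).IsChain G.Adj := (List.isChain_cons.1 h).2

lemma PathVia.connected_left {a b : V} {E : List V} (h : PathVia G a E b) :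
    (G.induce (lset (a :: E))).Connected := connected_lset h.chain_left (by simp)

lemma PathVia.connected_inner {a b : V} {E : List V} (h : PathVia G a E b) (hE : E ≠ []) :
    (G.induce (lset E)).Connected := connected_lset (List.isChain_append.1 h.chain_right).1 hE

lemma PathVia.joined_left {a b : V} {E : List V} (h : PathVia G a E b) {S T : Set V}
    (ha : a ∈ S) (hE : ∀ e ∈ E, e ∈ S) (hb : b ∈ T) : Joined G S T :=
  (joined_of_isChain_append (l₁ := a :: E) (l₂ := [b]) h (by simp) (by simp)).mono
    (by intro e he; rcases List.mem_cons.1 he with rfl | he; exacts [ha, hE e he])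
    (by intro e he; rw [mem_lset, List.mem_singleton] at he; exact he ▸ hb)

lemma PathVia.joined_right {a b : V} {E : List V} (h : PathVia G a E b) {S T : Set V}
    (ha : a ∈ S) (hE : ∀ e ∈ E, e ∈ T) (hb : b ∈ T) : Joined G S T :=
  (h.symm.joined_left hb (by simpa using hE) ha).symm

lemma PathVia.joined_inner {a b : V} {E : List V} (h : PathVia G a E b) (hE : E ≠ []) {S : Set V}
    (ha : a ∈ S) : Joined G S (lset E) := by
  obtain ⟨e, E, rfl⟩ := List.exists_cons_of_ne_nil hE
  exact ⟨a, ha, e, by simp, (List.isChain_cons_cons.1 h).1⟩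

lemma PathVia.joined_inner' {a b : V} {E : List V} (h : PathVia G a E b) (hE : E ≠ [])
    {S : Set V} (hb : b ∈ S) : Joined G S (lset E) :=
  (h.symm.joined_inner (by simpa using hE) hb).mono subset_rfl (by intro a; simp)

lemma connected_centre {c : V} {L₀ L₁ L₂ : List V} (h₀ : (c :: L₀).IsChain G.Adj)
    (h₁ : (c :: L₁).IsChain G.Adj) (h₂ : (c :: L₂).IsChain G.Adj) :
    (G.induce (lset (c :: (L₀ ++ L₁ ++ L₂)))).Connected := by
  have : lset (c :: (L₀ ++ L₁ ++ L₂)) = lset (c :: L₀) ∪ lset (c :: L₁) ∪ lset (c :: L₂) := by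
    ext; simp; tauto
  rw [this]
  exact connected_union_of_mem (connected_union_of_mem (connected_lset h₀ (by simp))
    (connected_lset h₁ (by simp)) (x := c) (by simp) (by simp))
    (connected_lset h₂ (by simp)) (x := c) (by simp) (by simp)

lemma nodup_of_count [DecidableEq V] {l l' : List V} (h : l.Nodup)
    (h' : ∀ a, l'.count a ≤ l.count a) : l'.Nodup :=
  List.nodup_iff_count_le_one.2 fun a => (h' a).trans (List.nodup_iff_count_le_one.1 h a)

lemma Joined.ne_nil {S : Set V} {l : List V} (h : Joined G (lset l) S) : l ≠ [] := by
  rintro rfl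
  obtain ⟨x, hx, -⟩ := h
  simp at hx

lemma Joined.exists_mem {S : Set V} {l : List V} (h : Joined G (lset l) S) :
    ∃ x ∈ l, Joined G {x} S := by
  obtain ⟨x, hx, h⟩ := h
  exact ⟨x, hx, x, rfl, h⟩

/-- A path that leaves the centre `c` of a claw and ends in `a`, with `a` the only vertex in
`Out`. -/
structure IsLeg (G : SimpleGraph V) (Out : Set V) (c a : V) (M : List V) : Prop where
  chain : (c :: M).IsChain G.Adj
  last : M.getLast? = some a
  out : ∀ y ∈ M, y ∈ Out → y = a

section

variable {Out : Set V} {c c' a x z : V} {A D M R E : List V}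

lemma IsLeg.path (h : IsLeg G Out c a (A ++ x :: D)) : PathVia G c A x := by
  have := h.chain
  rw [← List.cons_append, List.isChain_split] at this
  exact this.1

lemma IsLeg.last_mem (h : IsLeg G Out c a (A ++ x :: D)) : a ∈ x :: D := by
  have := h.last
  rw [List.getLast?_append_of_ne_nil _ (by simp)] at this
  exact List.mem_of_getLast? this

lemma IsLeg.tail (h : IsLeg G Out c a (A ++ x :: D)) : IsTail G Out a (lset (x :: D)) := by
  refine ⟨connected_lset ?_ (by simp), h.last_mem, fun y hy => h.out y (by simp_all)⟩
  have := h.chain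
  rw [← List.cons_append, List.isChain_split] at this
  exact this.2

lemma IsLeg.notMem_out (h : IsLeg G Out c a (A ++ x :: D)) (hn : (A ++ x :: D).Nodup) :
    ∀ y ∈ A, y ∉ Out := by
  intro y hy hyo
  obtain rfl := h.out y (by simp [hy]) hyo
  exact (List.nodup_append.1 hn).2.2 y hy y h.last_mem rfl

lemma IsLeg.of_path (h : IsLeg G Out c a (A ++ x :: D)) (hE : PathVia G c' E x)
    (hEO : ∀ y ∈ E, y ∉ Out) : IsLeg G Out c' a (E ++ x :: D) := by
  refine ⟨?_, ?_, ?_⟩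
  · have := h.chain
    rw [← List.cons_append, List.isChain_split] at this ⊢
    exact ⟨hE, this.2⟩
  · have := h.last
    rw [List.getLast?_append_of_ne_nil _ (by simp)] at this ⊢
    exact this
  · intro y hy hyo
    rcases List.mem_append.1 hy with hy | hy
    · exact absurd hyo (hEO y hy)
    · exact h.out y (by simp [hy]) hyo

end

/-! ### Claws with a connected set attached -/

/-- A claw with centre `c` whose legs `M₀`, `M₁`, `M₂`, listed without `c`, end in the branch
vertices of the neighbours of `u`, and a connected set `bs` off the claw. -/
structure IsClaw (G : SimpleGraph V) (u : ℕ) (vert : ℕ → V) (Out : Set V) (v₀ v₁ v₂ : ℕ) (c : V)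
    (M₀ M₁ M₂ bs : List V) : Prop where
  isNbrs : IsNbrs u v₀ v₁ v₂
  leg₀ : IsLeg G Out c (vert v₀) M₀
  leg₁ : IsLeg G Out c (vert v₁) M₁
  leg₂ : IsLeg G Out c (vert v₂) M₂
  notMem : c ∉ Out
  nodup : (c :: (M₀ ++ M₁ ++ M₂ ++ bs)).Nodup
  core : IsCore G Out (lset bs)

/-- A claw with a connected set `bs` attached to the vertices `x` and `y` on the first two legs, and
to a vertex between them. -/
structure Config (G : SimpleGraph V) (u : ℕ) (vert : ℕ → V) (Out : Set V) (v₀ v₁ v₂ : ℕ) (c : V)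
    (A₀ : List V) (x : V) (D₀ A₁ : List V) (y : V) (D₁ M₂ bs : List V) : Prop where
  claw : IsClaw G u vert Out v₀ v₁ v₂ c (A₀ ++ x :: D₀) (A₁ ++ y :: D₁) M₂ bs
  att₀ : Joined G {x} (lset bs)
  att₁ : Joined G {y} (lset bs)
  att : Joined G (lset (c :: (A₀ ++ A₁))) (lset bs)

/-- No set attached as in `Config` has more than `n` vertices. -/
def SizeBound (G : SimpleGraph V) (u : ℕ) (vert : ℕ → V) (Out : Set V) (n : ℕ) : Prop :=
  ∀ v₀ v₁ v₂ c A₀ x D₀ A₁ y D₁ M₂ bs,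
    Config G u vert Out v₀ v₁ v₂ c A₀ x D₀ A₁ y D₁ M₂ bs → bs.length ≤ n

/-- All vertices of `Out`, of a claw and of an attached set. -/
def clawVerts (Out : Set V) (c : V) (M₀ M₁ M₂ bs : List V) : Set V :=
  Out ∪ lset (c :: (M₀ ++ M₁ ++ M₂ ++ bs))

section

variable {u v₀ v₁ v₂ n : ℕ} {vert : ℕ → V} {Out : Set V} {c x y z z₁ z₂ p : V}
  {M₀ M₁ M₂ bs A₀ D₀ A₁ D₁ E F P Q R js : List V}

lemma IsClaw.swap (h : IsClaw G u vert Out v₀ v₁ v₂ c M₀ M₁ M₂ bs) :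
    IsClaw G u vert Out v₁ v₀ v₂ c M₁ M₀ M₂ bs := by
  classical
  refine ⟨h.isNbrs.swap, h.leg₁, h.leg₀, h.leg₂, h.notMem, nodup_of_count h.nodup fun a => ?_,
    h.core⟩
  simp only [List.count_append, List.count_cons]
  omega

lemma Config.swap (h : Config G u vert Out v₀ v₁ v₂ c A₀ x D₀ A₁ y D₁ M₂ bs) :
    Config G u vert Out v₁ v₀ v₂ c A₁ y D₁ A₀ x D₀ M₂ bs :=
  ⟨h.claw.swap, h.att₁, h.att₀, h.att.mono (by intro a; simp; tauto) subset_rfl⟩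

lemma clawVerts_swap : clawVerts Out c M₁ M₀ M₂ bs = clawVerts Out c M₀ M₁ M₂ bs := by
  ext a; simp [clawVerts]; tauto

lemma IsClaw.nodup_jump (h : IsClaw G u vert Out v₀ v₁ v₂ c M₀ M₁ M₂ bs)
    (hj : IsJump G (clawVerts Out c M₀ M₁ M₂ bs) z js p) :
    (c :: (M₀ ++ M₁ ++ M₂ ++ bs) ++ js).Nodup := by
  rw [List.nodup_append]
  refine ⟨h.nodup, hj.nodup, ?_⟩
  rintro a ha _ hb rfl
  exact hj.avoid a hb (Or.inr ha)

lemma IsClaw.jump_out (_h : IsClaw G u vert Out v₀ v₁ v₂ c M₀ M₁ M₂ bs)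
    (hj : IsJump G (clawVerts Out c M₀ M₁ M₂ bs) z js p) : ∀ j ∈ js, j ∉ Out :=
  fun j hj' ho => hj.avoid j hj' (Or.inl ho)

lemma IsClaw.inner_out₀ (h : IsClaw G u vert Out v₀ v₁ v₂ c (E ++ z :: F) M₁ M₂ bs) :
    ∀ e ∈ E, e ∉ Out := by
  classical
  refine h.leg₀.notMem_out (nodup_of_count h.nodup fun a => ?_)
  simp only [List.count_append, List.count_cons]
  omega

lemma IsClaw.inner_out₁ (h : IsClaw G u vert Out v₀ v₁ v₂ c M₀ (E ++ z :: F) M₂ bs) :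
    ∀ e ∈ E, e ∉ Out := h.swap.inner_out₀

lemma IsClaw.inner_out₂ (h : IsClaw G u vert Out v₀ v₁ v₂ c M₀ M₁ (E ++ z :: F) bs) :
    ∀ e ∈ E, e ∉ Out := by
  classical
  refine h.leg₂.notMem_out (nodup_of_count h.nodup fun a => ?_)
  simp only [List.count_append, List.count_cons]
  omega

end

/-! ### Rerouting a claw, and minors from paths off it -/

section

variable {Out : Set V} {c a : V} {M : List V}

lemma IsLeg.tail_self (h : IsLeg G Out c a M) : IsTail G Out a (lset M) := by
  obtain ⟨x, D, rfl⟩ := List.exists_cons_of_ne_nil (l := M) (by rintro rfl; simpa using h.last)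
  exact IsLeg.tail (A := []) h

lemma IsLeg.tail_append {A : List V} (h : IsLeg G Out c a (A ++ M)) (hM : M ≠ []) :
    IsTail G Out a (lset M) := by
  obtain ⟨x, D, rfl⟩ := List.exists_cons_of_ne_nil hM
  exact h.tail

lemma IsLeg.joined (h : IsLeg G Out c a M) {S : Set V} (hc : c ∈ S) : Joined G S (lset M) := by
  obtain ⟨x, D, rfl⟩ := List.exists_cons_of_ne_nil (l := M) (by rintro rfl; simpa using h.last)
  exact ⟨c, hc, x, by simp, (List.isChain_cons_cons.1 h.chain).1⟩

lemma IsLeg.connected_cons (h : IsLeg G Out c a M) : (G.induce (lset (c :: M))).Connected :=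
  connected_lset h.chain (by simp)

end

section

variable {u v₀ v₁ v₂ n : ℕ} {vert : ℕ → V} {Out : Set V} {c x y z z₁ z₂ p : V}
  {M₀ M₁ M₂ bs A₀ D₀ A₁ D₁ E F P Q R js : List V}

/-- Adding to `bs` the inner vertices of a path that starts in `bs`. -/
lemma Config.extend (h : Config G u vert Out v₀ v₁ v₂ c A₀ x D₀ A₁ y D₁ M₂ bs)
    (hz : z ∈ bs)
    (hj : IsJump G (clawVerts Out c (A₀ ++ x :: D₀) (A₁ ++ y :: D₁) M₂ bs) z js p) :
    Config G u vert Out v₀ v₁ v₂ c A₀ x D₀ A₁ y D₁ M₂ (bs ++ js) := by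
  have hsub : lset bs ⊆ lset (bs ++ js) := by intro a; simp; tauto
  refine ⟨⟨h.claw.isNbrs, h.claw.leg₀, h.claw.leg₁, h.claw.leg₂, h.claw.notMem, ?_, ?_, ?_⟩,
    h.att₀.mono subset_rfl hsub, h.att₁.mono subset_rfl hsub, h.att.mono subset_rfl hsub⟩
  · simpa using h.claw.nodup_jump hj
  · have e : lset (bs ++ js) = lset bs ∪ lset (z :: js) := by
      ext a; simp only [lset_append, Set.mem_union, mem_lset, List.mem_cons]; grind
    rw [e]
    exact connected_union_of_mem h.claw.core.conn (PathVia.connected_left hj.chain) hz (by simp)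
  · intro a ha
    rcases List.mem_append.1 ha with ha | ha
    · exact h.claw.core.disj a ha
    · exact h.claw.jump_out hj a ha

/-- By maximality, a path from `bs` to the configuration has no inner vertices: these could be added
to `bs`. -/
lemma Config.joined_of_jump (h : Config G u vert Out v₀ v₁ v₂ c A₀ x D₀ A₁ y D₁ M₂ bs)
    (hb : SizeBound G u vert Out bs.length) (hz : z ∈ bs)
    (hj : IsJump G (clawVerts Out c (A₀ ++ x :: D₀) (A₁ ++ y :: D₁) M₂ bs) z js p) :
    Joined G {p} (lset bs) := by
  have h1 := hb _ _ _ _ _ _ _ _ _ _ _ _ (h.extend hz hj)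
  have h2 : js = [] := by
    rw [← List.length_eq_zero_iff]
    simp at h1
    exact h1 ▸ rfl
  subst h2
  have := hj.chain
  simp at this
  exact ⟨p, rfl, z, hz, this.symm⟩

lemma Config.core_centre (h : Config G u vert Out v₀ v₁ v₂ c A₀ x D₀ A₁ y D₁ M₂ bs) :
    IsCore G Out (lset (c :: (A₀ ++ A₁))) := by
  refine ⟨?_, ?_⟩
  · have := connected_centre h.claw.leg₀.path.chain_left h.claw.leg₁.path.chain_left
      (L₂ := []) (by simp)
    rwa [List.append_nil] at this
  · intro a ha
    simp only [mem_lset, List.mem_cons, List.mem_append] at ha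
    rcases ha with rfl | ha | ha
    · exact h.claw.notMem
    · exact h.claw.inner_out₀ a ha
    · exact h.claw.inner_out₁ a ha

/-- If `bs` is also attached to a vertex of `Out` that is not the end of a leg, then there is a
`K_{3,4}` minor. -/
lemma Config.isMinor_of_out (h : Config G u vert Out v₀ v₁ v₂ c A₀ x D₀ A₁ y D₁ M₂ bs)
    (hctx : ClawContext G u vert Out)
    (hp : p ∈ Out) (hpv : ∀ v ∈ nbrs u, p ≠ vert v) (hj : Joined G {p} (lset bs)) :
    IsMinor K34 G := by
  classical
  refine hctx.isMinor_of_four h.claw.isNbrs ⟨h.claw.leg₀.tail, h.claw.leg₁.tail,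
    h.claw.leg₂.tail_self, h.core_centre⟩ h.claw.core ?_
    (h.claw.leg₀.path.joined_left (by simp) (by simp +contextual) (by simp))
    (h.claw.leg₁.path.joined_left (by simp) (by simp +contextual) (by simp))
    (h.claw.leg₂.joined (by simp)) h.att.symm (h.att₀.symm.mono subset_rfl (by simp))
    (h.att₁.symm.mono subset_rfl (by simp)) hp hpv hj
  refine nodup_of_count h.claw.nodup fun a => ?_
  simp only [List.count_append, List.count_cons]
  omega

/-- If `bs` is also attached to the third leg, then there is a `K_{3,4}` minor. -/
lemma Config.isMinor_of_leg₂ (h : Config G u vert Out v₀ v₁ v₂ c A₀ x D₀ A₁ y D₁ M₂ bs)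
    (hctx : ClawContext G u vert Out) (hj : Joined G (lset bs) (lset M₂)) :
    IsMinor K34 G := by
  classical
  refine hctx.isMinor_of_two_centres h.claw.isNbrs ⟨h.claw.leg₀.tail, h.claw.leg₁.tail,
    h.claw.leg₂.tail_self, h.core_centre⟩ h.claw.core ?_
    (h.claw.leg₀.path.joined_left (by simp) (by simp +contextual) (by simp))
    (h.claw.leg₁.path.joined_left (by simp) (by simp +contextual) (by simp))
    (h.claw.leg₂.joined (by simp)) (h.att₀.symm.mono subset_rfl (by simp))
    (h.att₁.symm.mono subset_rfl (by simp)) hj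
  refine nodup_of_count h.claw.nodup fun a => ?_
  simp only [List.count_append, List.count_cons]
  omega

/-- A path from one leg to another that jumps over attachments on both of them. -/
lemma IsClaw.isMinor_of_cross_jump (h : IsClaw G u vert Out v₀ v₁ v₂ c M₀ M₁ M₂ bs)
    (hctx : ClawContext G u vert Out) (h0 : M₀ = E ++ z₁ :: F) (h1 : M₁ = P ++ z₂ :: R)
    (hj : IsJump G (clawVerts Out c M₀ M₁ M₂ bs) z₁ js z₂)
    (hP : Joined G (lset P) (lset bs)) (hF : Joined G (lset F) (lset bs)) : IsMinor K34 G := by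
  classical
  subst h0 h1
  obtain ⟨f, F, rfl⟩ := List.exists_cons_of_ne_nil hF.ne_nil
  have hnd := h.nodup_jump hj
  have p0 := h.leg₀.path
  have p1 := h.leg₁.path
  have q0 : PathVia G z₁ [] f := (pathVia_split.1 (IsLeg.path (A := E ++ z₁ :: [])
    (x := f) (D := F) (by simpa using h.leg₀))).2
  have pj : PathVia G z₁ js z₂ := hj.chain
  have hO := h.jump_out hj
  have t0 : IsTail G Out (vert v₀) (lset (f :: F)) :=
    IsLeg.tail (A := E ++ [z₁]) (by simpa using h.leg₀)
  have i0 : ∀ e ∈ E ++ z₁ :: [], e ∉ Out :=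
    IsClaw.inner_out₀ (E := E ++ z₁ :: []) (z := f) (F := F) (by simpa using h)
  have jP : Joined G {z₂} (lset P) := p1.joined_inner' hP.ne_nil (by simp)
  have jP' : Joined G {c} (lset P) := p1.joined_inner hP.ne_nil (by simp)
  have ePB : lset (bs ++ P) = lset bs ∪ lset P := lset_append _ _
  have eT2 : lset (E ++ c :: M₂) = lset (c :: E) ∪ lset (c :: M₂) := by ext; simp; tauto
  have iP := h.inner_out₁
  refine hctx.isMinor_of_two_centres (T₀ := f :: F) (T₁ := z₂ :: R) (T₂ := E ++ c :: M₂)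
    (C := z₁ :: js) (B := bs ++ P) h.isNbrs ⟨t0, h.leg₁.tail, ⟨?_, ?_, ?_⟩,
      ⟨pj.connected_left, ?_⟩⟩ ⟨?_, ?_⟩ ?_
    (q0.joined_left (by simp) (by simp) (by simp))
    (pj.joined_left (by simp) (by simp +contextual) (by simp))
    (p0.symm.joined_right (by simp) (by simp +contextual) (by simp))
    (hF.symm.mono (by simp [ePB]) subset_rfl)
    (jP.symm.mono (by simp [ePB]) (by simp)) (jP'.symm.mono (by simp [ePB]) (by simp))
  · rw [eT2]
    exact connected_union_of_mem p0.connected_left h.leg₂.connected_cons (x := c) (by simp)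
      (by simp)
  · have := h.leg₂.tail_self.mem
    simp_all
  · intro a ha ho
    rw [eT2] at ha
    have := h.notMem
    have := h.leg₂.tail_self.eq a
    have := i0 a
    grind [mem_lset]
  · intro a ha
    have := i0 a
    have := hO a
    grind [mem_lset]
  · rw [ePB]
    exact connected_union_of_joined h.core.conn (p1.connected_inner hP.ne_nil) hP.symm
  · intro a ha
    have := iP a
    have := h.core.disj a
    grind [mem_lset]
  · refine nodup_of_count hnd fun a => ?_
    simp only [List.count_append, List.count_cons]
    omega

/-- If a path from a vertex `z₁` of the first leg before `z₂` to `z₂` can replace the part of the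
leg between them, and `bs` is attached to this part, then `bs` can be made larger. -/
lemma Config.grow (h : Config G u vert Out v₀ v₁ v₂ c A₀ x D₀ A₁ y D₁ M₂ bs)
    (hb : SizeBound G u vert Out bs.length) (h0 : A₀ ++ x :: D₀ = E ++ z₂ :: R)
    (hp : PathVia G c P z₂) (hP : ∀ e ∈ P, e ∉ Out) (hQ : Joined G (lset Q) (lset bs))
    (hQE : ∀ e ∈ Q, e ∈ E) (hQz : PathVia G z₁ Q z₂) (hz₁ : z₁ ∈ c :: P)
    (hnd : (c :: (P ++ z₂ :: R ++ (A₁ ++ y :: D₁) ++ M₂ ++ (bs ++ Q))).Nodup) : False := by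
  have hcl := h.claw
  rw [h0] at hcl
  have e : lset (bs ++ Q) = lset bs ∪ lset Q := lset_append _ _
  have := hb v₀ v₁ v₂ c P z₂ R A₁ y D₁ M₂ (bs ++ Q) ⟨⟨hcl.isNbrs, hcl.leg₀.of_path hp hP, hcl.leg₁,
    hcl.leg₂, hcl.notMem, hnd, ?_, ?_⟩, ?_, ?_, ?_⟩
  · rw [List.length_append] at this
    exact hQ.ne_nil (List.length_eq_zero_iff.1 (by omega))
  · rw [e]
    exact connected_union_of_joined hcl.core.conn (hQz.connected_inner hQ.ne_nil) hQ.symm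
  · intro a ha
    have := hcl.core.disj a
    have := hcl.inner_out₀ a
    have := hQE a
    grind [mem_lset]
  · exact (hQz.joined_inner' hQ.ne_nil (by simp)).mono subset_rfl (by simp [e])
  · exact h.att₁.mono subset_rfl (by simp [e])
  · exact (hQz.joined_inner (S := {z₁}) hQ.ne_nil rfl).mono
      (by intro a ha; rw [Set.mem_singleton_iff] at ha; subst ha; simp_all; tauto) (by simp [e])

/-- By maximality, no path off the claw jumps over an attachment of `bs` on the first leg. -/
lemma Config.no_leg_jump (h : Config G u vert Out v₀ v₁ v₂ c A₀ x D₀ A₁ y D₁ M₂ bs)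
    (hb : SizeBound G u vert Out bs.length) (h0 : A₀ ++ x :: D₀ = P ++ z₁ :: (Q ++ z₂ :: R))
    (hj : IsJump G (clawVerts Out c (A₀ ++ x :: D₀) (A₁ ++ y :: D₁) M₂ bs) z₁ js z₂)
    (hQ : Joined G (lset Q) (lset bs)) : False := by
  classical
  have hcl := h.claw
  have hO := hcl.jump_out hj
  have hnd := hcl.nodup_jump hj
  rw [h0] at hcl hnd
  have hcl' : IsClaw G u vert Out v₀ v₁ v₂ c ((P ++ z₁ :: Q) ++ z₂ :: R) (A₁ ++ y :: D₁) M₂ bs := by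
    simpa using hcl
  have p1 := hcl'.leg₀.path
  have i0 := hcl'.inner_out₀
  rw [pathVia_split] at p1
  refine h.grow hb (E := P ++ z₁ :: Q) (P := P ++ z₁ :: js) (z₁ := z₁) (z₂ := z₂) (R := R) (Q := Q)
    (by simpa using h0) (pathVia_split.2 ⟨p1.1, hj.chain⟩) ?_ hQ (by simp +contextual) p1.2
    (by simp) ?_
  · intro e he
    have := i0 e
    have := hO e
    grind
  · refine nodup_of_count hnd fun a => ?_
    simp only [List.count_append, List.count_cons]
    omega

/-- The case of `Config.no_leg_jump` in which the path starts in the centre. -/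
lemma Config.no_leg_jump_centre (h : Config G u vert Out v₀ v₁ v₂ c A₀ x D₀ A₁ y D₁ M₂ bs)
    (hb : SizeBound G u vert Out bs.length) (h0 : A₀ ++ x :: D₀ = Q ++ z₂ :: R)
    (hj : IsJump G (clawVerts Out c (A₀ ++ x :: D₀) (A₁ ++ y :: D₁) M₂ bs) c js z₂)
    (hQ : Joined G (lset Q) (lset bs)) : False := by
  classical
  have hcl := h.claw
  have hO := hcl.jump_out hj
  have hnd := hcl.nodup_jump hj
  rw [h0] at hcl hnd
  refine h.grow hb (E := Q) (P := js) (z₁ := c) (z₂ := z₂) (R := R) (Q := Q)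
    h0 hj.chain hO hQ (by simp) hcl.leg₀.path (by simp) ?_
  refine nodup_of_count hnd fun a => ?_
  simp only [List.count_append, List.count_cons]
  omega

/-- A path to `Out` that starts on the first leg, behind an attachment of `bs`. -/
lemma Config.isMinor_of_out_jump (h : Config G u vert Out v₀ v₁ v₂ c A₀ x D₀ A₁ y D₁ M₂ bs)
    (hctx : ClawContext G u vert Out) (h0 : A₀ = E ++ z :: F)
    (hj : IsJump G (clawVerts Out c (A₀ ++ x :: D₀) (A₁ ++ y :: D₁) M₂ bs) z js p)
    (hp : p ∈ Out) (hpv : ∀ v ∈ nbrs u, p ≠ vert v)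
    (ha : Joined G (lset (c :: (E ++ A₁))) (lset bs)) : IsMinor K34 G := by
  classical
  have hcl := h.claw
  have hO := hcl.jump_out hj
  have hnd := hcl.nodup_jump hj
  subst h0
  have p0 := pathVia_split.1 hcl.leg₀.path
  have i0 := hcl.inner_out₀
  have i1 := hcl.inner_out₁
  have pj : PathVia G z js p := hj.chain
  have pF := p0.2
  have e : lset (z :: (F ++ js)) = lset (z :: F) ∪ lset (z :: js) := by ext; simp; tauto
  have hC := connected_centre p0.1.chain_left hcl.leg₁.path.chain_left (L₂ := []) (by simp)
  rw [List.append_nil] at hC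
  refine hctx.isMinor_of_jump (T₀ := x :: D₀) (T₁ := y :: D₁) (T₂ := M₂) (C := c :: (E ++ A₁))
    (B := bs) (Z := z :: (F ++ js)) hcl.isNbrs ⟨hcl.leg₀.tail, hcl.leg₁.tail,
      hcl.leg₂.tail_self, hC, ?_⟩ hcl.core ⟨?_, ?_⟩ ?_
    (hcl.leg₁.path.joined_left (by simp) (by simp +contextual) (by simp))
    (hcl.leg₂.joined (by simp)) (p0.1.joined_left (by simp) (by simp +contextual) (by simp))
    (pF.joined_left (by simp) (by simp +contextual) (by simp)) ha.symm
    (h.att₀.symm.mono subset_rfl (by simp)) (h.att₁.symm.mono subset_rfl (by simp)) hp hpv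
    (pj.joined_left (by simp) (by simp +contextual) (by simp)).symm
  · intro a ha
    have := hcl.notMem
    have := i0 a
    have := i1 a
    grind [mem_lset]
  · rw [e]
    exact connected_union_of_mem pF.connected_left pj.connected_left (x := z) (by simp) (by simp)
  · intro a ha
    have := i0 a
    have := hO a
    grind [mem_lset]
  · refine nodup_of_count hnd fun a => ?_
    simp only [List.count_append, List.count_cons]
    omega

/-- Two jumps that do not meet, taken together. -/
lemma IsClaw.nodup_two_jumps {js' : List V} {z' p' : V}
    (h : IsClaw G u vert Out v₀ v₁ v₂ c M₀ M₁ M₂ bs)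
    (hj : IsJump G (clawVerts Out c M₀ M₁ M₂ bs) z js p)
    (hj' : IsJump G (clawVerts Out c M₀ M₁ M₂ bs) z' js' p') (hm : ∀ j ∈ js, j ∉ js') :
    (c :: (M₀ ++ M₁ ++ M₂ ++ bs) ++ js ++ js').Nodup := by
  rw [List.nodup_append]
  refine ⟨h.nodup_jump hj, hj'.nodup, ?_⟩
  rintro a ha _ hb rfl
  rw [List.mem_append] at ha
  rcases ha with ha | ha
  · exact hj'.avoid a hb (Or.inr ha)
  · exact hm a ha hb

/-- Two paths that start on the first leg, the first one from `z` to `Out`, and the second one from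
`z₂`, which is behind `z`, to the third leg; and `bs` is attached to `z` or to a vertex between `z`
and `z₂`. -/
lemma Config.isMinor_of_two_jumps {F₁ F₂ F₃ js' : List V} {r : V}
    (h : Config G u vert Out v₀ v₁ v₂ c A₀ x D₀ A₁ y D₁ M₂ bs)
    (hctx : ClawContext G u vert Out) (h0 : A₀ = E ++ z :: (F₁ ++ (F₂ ++ z₂ :: F₃)))
    (ht : Joined G (lset (z :: F₁)) (lset bs))
    (hj : IsJump G (clawVerts Out c (A₀ ++ x :: D₀) (A₁ ++ y :: D₁) M₂ bs) z js p)
    (hp : p ∈ Out) (hpv : ∀ v ∈ nbrs u, p ≠ vert v)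
    (hj' : IsJump G (clawVerts Out c (A₀ ++ x :: D₀) (A₁ ++ y :: D₁) M₂ bs) z₂ js' r)
    (hr : r ∈ M₂) : IsMinor K34 G := by
  classical
  have hcl := h.claw
  have hO := hcl.jump_out hj
  have hO' := hcl.jump_out hj'
  by_cases hmeet : ∃ j ∈ js, j ∈ js'
  · obtain ⟨j, hj1, hj2⟩ := hmeet
    obtain ⟨l, hl, -⟩ := hj.trans_of_mem hj' hj1 hj2
    exact h.isMinor_of_out_jump hctx (E := E ++ z :: (F₁ ++ F₂)) (by simpa using h0) hl hp hpv
      (ht.mono (by intro a; simp; tauto) subset_rfl)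
  push Not at hmeet
  have hnd := hcl.nodup_two_jumps hj hj' hmeet
  subst h0
  have i0 := hcl.inner_out₀
  have i1 := hcl.inner_out₁
  have pj : PathVia G z js p := hj.chain
  have pj' : PathVia G z₂ js' r := hj'.chain
  obtain ⟨pE, p1⟩ := pathVia_split.1 hcl.leg₀.path
  rw [← List.append_assoc, pathVia_split] at p1
  obtain ⟨p1, p2⟩ := p1
  have ch : ((z :: F₁) ++ (F₂ ++ [z₂])).IsChain G.Adj := by
    have := p1
    simpa [PathVia] using this
  have ch' := List.isChain_append.1 ch
  have eZ : lset (z :: (F₁ ++ js)) = lset (z :: F₁) ∪ lset (z :: js) := by ext; simp; tauto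
  have eY : lset (F₂ ++ z₂ :: js') = lset (F₂ ++ [z₂]) ∪ lset (z₂ :: js') := by
    ext; simp; tauto
  have hC := connected_centre pE.chain_left hcl.leg₁.path.chain_left (L₂ := []) (by simp)
  rw [List.append_nil] at hC
  have t0 : IsTail G Out (vert v₀) (lset (F₃ ++ x :: D₀)) :=
    IsLeg.tail_append (A := E ++ z :: (F₁ ++ (F₂ ++ [z₂]))) (by simpa using hcl.leg₀) (by simp)
  refine hctx.isMinor_of_foot_jump (T₀ := F₃ ++ x :: D₀) (T₁ := y :: D₁) (T₂ := M₂)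
    (C := c :: (E ++ A₁)) (B := bs) (Z := z :: (F₁ ++ js)) (Y := F₂ ++ z₂ :: js') hcl.isNbrs
    ⟨t0, hcl.leg₁.tail, hcl.leg₂.tail_self, hC, ?_⟩ hcl.core ⟨?_, ?_⟩ ⟨?_, ?_⟩ ?_
    (hcl.leg₁.path.joined_left (by simp) (by simp +contextual) (by simp))
    (hcl.leg₂.joined (by simp)) (pE.joined_left (by simp) (by simp +contextual) (by simp))
    ((joined_of_isChain_append ch (by simp) (by simp)).mono (by simp [eZ]) (by simp [eY]))
    (p2.joined_right (by simp) (by simp +contextual) (by simp))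
    (pj'.joined_left (by simp) (by simp +contextual) hr)
    (h.att₀.symm.mono subset_rfl (by simp)) (h.att₁.symm.mono subset_rfl (by simp))
    (ht.symm.mono subset_rfl (by simp [eZ])) hp hpv
    (pj.joined_left (by simp) (by simp +contextual) (by simp)).symm
  · intro a ha
    have := hcl.notMem
    have := i0 a
    have := i1 a
    grind [mem_lset]
  · rw [eZ]
    exact connected_union_of_mem (connected_lset ch'.1 (by simp)) pj.connected_left (x := z)
      (by simp) (by simp)
  · intro a ha
    have := i0 a
    have := hO a
    grind [mem_lset]
  · rw [eY]
    exact connected_union_of_mem (connected_lset ch'.2.1 (by simp)) pj'.connected_left (x := z₂)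
      (by simp) (by simp)
  · intro a ha
    have := i0 a
    have := hO' a
    grind [mem_lset]
  · refine nodup_of_count hnd fun a => ?_
    simp only [List.count_append, List.count_cons]
    omega

/-- A path from the first leg to the third one, and a path to `Out` from a vertex of the third leg
before the end of the first path. -/
lemma Config.isMinor_of_leg₂_jump {X X' Y js' : List V} {z' r : V}
    (h : Config G u vert Out v₀ v₁ v₂ c A₀ x D₀ A₁ y D₁ M₂ bs)
    (hctx : ClawContext G u vert Out) (h0 : A₀ = E ++ z :: F)
    (h2 : M₂ = X ++ z' :: (X' ++ r :: Y))
    (hj : IsJump G (clawVerts Out c (A₀ ++ x :: D₀) (A₁ ++ y :: D₁) M₂ bs) z js r)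
    (hj' : IsJump G (clawVerts Out c (A₀ ++ x :: D₀) (A₁ ++ y :: D₁) M₂ bs) z' js' p)
    (hmeet : ∀ j ∈ js, j ∉ js')
    (hp : p ∈ Out) (hpv : ∀ v ∈ nbrs u, p ≠ vert v) : IsMinor K34 G := by
  classical
  have hcl := h.claw
  have hO := hcl.jump_out hj
  have hO' := hcl.jump_out hj'
  have hnd := hcl.nodup_two_jumps hj hj' hmeet
  subst h0 h2
  have i0 := hcl.inner_out₀
  have i1 := hcl.inner_out₁
  have l2 : IsLeg G Out c (vert v₂) ((X ++ z' :: X') ++ r :: Y) := by simpa using hcl.leg₂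
  have i2 : ∀ e ∈ X ++ z' :: X', e ∉ Out :=
    IsClaw.inner_out₂ (z := r) (F := Y) (by simpa using hcl)
  have pj : PathVia G z js r := hj.chain
  have pj' : PathVia G z' js' p := hj'.chain
  obtain ⟨pE, pF⟩ := pathVia_split.1 hcl.leg₀.path
  obtain ⟨pX, pX'⟩ := pathVia_split.1 l2.path
  have eZ : lset (z :: (F ++ js)) = lset (z :: F) ∪ lset (z :: js) := by ext; simp; tauto
  have eY : lset (z' :: (X' ++ js')) = lset (z' :: X') ∪ lset (z' :: js') := by
    ext; simp; tauto
  have hC := connected_centre pE.chain_left hcl.leg₁.path.chain_left pX.chain_left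
  have hs : Spokes G Out (vert v₀) (vert v₁) (vert v₂) (x :: D₀) (y :: D₁) (r :: Y)
      (c :: (E ++ A₁ ++ X)) := by
    refine ⟨hcl.leg₀.tail, hcl.leg₁.tail, l2.tail, hC, fun a ha => ?_⟩
    have := hcl.notMem
    have := i0 a
    have := i1 a
    have := i2 a
    grind [mem_lset]
  have hZ : IsCore G Out (lset (z :: (F ++ js))) := by
    refine ⟨?_, fun a ha => ?_⟩
    · rw [eZ]
      exact connected_union_of_mem pF.connected_left pj.connected_left (x := z)
        (by simp) (by simp)
    · have := i0 a
      have := hO a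
      grind [mem_lset]
  have hY : IsCore G Out (lset (z' :: (X' ++ js'))) := by
    refine ⟨?_, fun a ha => ?_⟩
    · rw [eY]
      exact connected_union_of_mem pX'.connected_left pj'.connected_left (x := z')
        (by simp) (by simp)
    · have := i2 a
      have := hO' a
      grind [mem_lset]
  have hnd' : (x :: D₀ ++ y :: D₁ ++ r :: Y ++ c :: (E ++ A₁ ++ X) ++
      (bs ++ z :: (F ++ js) ++ z' :: (X' ++ js'))).Nodup := by
    refine nodup_of_count hnd fun a => ?_
    simp only [List.count_append, List.count_cons]
    omega
  have j1 : Joined G (lset (c :: (E ++ A₁ ++ X))) (lset (y :: D₁)) :=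
    hcl.leg₁.path.joined_left (by simp) (by simp +contextual) (by simp)
  have j2 : Joined G (lset (c :: (E ++ A₁ ++ X))) (lset (z :: (F ++ js))) :=
    pE.joined_left (by simp) (by simp +contextual) (by simp)
  have j3 : Joined G (lset (c :: (E ++ A₁ ++ X))) (lset (z' :: (X' ++ js'))) :=
    pX.joined_left (by simp) (by simp +contextual) (by simp)
  have j4 : Joined G (lset (z :: (F ++ js))) (lset (x :: D₀)) :=
    pF.joined_left (by simp) (by simp +contextual) (by simp)
  have j5 : Joined G (lset (z :: (F ++ js))) (lset (r :: Y)) :=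
    pj.joined_left (by simp) (by simp +contextual) (by simp)
  have j6 : Joined G (lset (z' :: (X' ++ js'))) (lset (r :: Y)) :=
    pX'.joined_left (by simp) (by simp +contextual) (by simp)
  have j7 : Joined G (lset bs) (lset (x :: D₀)) := h.att₀.symm.mono subset_rfl (by simp)
  have j8 : Joined G (lset bs) (lset (y :: D₁)) := h.att₁.symm.mono subset_rfl (by simp)
  have j9 : Joined G {p} (lset (z' :: (X' ++ js'))) :=
    (pj'.joined_left (by simp) (by simp +contextual) (by simp)).symm
  have hor : Joined G (lset bs) (lset (c :: (E ++ A₁ ++ X))) ∨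
      Joined G (lset bs) (lset (z :: (F ++ js))) := by
    obtain ⟨s, hs, hsj⟩ := h.att.exists_mem
    have : s ∈ c :: (E ++ A₁ ++ X) ∨ s ∈ z :: (F ++ js) := by grind
    exact this.imp (fun hs => hsj.symm.mono subset_rfl (by simpa using hs))
      (fun hs => hsj.symm.mono subset_rfl (by simpa using hs))
  rcases hor with hor | hor
  · exact hctx.isMinor_of_leg_jump hcl.isNbrs hs hcl.core hZ hY hnd' j1 j2 j3 j4 j5 j6 j7 j8 hor
      hp hpv j9
  · exact hctx.isMinor_of_leg_jump' hcl.isNbrs hs hcl.core hZ hY hnd' j1 j2 j3 j4 j5 j6 j7 j8 hor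
      hp hpv j9

/-- A path from a vertex `z'` of the third leg to the first leg that jumps over an attachment would
allow to enlarge `bs`: in the claw centred at `z'` whose first leg starts with this path, the part
of the old leg before the end of the path is free. -/
lemma Config.no_leg₂_jump {X Y : List V} {z' : V}
    (h : Config G u vert Out v₀ v₁ v₂ c A₀ x D₀ A₁ y D₁ M₂ bs)
    (hb : SizeBound G u vert Out bs.length) (h0 : A₀ ++ x :: D₀ = E ++ z₂ :: R)
    (h2 : M₂ = X ++ z' :: Y) (hY : Y ≠ [])
    (hj : IsJump G (clawVerts Out c (A₀ ++ x :: D₀) (A₁ ++ y :: D₁) M₂ bs) z' js z₂)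
    (hE : Joined G (lset E) (lset bs)) : False := by
  classical
  have hcl := h.claw
  have hO := hcl.jump_out hj
  have hnd := hcl.nodup_jump hj
  rw [h0] at hcl hnd
  subst h2
  obtain ⟨r, Y, rfl⟩ := List.exists_cons_of_ne_nil hY
  have i0 := hcl.inner_out₀
  have i1 := hcl.inner_out₁
  have l2 : IsLeg G Out c (vert v₂) ((X ++ z' :: []) ++ r :: Y) := by simpa using hcl.leg₂
  have i2 : ∀ e ∈ X ++ z' :: [], e ∉ Out :=
    IsClaw.inner_out₂ (z := r) (F := Y) (by simpa using hcl)
  obtain ⟨pX, pX'⟩ := pathVia_split.1 l2.path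
  have e : lset (bs ++ E) = lset bs ∪ lset E := lset_append _ _
  have := hb v₀ v₁ v₂ z' js z₂ R (X.reverse ++ c :: A₁) y D₁ (r :: Y) (bs ++ E)
    ⟨⟨hcl.isNbrs, hcl.leg₀.of_path hj.chain hO,
      hcl.leg₁.of_path (pathVia_split.2 ⟨pX.symm, hcl.leg₁.path⟩) ?_,
      l2.of_path (E := []) pX' (by simp), i2 z' (by simp), ?_, ?_, ?_⟩, ?_, ?_, ?_⟩
  · rw [List.length_append] at this
    exact hE.ne_nil (List.length_eq_zero_iff.1 (by omega))
  · intro a ha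
    have := hcl.notMem
    have := i1 a
    have := i2 a
    grind
  · refine nodup_of_count hnd fun a => ?_
    simp only [List.count_append, List.count_cons, List.count_reverse]
    omega
  · rw [e]
    exact connected_union_of_joined hcl.core.conn
      (hcl.leg₀.path.connected_inner hE.ne_nil) hE.symm
  · intro a ha
    have := hcl.core.disj a
    have := i0 a
    grind [mem_lset]
  · exact (hcl.leg₀.path.joined_inner' hE.ne_nil (by simp)).mono subset_rfl (by simp [e])
  · exact h.att₁.mono subset_rfl (by simp [e])
  · exact (hcl.leg₀.path.joined_inner (S := {c}) hE.ne_nil rfl).mono (by simp) (by simp [e])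

/-- The claw centred at a vertex `z` of the first leg, for a path from `z` to the third leg. -/
lemma Config.recentre {X Y : List V} {r : V}
    (h : Config G u vert Out v₀ v₁ v₂ c (E ++ z :: F) x D₀ A₁ y D₁ (X ++ r :: Y) bs)
    (hj : IsJump G (clawVerts Out c (E ++ z :: F ++ x :: D₀) (A₁ ++ y :: D₁) (X ++ r :: Y) bs)
      z js r) :
    Config G u vert Out v₀ v₁ v₂ z F x D₀ (E.reverse ++ c :: A₁) y D₁ (js ++ r :: Y) bs := by
  classical
  have hcl := h.claw
  have hO := hcl.jump_out hj
  have hnd := hcl.nodup_jump hj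
  have i0 := hcl.inner_out₀
  have i1 := hcl.inner_out₁
  obtain ⟨pE, pF⟩ := pathVia_split.1 hcl.leg₀.path
  refine ⟨⟨hcl.isNbrs, hcl.leg₀.of_path pF ?_,
    hcl.leg₁.of_path (pathVia_split.2 ⟨pE.symm, hcl.leg₁.path⟩) ?_, hcl.leg₂.of_path hj.chain hO,
    i0 z (by simp), ?_, hcl.core⟩, h.att₀, h.att₁,
    h.att.mono (by intro a; simp; tauto) subset_rfl⟩
  · intro a ha
    exact i0 a (by simp [ha])
  · intro a ha
    have := hcl.notMem
    have := i0 a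
    have := i1 a
    grind
  · refine nodup_of_count hnd fun a => ?_
    simp only [List.count_append, List.count_cons, List.count_reverse]
    omega

/-- The claw whose third leg ends with the part of the old one behind `p`, and starts with a path
`P`. -/
lemma Config.reroute {X Y : List V}
    (h : Config G u vert Out v₀ v₁ v₂ c A₀ x D₀ A₁ y D₁ (X ++ p :: Y) bs)
    (hP : PathVia G c P p) (hPO : ∀ a ∈ P, a ∉ Out)
    (hnd : (c :: (A₀ ++ x :: D₀ ++ (A₁ ++ y :: D₁) ++ (P ++ p :: Y) ++ bs)).Nodup) :
    Config G u vert Out v₀ v₁ v₂ c A₀ x D₀ A₁ y D₁ (P ++ p :: Y) bs :=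
  ⟨⟨h.claw.isNbrs, h.claw.leg₀, h.claw.leg₁, h.claw.leg₂.of_path hP hPO, h.claw.notMem, hnd,
    h.claw.core⟩, h.att₀, h.att₁, h.att⟩

end

/-! ### Claws with an attached set of maximal size -/

section

variable {u v₀ v₁ v₂ n : ℕ} {vert : ℕ → V} {Out : Set V} {c x y z z₁ z₂ p : V}
  {M₀ M₁ M₂ bs A₀ D₀ A₁ D₁ E F P Q R js : List V}

/-- The vertex `p` of `Out` is not the end of a leg. -/
def IsOuter (u : ℕ) (vert : ℕ → V) (Out : Set V) (p : V) : Prop :=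
  p ∈ Out ∧ ∀ v ∈ nbrs u, p ≠ vert v

lemma IsClaw.notMem_of_isOuter (h : IsClaw G u vert Out v₀ v₁ v₂ c M₀ M₁ M₂ bs)
    (hp : IsOuter u vert Out p) : p ∉ c :: (M₀ ++ M₁ ++ M₂ ++ bs) := by
  intro hm
  have h0 := h.leg₀.out p
  have h1 := h.leg₁.out p
  have h2 := h.leg₂.out p
  have hc := h.notMem
  have hb := h.core.disj p
  have := hp.1
  have := hp.2 _ h.isNbrs.mem₀
  have := hp.2 _ h.isNbrs.mem₁
  have := hp.2 _ h.isNbrs.mem₂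
  rw [mem_lset] at hb
  grind

lemma IsClaw.mem_cases (h : IsClaw G u vert Out v₀ v₁ v₂ c M₀ M₁ M₂ bs) (hu : u ∈ cubic)
    (hp : p ∈ clawVerts Out c M₀ M₁ M₂ bs) :
    IsOuter u vert Out p ∨ p = c ∨ p ∈ M₀ ∨ p ∈ M₁ ∨ p ∈ M₂ ∨ p ∈ bs := by
  by_cases ho : IsOuter u vert Out p
  · exact Or.inl ho
  rcases hp with hp | hp
  · simp only [IsOuter, not_and, not_forall, not_not] at ho
    obtain ⟨v, hv, rfl⟩ := ho hp
    have h0 := h.leg₀.tail_self.mem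
    have h1 := h.leg₁.tail_self.mem
    have h2 := h.leg₂.tail_self.mem
    rcases h.isNbrs.eq_or hu hv with rfl | rfl | rfl
    · exact Or.inr (Or.inr (Or.inl h0))
    · exact Or.inr (Or.inr (Or.inr (Or.inl h1)))
    · exact Or.inr (Or.inr (Or.inr (Or.inr (Or.inl h2))))
  · rw [mem_lset] at hp
    grind

lemma ncard_triple_le (a b c : V) : ({a, b, c} : Set V).ncard ≤ 3 :=
  (Set.ncard_insert_le _ _).trans (Nat.succ_le_succ ((Set.ncard_insert_le _ _).trans (by simp)))

/-- A set `L ∪ bs` of vertices of a claw that is separated from the other vertices of the claw by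
three vertices `s₀`, `s₁`, `s₂` is joined to them by a path, provided that `L` is not empty or `s₀`
and `s₁` are adjacent. -/
lemma IsClaw.exists_jump [Finite V] (hG : InternallyFourConnected G) (hcard : 6 < Nat.card V)
    (hctx : ClawContext G u vert Out) (h : IsClaw G u vert Out v₀ v₁ v₂ c M₀ M₁ M₂ bs)
    {s₀ s₁ s₂ : V} {L : List V} (hbs : bs ≠ [])
    (hnd : (L ++ [s₀, s₁, s₂]).Nodup) (hS : ∀ s ∈ [s₀, s₁, s₂], s ∈ c :: (M₀ ++ M₁ ++ M₂))
    (hL : ∀ s ∈ L, s ∈ c :: (M₀ ++ M₁ ++ M₂)) (hD : L ≠ [] ∨ G.Adj s₀ s₁) :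
    ∃ z, (z ∈ L ∨ z ∈ bs) ∧ ∃ p ∈ clawVerts Out c M₀ M₁ M₂ bs, p ∉ L ∧ p ∉ bs ∧
      p ≠ s₀ ∧ p ≠ s₁ ∧ p ≠ s₂ ∧ ∃ js, IsJump G (clawVerts Out c M₀ M₁ M₂ bs) z js p := by
  have hnd' := h.nodup
  rw [← List.cons_append, List.nodup_append] at hnd'
  have hdisj : ∀ s ∈ c :: (M₀ ++ M₁ ++ M₂), s ∉ bs := fun s hs hb => hnd'.2.2 s hs s hb rfl
  obtain ⟨b, hb⟩ := List.exists_mem_of_ne_nil _ hbs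
  have key := GraphF4.exists_jump hG hcard (S := {s₀, s₁, s₂}) (D := lset (L ++ bs))
    (K := clawVerts Out c M₀ M₁ M₂ bs) (ncard_triple_le _ _ _) ?_ ⟨b, by simp [hb]⟩ ?_ ?_
  · obtain ⟨z, hz, p, hp, hpD, hpS, js, hj⟩ := key
    have e : clawVerts Out c M₀ M₁ M₂ bs ∪ lset (L ++ bs) ∪ {s₀, s₁, s₂} =
        clawVerts Out c M₀ M₁ M₂ bs := by
      rw [Set.union_assoc]
      refine Set.union_eq_left.2 ?_
      have h1 : ∀ s ∈ c :: (M₀ ++ M₁ ++ M₂), s ∈ clawVerts Out c M₀ M₁ M₂ bs := by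
        intro s hs
        refine Or.inr ?_
        rw [mem_lset]
        grind
      rintro a (ha | ha)
      · rw [lset_append] at ha
        rcases ha with ha | ha
        · exact h1 a (hL a ha)
        · exact Or.inr (by rw [mem_lset] at ha ⊢; grind)
      · exact h1 a (hS a (by simpa using ha))
    rw [e] at hj
    simp only [Set.mem_insert_iff, Set.mem_singleton_iff, not_or] at hpS
    rw [lset_append, Set.mem_union, not_or] at hpD
    exact ⟨z, by simpa using hz, p, hp, hpD.1, hpD.2, hpS.1, hpS.2.1, hpS.2.2, js, hj⟩
  · rw [Set.disjoint_left]
    intro a ha ha'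
    have := hS a (by simpa using ha)
    rcases List.mem_append.1 ha' with ha' | ha'
    · exact (List.nodup_append.1 hnd).2.2 a ha' a (by simpa using ha) rfl
    · exact hdisj a this ha'
  · rcases hD with hD | hD
    · right
      obtain ⟨a, ha⟩ := List.exists_mem_of_ne_nil _ hD
      refine ⟨a, by simp [ha], b, by simp [hb], ?_⟩
      rintro rfl
      exact hdisj a (hL a ha) hb
    · exact Or.inl ⟨s₀, by simp, s₁, by simp, hD⟩
  · obtain ⟨q, hq, q', hq', hne, hqv, hqv'⟩ := hctx.two
    have n1 := h.notMem_of_isOuter ⟨hq, hqv⟩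
    have n2 := h.notMem_of_isOuter ⟨hq', hqv'⟩
    have h1 : ∀ a, a ∉ c :: (M₀ ++ M₁ ++ M₂ ++ bs) → a ∉ lset (L ++ bs) ∧
        a ∉ ({s₀, s₁, s₂} : Set V) := by
      intro a ha
      refine ⟨?_, ?_⟩
      · rw [mem_lset]
        intro ha'
        have := hL a
        grind
      · intro ha'
        have := hS a (by simpa using ha')
        grind
    exact ⟨q, Or.inl hq, q', Or.inl hq', hne, (h1 q n1).1, (h1 q' n2).1, (h1 q n1).2, (h1 q' n2).2⟩

/-- A configuration in which `bs` has as many vertices as possible, and `x` and `y` are the last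
attachments on the first two legs. -/
structure Extremal (G : SimpleGraph V) (u : ℕ) (vert : ℕ → V) (Out : Set V) (v₀ v₁ v₂ : ℕ) (c : V)
    (A₀ : List V) (x : V) (D₀ A₁ : List V) (y : V) (D₁ M₂ bs : List V) : Prop where
  config : Config G u vert Out v₀ v₁ v₂ c A₀ x D₀ A₁ y D₁ M₂ bs
  bound : SizeBound G u vert Out bs.length
  last₀ : ¬ Joined G (lset D₀) (lset bs)
  last₁ : ¬ Joined G (lset D₁) (lset bs)

lemma Extremal.swap (h : Extremal G u vert Out v₀ v₁ v₂ c A₀ x D₀ A₁ y D₁ M₂ bs) :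
    Extremal G u vert Out v₁ v₀ v₂ c A₁ y D₁ A₀ x D₀ M₂ bs :=
  ⟨h.config.swap, h.bound, h.last₁, h.last₀⟩

/-- Every path from `bs` to the rest of the claw or to `Out` ends between `x` and `y`. -/
lemma Extremal.bs_jump (h : Extremal G u vert Out v₀ v₁ v₂ c A₀ x D₀ A₁ y D₁ M₂ bs)
    (hctx : ClawContext G u vert Out) (hK : ¬ IsMinor K34 G) (hz : z ∈ bs) (hpb : p ∉ bs)
    (hp : p ∈ clawVerts Out c (A₀ ++ x :: D₀) (A₁ ++ y :: D₁) M₂ bs)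
    (hj : IsJump G (clawVerts Out c (A₀ ++ x :: D₀) (A₁ ++ y :: D₁) M₂ bs) z js p) :
    (p = c ∨ p ∈ A₀ ∨ p = x ∨ p ∈ A₁ ∨ p = y) ∧ Joined G {p} (lset bs) := by
  have ha := h.config.joined_of_jump h.bound hz hj
  refine ⟨?_, ha⟩
  have hmem : ∀ l : List V, p ∈ l → Joined G (lset l) (lset bs) := fun l hl =>
    ha.mono (by simpa using hl) subset_rfl
  rcases h.config.claw.mem_cases hctx.cubic hp with hp | hp | hp | hp | hp | hp
  · exact absurd (h.config.isMinor_of_out hctx hp.1 hp.2 ha) hK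
  · exact Or.inl hp
  · have := fun hp => h.last₀ (hmem D₀ hp)
    grind
  · have := fun hp => h.last₁ (hmem D₁ hp)
    grind
  · exact absurd (h.config.isMinor_of_leg₂ hctx (hmem _ hp).symm) hK
  · exact absurd hp hpb

lemma Config.bs_ne_nil (h : Config G u vert Out v₀ v₁ v₂ c A₀ x D₀ A₁ y D₁ M₂ bs) : bs ≠ [] :=
  h.att₀.symm.ne_nil

/-- No path from the first leg before `x` ends on the first two legs behind `x` and `y`. -/
lemma Extremal.no_jump_behind (h : Extremal G u vert Out v₀ v₁ v₂ c A₀ x D₀ A₁ y D₁ M₂ bs)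
    (hctx : ClawContext G u vert Out) (hK : ¬ IsMinor K34 G) (hz : z ∈ A₀)
    (hj : IsJump G (clawVerts Out c (A₀ ++ x :: D₀) (A₁ ++ y :: D₁) M₂ bs) z js p) :
    p ∉ D₀ ∧ p ∉ D₁ := by
  obtain ⟨E, F, rfl⟩ := List.append_of_mem hz
  refine ⟨fun hp => ?_, fun hp => ?_⟩
  · obtain ⟨Q, R, rfl⟩ := List.append_of_mem hp
    exact h.config.no_leg_jump h.bound (P := E) (z₁ := z) (Q := F ++ x :: Q) (z₂ := p) (R := R)
      (by simp) hj (h.config.att₀.mono (by simp) subset_rfl)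
  · obtain ⟨Q, R, rfl⟩ := List.append_of_mem hp
    exact hK (h.config.claw.isMinor_of_cross_jump hctx (E := E) (F := F ++ x :: D₀)
      (P := A₁ ++ y :: Q) (R := R) (by simp) (by simp) hj
      (h.config.att₁.mono (by simp) subset_rfl) (h.config.att₀.mono (by simp) subset_rfl))

/-- The case of `Extremal.no_jump_behind` in which the path starts in the centre. -/
lemma Extremal.no_jump_behind_centre
    (h : Extremal G u vert Out v₀ v₁ v₂ c A₀ x D₀ A₁ y D₁ M₂ bs)
    (hj : IsJump G (clawVerts Out c (A₀ ++ x :: D₀) (A₁ ++ y :: D₁) M₂ bs) c js p) :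
    p ∉ D₀ := by
  intro hp
  obtain ⟨Q, R, rfl⟩ := List.append_of_mem hp
  exact h.config.no_leg_jump_centre h.bound (Q := A₀ ++ x :: Q) (z₂ := p) (R := R)
      (by simp) hj (h.config.att₀.mono (by simp) subset_rfl)

/-- No path from the first leg before `x` ends in `Out`. -/
lemma Extremal.no_out_jump [Finite V] (hG : InternallyFourConnected G) (hcard : 6 < Nat.card V)
    (h : Extremal G u vert Out v₀ v₁ v₂ c A₀ x D₀ A₁ y D₁ M₂ bs)
    (hctx : ClawContext G u vert Out) (hK : ¬ IsMinor K34 G) (hz : z ∈ A₀)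
    (hj : IsJump G (clawVerts Out c (A₀ ++ x :: D₀) (A₁ ++ y :: D₁) M₂ bs) z js p) :
    ¬ IsOuter u vert Out p := by
  classical
  intro hp
  obtain ⟨E, F, rfl⟩ := List.append_of_mem hz
  have hcl := h.config.claw
  have hno : ¬ Joined G (lset (c :: (E ++ A₁))) (lset bs) := fun ha =>
    hK (h.config.isMinor_of_out_jump hctx rfl hj hp.1 hp.2 ha)
  have hno' : ∀ a, Joined G {a} (lset bs) → a ≠ c ∧ a ∉ E ∧ a ∉ A₁ := by
    intro a ha
    have := fun hm : a ∈ c :: (E ++ A₁) => hno (ha.mono (by simpa using hm) subset_rfl)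
    grind
  have hatt : ∃ t ∈ z :: F, Joined G {t} (lset bs) := by
    obtain ⟨s, hs, hsj⟩ := h.config.att.exists_mem
    have := hno' s hsj
    exact ⟨s, by grind, hsj⟩
  -- `t` is the first attachment on the first leg. Three vertices `t`, `x`, `y` do not separate the
  -- part of this leg between `t` and `x`, and `bs`, from the rest.
  obtain ⟨F₁, t, F', hF, ht, hF₁⟩ := exists_first hatt
  have hA : E ++ z :: F = E ++ F₁ ++ t :: F' := by rw [hF]; simp
  have hndA : (c :: ((E ++ F₁ ++ t :: F') ++ x :: D₀ ++ (A₁ ++ y :: D₁) ++ M₂ ++ bs)).Nodup :=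
    hA ▸ hcl.nodup
  have hadj : F' = [] → G.Adj t x := by
    rintro rfl
    have p0 := hcl.leg₀.path
    rw [hA, pathVia_split] at p0
    simpa [PathVia] using p0.2
  obtain ⟨z₂, hz₂, p₂, hp₂, hpF, hpb, hpt, hpx, hpy, js', hj'⟩ :=
    hcl.exists_jump hG hcard hctx (s₀ := t) (s₁ := x) (s₂ := y) (L := F') h.config.bs_ne_nil
      (nodup_of_count hndA fun a => by
        simp only [List.count_append, List.count_cons, List.count_nil]; omega)
      (by rw [hA]; simp) (by rw [hA]; simp +contextual) (by tauto)
  rcases hz₂ with hz₂ | hz₂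
  · obtain ⟨F₂, F₃, rfl⟩ := List.append_of_mem hz₂
    have hbehind := h.no_jump_behind hctx hK (by rw [hA]; simp) hj'
    have htF : Joined G (lset (E ++ F₁ ++ t :: F₂)) (lset bs) := ht.mono (by simp) subset_rfl
    rcases hcl.mem_cases hctx.cubic hp₂ with hp' | rfl | hp' | hp' | hp' | hp'
    · exact hK (h.config.isMinor_of_out_jump hctx (E := E ++ F₁ ++ t :: F₂) (F := F₃)
        (by rw [hA]; simp) hj' hp'.1 hp'.2 (ht.mono (by simp) subset_rfl))
    · exact h.config.no_leg_jump_centre h.bound (Q := E ++ F₁ ++ t :: F₂) (z₂ := z₂)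
        (R := F₃ ++ x :: D₀) (by rw [hA]; simp) hj'.symm htF
    · have : p₂ ∈ E ++ F₁ := by rw [hA] at hp'; grind
      obtain ⟨P, Q, hPQ⟩ := List.append_of_mem this
      exact h.config.no_leg_jump h.bound (P := P) (z₁ := p₂) (Q := Q ++ t :: F₂) (z₂ := z₂)
        (R := F₃ ++ x :: D₀) (by rw [hA, hPQ]; simp) hj'.symm (ht.mono (by simp) subset_rfl)
    · have : p₂ ∈ A₁ := by grind
      obtain ⟨P, Q, rfl⟩ := List.append_of_mem this
      refine hK (hcl.swap.isMinor_of_cross_jump hctx (E := P) (z₁ := p₂) (F := Q ++ y :: D₁)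
        (P := E ++ F₁ ++ t :: F₂) (z₂ := z₂) (R := F₃ ++ x :: D₀) (by simp) (by rw [hA]; simp)
        (by rw [clawVerts_swap]; exact hj'.symm) htF
        (h.config.att₁.mono (by simp) subset_rfl))
    · have hF' : ∃ F₁', z :: F = z :: (F₁' ++ (F₂ ++ z₂ :: F₃)) ∧ t ∈ z :: F₁' := by
        cases F₁ with
        | nil =>
          simp only [List.nil_append, List.cons.injEq] at hF
          exact ⟨[], by simp [hF.2], by simp [hF.1]⟩
        | cons f F₁ =>
          simp only [List.cons_append, List.cons.injEq] at hF
          exact ⟨F₁ ++ [t], by simp [hF.2], by simp⟩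
      obtain ⟨F₁', hF', htF'⟩ := hF'
      exact hK (h.config.isMinor_of_two_jumps hctx (E := E) (F₁ := F₁') (F₂ := F₂) (F₃ := F₃)
        (by rw [hF']) (ht.mono (by simpa using htF') subset_rfl) hj hp.1 hp.2 hj' hp')
    · exact hpb hp'
  · obtain ⟨h1, h2⟩ := h.bs_jump hctx hK hz₂ hpb hp₂ hj'
    have h3 := hno' p₂ h2
    have h4 : p₂ ∉ F₁ := fun hm => hF₁ p₂ hm h2
    rw [hA] at h1
    grind

/-- No path from the centre ends in `Out`, if there is a path from the first leg to the third one: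
this path can become the third leg of a claw for which the old centre is an inner vertex of a
leg. -/
lemma Extremal.no_out_jump_centre [Finite V] (hG : InternallyFourConnected G)
    (hcard : 6 < Nat.card V)
    (h : Extremal G u vert Out v₀ v₁ v₂ c A₀ x D₀ A₁ y D₁ M₂ bs)
    (hctx : ClawContext G u vert Out) (hK : ¬ IsMinor K34 G)
    {r : V} {js' : List V} (hz : z ∈ A₀) (hr : r ∈ M₂)
    (hj : IsJump G (clawVerts Out c (A₀ ++ x :: D₀) (A₁ ++ y :: D₁) M₂ bs) z js r)
    (hj' : IsJump G (clawVerts Out c (A₀ ++ x :: D₀) (A₁ ++ y :: D₁) M₂ bs) c js' p) :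
    ¬ IsOuter u vert Out p := by
  intro hp
  by_cases hmeet : ∃ j ∈ js', j ∈ js
  · obtain ⟨j, h1, h2⟩ := hmeet
    obtain ⟨l, hl, -⟩ := hj'.trans_of_mem hj h1 h2
    exact h.no_out_jump hG hcard hctx hK hz hl hp
  obtain ⟨E, F, rfl⟩ := List.append_of_mem hz
  obtain ⟨X, Y, rfl⟩ := List.append_of_mem hr
  have h' : Extremal G u vert Out v₀ v₁ v₂ z F x D₀ (E.reverse ++ c :: A₁) y D₁ (js ++ r :: Y) bs :=
    ⟨h.config.recentre hj, h.bound, h.last₀, h.last₁⟩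
  refine h'.swap.no_out_jump hG hcard hctx hK (z := c) (by simp) (js := js')
    (hj'.mono fun j hj1 hj2 => ?_) hp
  have h1 := hj'.avoid j hj1
  push Not at hmeet
  have h2 := hmeet j hj1
  simp only [clawVerts, Set.mem_union, mem_lset, not_or] at h1 hj2
  grind

/-- The vertices `x`, `y` and the centre do not separate the inner part of the first two legs, and
`bs`, from the rest. The path that avoids them can only end on the third leg. -/
lemma Extremal.exists_foot [Finite V] (hG : InternallyFourConnected G) (hcard : 6 < Nat.card V)
    (h : Extremal G u vert Out v₀ v₁ v₂ c A₀ x D₀ A₁ y D₁ M₂ bs)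
    (hctx : ClawContext G u vert Out) (hK : ¬ IsMinor K34 G) :
    ∃ z, (z ∈ A₀ ∨ z ∈ A₁) ∧ ∃ r ∈ M₂, ∃ js,
      IsJump G (clawVerts Out c (A₀ ++ x :: D₀) (A₁ ++ y :: D₁) M₂ bs) z js r := by
  classical
  have hcl := h.config.claw
  have hadj : A₀ ++ A₁ = [] → G.Adj x c := by
    intro hA
    rw [List.append_eq_nil_iff] at hA
    have p0 := hcl.leg₀.path
    rw [hA.1] at p0
    simpa [PathVia, G.adj_comm] using p0
  obtain ⟨z, hz, p, hp, hpA, hpb, hpx, hpc, hpy, js, hj⟩ :=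
    hcl.exists_jump hG hcard hctx (s₀ := x) (s₁ := c) (s₂ := y) (L := A₀ ++ A₁)
      h.config.bs_ne_nil
      (nodup_of_count hcl.nodup fun a => by
        simp only [List.count_append, List.count_cons, List.count_nil]; omega)
      (by simp) (by simp; grind) (by tauto)
  rw [List.mem_append, not_or] at hpA
  have hcases := hcl.mem_cases hctx.cubic hp
  rcases hz with hz | hz
  · refine ⟨z, by simpa using hz, p, ?_, js, hj⟩
    rcases List.mem_append.1 hz with hz | hz
    · have h1 := h.no_jump_behind hctx hK hz hj
      have h2 := h.no_out_jump hG hcard hctx hK hz hj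
      grind
    · have h1 := h.swap.no_jump_behind hctx hK hz (by rw [clawVerts_swap]; exact hj)
      have h2 := h.swap.no_out_jump hG hcard hctx hK hz (by rw [clawVerts_swap]; exact hj)
      grind
  · have := (h.bs_jump hctx hK hz hpb hp hj).1
    grind

/-- There is no path from the first two legs before `x` and `y` to the third leg. The proof is by
induction on the length of the part of the third leg behind the path. -/
lemma Extremal.no_foot [Finite V] (hG : InternallyFourConnected G) (hcard : 6 < Nat.card V)
    (hctx : ClawContext G u vert Out) (hK : ¬ IsMinor K34 G) (m : ℕ) :
    ∀ {v₀ v₁ v₂ : ℕ} {c x y z r : V} {A₀ D₀ A₁ D₁ X Y bs js : List V},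
    Extremal G u vert Out v₀ v₁ v₂ c A₀ x D₀ A₁ y D₁ (X ++ r :: Y) bs → Y.length = m → z ∈ A₀ →
    IsJump G (clawVerts Out c (A₀ ++ x :: D₀) (A₁ ++ y :: D₁) (X ++ r :: Y) bs) z js r →
    False := by
  classical
  induction m using Nat.strong_induction_on with
  | _ m ih =>
  intro v₀ v₁ v₂ c x y z r A₀ D₀ A₁ D₁ X Y bs js h hm hz hj
  have hcl := h.config.claw
  -- a jump from the first two legs to the part of the third one behind `r`
  have hY : ∀ {z' p js'}, z' ∈ A₀ ++ A₁ → p ∈ Y → ¬ IsJump G (clawVerts Out c (A₀ ++ x :: D₀)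
      (A₁ ++ y :: D₁) (X ++ r :: Y) bs) z' js' p := by
    intro z' p js' hz' hp hj'
    obtain ⟨Y₁, Y₂, rfl⟩ := List.append_of_mem hp
    have e : X ++ r :: (Y₁ ++ p :: Y₂) = (X ++ r :: Y₁) ++ p :: Y₂ := by simp
    rw [e] at h hj'
    have hlt : Y₂.length < m := by simp at hm; omega
    rcases List.mem_append.1 hz' with hz' | hz'
    · exact ih _ hlt h rfl hz' hj'
    · exact ih _ hlt h.swap rfl hz' (by rw [clawVerts_swap]; exact hj')
  -- a jump from the third leg, or the centre, to the part of this leg behind `r`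
  have hX : ∀ {z' p js' P}, (P = js' ∧ z' = c ∨ ∃ X₁ X₂, X = X₁ ++ z' :: X₂ ∧ P = X₁ ++ z' :: js') →
      p ∈ Y → ¬ IsJump G (clawVerts Out c (A₀ ++ x :: D₀)
      (A₁ ++ y :: D₁) (X ++ r :: Y) bs) z' js' p := by
    intro z' p js' P hP hp hj'
    by_cases hmeet : ∃ j ∈ js', j ∈ js
    · obtain ⟨j, h1, h2⟩ := hmeet
      obtain ⟨l, hl, -⟩ := hj'.trans_of_mem hj h1 h2
      exact hY (by simp [hz]) hp hl
    push Not at hmeet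
    have hnd := hcl.nodup_two_jumps hj' hj hmeet
    have hO := hcl.jump_out hj'
    have i2 := hcl.inner_out₂
    have p2 := hcl.leg₂.path
    obtain ⟨Y₁, Y₂, rfl⟩ := List.append_of_mem hp
    have hlt : Y₂.length < m := by simp at hm; omega
    have e : X ++ r :: (Y₁ ++ p :: Y₂) = (X ++ r :: Y₁) ++ p :: Y₂ := by simp
    have hPp : PathVia G c P p := by
      rcases hP with ⟨rfl, rfl⟩ | ⟨X₁, X₂, rfl, rfl⟩
      · exact hj'.chain
      · exact pathVia_split.2 ⟨(pathVia_split.1 p2).1, hj'.chain⟩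
    have hPO : ∀ a ∈ P, a ∉ Out := by
      intro a ha
      rcases hP with ⟨rfl, rfl⟩ | ⟨X₁, X₂, rfl, rfl⟩
      · exact hO a ha
      · rcases List.mem_append.1 ha with ha | ha
        · exact i2 a (by simp [ha])
        · rcases List.mem_cons.1 ha with rfl | ha
          · exact i2 a (by simp)
          · exact hO a ha
    have hPc : ∀ a, P.count a ≤ X.count a + js'.count a := by
      intro a
      rcases hP with ⟨rfl, rfl⟩ | ⟨X₁, X₂, rfl, rfl⟩
      · omega
      · simp only [List.count_append, List.count_cons]; omega
    have hrY : PathVia G r Y₁ p := by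
      have := hcl.leg₂
      rw [e] at this
      exact (pathVia_split.1 this.path).2
    have h' : Extremal G u vert Out v₀ v₁ v₂ c A₀ x D₀ A₁ y D₁ (P ++ p :: Y₂) bs := by
      refine ⟨Config.reroute (X := X ++ r :: Y₁) (by rw [← e]; exact h.config) hPp hPO
        (nodup_of_count hnd fun a => ?_), h.bound, h.last₀, h.last₁⟩
      have := hPc a
      simp only [List.count_append, List.count_cons]
      omega
    have hnd' : (js ++ r :: Y₁ ++ (c :: (A₀ ++ x :: D₀ ++ (A₁ ++ y :: D₁) ++ (P ++ p :: Y₂) ++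
        bs))).Nodup := by
      refine nodup_of_count hnd fun a => ?_
      have := hPc a
      simp only [List.count_append, List.count_cons]
      omega
    rw [List.nodup_append] at hnd'
    refine ih _ hlt h' rfl hz (js := js ++ r :: Y₁) ⟨pathVia_split.2 ⟨hj.chain, hrY⟩, hnd'.1, ?_⟩
    rintro j hj1 (hj2 | hj2)
    · have h1 := hcl.jump_out hj j
      have h2 := IsClaw.inner_out₂ (E := X ++ r :: Y₁) (z := p) (F := Y₂)
        (by rw [← e]; exact hcl) j
      grind
    · exact hnd'.2.2 j hj1 j hj2 rfl
  -- The vertices `x`, `y`, `r` do not separate the part of the claw between them, and `bs`, from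
  -- the rest. Every possible end of the resulting path is excluded.
  obtain ⟨z', hz', p, hp, hpL, hpb, hpx, hpy, hpr, js', hj'⟩ :=
    hcl.exists_jump hG hcard hctx (s₀ := x) (s₁ := y) (s₂ := r) (L := c :: (A₀ ++ A₁ ++ X))
      h.config.bs_ne_nil
      (nodup_of_count hcl.nodup fun a => by
        simp only [List.count_append, List.count_cons, List.count_nil]; omega)
      (by simp) (by simp; grind) (by simp)
  have hjs : IsJump G (clawVerts Out c (A₁ ++ y :: D₁) (A₀ ++ x :: D₀) (X ++ r :: Y) bs) z' js' p :=
    by rw [clawVerts_swap]; exact hj'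
  have hcases := hcl.mem_cases hctx.cubic hp
  have hpD : IsOuter u vert Out p ∨ p ∈ D₀ ∨ p ∈ D₁ ∨ p ∈ Y := by grind
  rcases hz' with hz' | hz'
  · simp only [List.mem_cons, List.mem_append] at hz'
    rcases hz' with rfl | (hz' | hz') | hz'
    · have h1 := h.no_jump_behind_centre hj'
      have h2 := h.swap.no_jump_behind_centre hjs
      have h3 := h.no_out_jump_centre hG hcard hctx hK hz (by simp) hj hj'
      have h4 := fun hp => hX (P := js') (Or.inl ⟨rfl, rfl⟩) hp hj'
      tauto
    · have h1 := h.no_jump_behind hctx hK hz' hj'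
      have h2 := h.no_out_jump hG hcard hctx hK hz' hj'
      have h3 := fun hp => hY (by simp [hz']) hp hj'
      tauto
    · have h1 := h.swap.no_jump_behind hctx hK hz' hjs
      have h2 := h.swap.no_out_jump hG hcard hctx hK hz' hjs
      have h3 := fun hp => hY (by simp [hz']) hp hj'
      tauto
    · obtain ⟨X₁, X₂, hX₁⟩ := List.append_of_mem hz'
      have e : X ++ r :: Y = X₁ ++ z' :: (X₂ ++ r :: Y) := by rw [hX₁]; simp
      rcases hpD with hp' | hp' | hp' | hp'
      · by_cases hmeet : ∃ j ∈ js', j ∈ js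
        · obtain ⟨j, h1, h2⟩ := hmeet
          obtain ⟨l, hl, -⟩ := hj'.trans_of_mem hj h1 h2
          exact h.no_out_jump hG hcard hctx hK hz hl hp'
        · push Not at hmeet
          obtain ⟨E, F, hEF⟩ := List.append_of_mem hz
          exact hK (h.config.isMinor_of_leg₂_jump hctx hEF e hj hj'
            (fun j h1 h2 => hmeet j h2 h1) hp'.1 hp'.2)
      · obtain ⟨Q, R, rfl⟩ := List.append_of_mem hp'
        exact h.config.no_leg₂_jump h.bound (E := A₀ ++ x :: Q) (z₂ := p) (R := R) (by simp) e
          (by simp) hj' (h.config.att₀.mono (by simp) subset_rfl)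
      · obtain ⟨Q, R, rfl⟩ := List.append_of_mem hp'
        exact h.config.swap.no_leg₂_jump h.bound (E := A₁ ++ y :: Q) (z₂ := p) (R := R) (by simp) e
          (by simp) hjs (h.config.att₁.mono (by simp) subset_rfl)
      · exact hX (Or.inr ⟨X₁, X₂, hX₁, rfl⟩) hp' hj'
  · have := (h.bs_jump hctx hK hz' hpb hp hj').1
    grind

/-- The vertices `x` and `y` can be moved to the last attachments on their legs. -/
lemma Config.exists_extremal (h : Config G u vert Out v₀ v₁ v₂ c A₀ x D₀ A₁ y D₁ M₂ bs)
    (hb : SizeBound G u vert Out bs.length) :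
    ∃ A₀ x D₀ A₁ y D₁, Extremal G u vert Out v₀ v₁ v₂ c A₀ x D₀ A₁ y D₁ M₂ bs := by
  obtain ⟨B₀, x', C₀, h1, h2, h3⟩ := exists_last (l := A₀ ++ x :: D₀)
    (P := fun a => Joined G {a} (lset bs)) ⟨x, by simp, h.att₀⟩
  obtain ⟨B₁, y', C₁, h4, h5, h6⟩ := exists_last (l := A₁ ++ y :: D₁)
    (P := fun a => Joined G {a} (lset bs)) ⟨y, by simp, h.att₁⟩
  have hsub : ∀ {A B D C : List V} {x x' : V}, A ++ x :: D = B ++ x' :: C → x ∉ C →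
      ∀ a ∈ A, a ∈ B := by
    intro A B D C x x' he hx a ha
    rw [List.append_eq_append_iff] at he
    rcases he with ⟨l, rfl, -⟩ | ⟨l, rfl, hl⟩
    · simp [ha]
    · cases l with
      | nil => simpa using ha
      | cons b l =>
        simp only [List.cons_append, List.cons.injEq] at hl
        exact absurd (hl.2 ▸ by simp) hx
  refine ⟨B₀, x', C₀, B₁, y', C₁, ⟨h4 ▸ h1 ▸ h.claw, h2, h5, h.att.mono ?_ subset_rfl⟩, hb,
    fun hj => ?_, fun hj => ?_⟩
  · intro a ha
    have := hsub h1 (fun hx => h3 x hx h.att₀) a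
    have := hsub h4 (fun hx => h6 y hx h.att₁) a
    simp only [mem_lset, List.mem_cons, List.mem_append] at ha ⊢
    tauto
  · obtain ⟨a, ha, haj⟩ := hj.exists_mem
    exact h3 a ha haj
  · obtain ⟨a, ha, haj⟩ := hj.exists_mem
    exact h6 a ha haj

/-- A connected set off a claw cannot be attached to the claw at two vertices on different legs and
at a vertex between them. -/
theorem Config.false [Finite V] (hG : InternallyFourConnected G) (hcard : 6 < Nat.card V)
    (hctx : ClawContext G u vert Out) (hK : ¬ IsMinor K34 G)
    (h : Config G u vert Out v₀ v₁ v₂ c A₀ x D₀ A₁ y D₁ M₂ bs) : False := by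
  classical
  have := Fintype.ofFinite V
  let good : ℕ → Prop := fun k => ∃ v₀ v₁ v₂ c A₀ x D₀ A₁ y D₁ M₂ bs,
    Config G u vert Out v₀ v₁ v₂ c A₀ x D₀ A₁ y D₁ M₂ bs ∧ bs.length = k
  have hle : ∀ k, good k → k ≤ Fintype.card V := by
    rintro k ⟨v₀, v₁, v₂, c, A₀, x, D₀, A₁, y, D₁, M₂, bs, h, rfl⟩
    refine List.Nodup.length_le_card ((nodup_of_count h.claw.nodup fun a => ?_))
    simp only [List.count_append, List.count_cons]
    omega
  have hgood : good bs.length := ⟨_, _, _, _, _, _, _, _, _, _, _, _, h, rfl⟩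
  obtain ⟨w₀, w₁, w₂, c', A₀', x', D₀', A₁', y', D₁', M₂', bs', h', hlen⟩ :=
    Nat.findGreatest_spec (hle _ hgood) hgood
  have hb : SizeBound G u vert Out bs'.length := by
    intro _ _ _ _ _ _ _ _ _ _ _ bs'' h''
    have hg : good bs''.length := ⟨_, _, _, _, _, _, _, _, _, _, _, _, h'', rfl⟩
    rw [hlen]
    exact Nat.le_findGreatest (hle _ hg) hg
  obtain ⟨A₀, x, D₀, A₁, y, D₁, he⟩ := h'.exists_extremal hb
  obtain ⟨z, hz, r, hr, js, hj⟩ := he.exists_foot hG hcard hctx hK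
  obtain ⟨X, Y, rfl⟩ := List.append_of_mem hr
  rcases hz with hz | hz
  · exact Extremal.no_foot hG hcard hctx hK _ he rfl hz hj
  · exact Extremal.no_foot hG hcard hctx hK _ he.swap rfl hz (by rw [clawVerts_swap]; exact hj)

end

/-! ### Subdivisions of `F₄` -/

/-- A subdivision of `F₄`, with the vertices of `F₄` numbered as in `baseEdges`: the branch vertices
`vert i`, and the lists `inner i j` of the inner vertices of the segments. -/
structure IsModel (G : SimpleGraph V) (vert : ℕ → V) (inner : ℕ → ℕ → List V) : Prop where
  path : ∀ i j, IsEdge i j → PathVia G (vert i) (inner i j) (vert j)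
  rev : ∀ i j, IsEdge i j → inner j i = (inner i j).reverse
  nodup : ∀ i j, IsEdge i j → (inner i j).Nodup
  inj : ∀ i < 10, ∀ j < 10, vert i = vert j → i = j
  vert_notMem : ∀ k < 10, ∀ i j, IsEdge i j → vert k ∉ inner i j
  disj : ∀ i j, IsEdge i j → ∀ k l, IsEdge k l →
    ∀ x ∈ inner i j, x ∈ inner k l → (i = k ∧ j = l) ∨ (i = l ∧ j = k)

/-- The part of a subdivision formed by the branch vertices `i` with `alive i` and the inner
vertices of the segments `i j` with `keep i j`. -/
def modelPart (vert : ℕ → V) (inner : ℕ → ℕ → List V) (alive : ℕ → Prop) (keep : ℕ → ℕ → Prop) :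
    Set V :=
  {x | (∃ i, alive i ∧ x = vert i) ∨ ∃ i j, keep i j ∧ x ∈ inner i j}

/-- The sets of a contraction of a part of a subdivision; the inner vertices of the segment `i j` go
to `i` if `own i j`. -/
def modelSet (vert : ℕ → V) (inner : ℕ → ℕ → List V) (alive : ℕ → Prop) (keep own : ℕ → ℕ → Prop)
    (i : ℕ) : Set V :=
  {x | alive i ∧ (x = vert i ∨ ∃ j, keep i j ∧ own i j ∧ x ∈ inner i j)}

lemma adjF_symm : ∀ i < 10, ∀ j < 10, adjF i j = true → adjF j i = true := by decide

lemma adjF_irrefl : ∀ i < 10, adjF i i = false := by decide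

lemma adjF_triangle_free : ∀ i < 10, ∀ j < 10, ∀ k < 10, adjF i j = true → adjF i k = true →
    adjF j k = false := by decide

/-- Conditions under which the sets `modelSet` contract a part of a subdivision. -/
structure Ownership (alive : ℕ → Prop) (keep own : ℕ → ℕ → Prop) : Prop where
  lt : ∀ i, alive i → i < 10
  keep_alive : ∀ i j, keep i j → IsEdge i j ∧ alive i ∧ alive j
  keep_symm : ∀ i j, keep i j → keep j i
  own_iff : ∀ i j, keep i j → (own i j ↔ ¬ own j i)

section

variable {vert : ℕ → V} {inner : ℕ → ℕ → List V} {alive : ℕ → Prop} {keep own : ℕ → ℕ → Prop}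

lemma IsModel.home (hM : IsModel G vert inner) (ho : Ownership alive keep own) :
    Home G alive keep vert (modelPart vert inner alive keep)
      (modelSet vert inner alive keep own) := by
  have hk : ∀ i j, keep i j → IsEdge i j := fun i j h => (ho.keep_alive i j h).1
  refine ⟨fun i hi => ?_, fun i hi => ⟨hi, Or.inl rfl⟩, ?_, ?_, ?_, ?_⟩
  · refine SimpleGraph.induce_connected_of_patches (vert i) ⟨hi, Or.inl rfl⟩ ?_
    rintro x ⟨-, rfl | ⟨j, hj, hown, hx⟩⟩
    · exact ⟨{vert i}, by rintro _ rfl; exact ⟨hi, Or.inl rfl⟩, rfl, rfl, .refl _⟩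
    · have ha := hk i j hj
      refine ⟨lset (vert i :: inner i j), ?_, by simp, by simp [hx],
        (hM.path i j ha).connected_left.preconnected _ _⟩
      intro y hy
      rcases List.mem_cons.1 hy with rfl | hy
      · exact ⟨hi, Or.inl rfl⟩
      · exact ⟨hi, Or.inr ⟨j, hj, hown, hy⟩⟩
  · rintro i x ⟨hi, rfl | ⟨j, hj, -, hx⟩⟩
    · exact Or.inl ⟨i, hi, rfl⟩
    · exact Or.inr ⟨i, j, hj, hx⟩
  · intro i hi
    rw [Set.eq_empty_iff_forall_notMem]
    rintro x ⟨h, -⟩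
    exact hi h
  · intro i j hij
    rw [Set.disjoint_left]
    rintro x ⟨hi, hx⟩ ⟨hj, hy⟩
    have li := ho.lt i hi
    have lj := ho.lt j hj
    rcases hx with rfl | ⟨k, hk1, hk2, hx⟩
    · rcases hy with hy | ⟨l, hl1, hl2, hy⟩
      · exact hij (hM.inj i li j lj hy)
      · have a1 := hk j l hl1
        exact hM.vert_notMem i li j l a1 hy
    · have b1 := hk i k hk1
      rcases hy with rfl | ⟨l, hl1, hl2, hy⟩
      · exact hM.vert_notMem j lj i k b1 hx
      · have a1 := hk j l hl1
        rcases hM.disj i k b1 j l a1 x hx hy with ⟨h1, -⟩ | ⟨rfl, rfl⟩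
        · exact hij h1
        · exact (ho.own_iff _ _ hk1).1 hk2 hl2
  · have key : ∀ i j, keep i j → own i j → Joined G (modelSet vert inner alive keep own i)
        (modelSet vert inner alive keep own j) := by
      intro i j h hown
      have a1 := hk i j h
      obtain ⟨-, hi, hj⟩ := ho.keep_alive i j h
      exact (hM.path i j a1).joined_left ⟨hi, Or.inl rfl⟩
        (fun e he => ⟨hi, Or.inr ⟨j, h, hown, he⟩⟩) ⟨hj, Or.inl rfl⟩
    intro i j h
    by_cases hown : own i j
    · exact key i j h hown
    · refine (key j i (ho.keep_symm i j h) ?_).symm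
      by_contra h2
      exact hown ((ho.own_iff i j h).2 h2)

/-- The inner vertices of the segments at `c` go to `c`. -/
def ownAt (c i j : ℕ) : Prop := i = c ∨ (j ≠ c ∧ i < j)

lemma IsEdge.symm {i j : ℕ} (h : IsEdge i j) : IsEdge j i :=
  ⟨adjF_symm i h.2.1 j h.2.2 h.1, h.2.2, h.2.1⟩

lemma IsEdge.ne {i j : ℕ} (h : IsEdge i j) : i ≠ j := by
  rintro rfl
  have := adjF_irrefl i h.2.1
  simp_all

lemma ownAt_iff {c i j : ℕ} (h : IsEdge i j) : ownAt c i j ↔ ¬ ownAt c j i := by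
  have hij := h.ne
  unfold ownAt
  omega

lemma keepClaw_ownership (u c : ℕ) :
    Ownership (fun i => i < 10 ∧ i ≠ u) (keepClaw u) (ownAt c) :=
  ⟨fun _ hi => hi.1, fun _ _ h => ⟨h.1, ⟨h.1.2.1, h.2.1⟩, ⟨h.1.2.2, h.2.2⟩⟩,
    fun _ _ h => ⟨h.1.symm, h.2.2, h.2.1⟩, fun _ _ h => ownAt_iff h.1⟩

lemma exists_third_nbr : ∀ u ∈ cubic, ∀ v ∈ nbrs u, ∀ w ∈ nbrs u, v ≠ w →
    ∃ z ∈ nbrs u, v ≠ z ∧ w ≠ z := by decide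

lemma exists_two_far : ∀ u ∈ cubic, ∃ w < 10, ∃ w' < 10, w ≠ w' ∧ w ≠ u ∧ w' ≠ u ∧
    adjF u w = false ∧ adjF u w' = false := by decide

/-- The part of a subdivision outside the open star of `u`. -/
abbrev clawOut (vert : ℕ → V) (inner : ℕ → ℕ → List V) (u : ℕ) : Set V :=
  modelPart vert inner (fun i => i < 10 ∧ i ≠ u) (keepClaw u)

/-- For a given vertex of a segment, the contraction is chosen so that the segment goes to an end
that is not adjacent to `u`; there is one, as `F₄` has no triangles. -/
lemma IsModel.clawContext (hM : IsModel G vert inner) {u : ℕ} (hu : u ∈ cubic) :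
    ClawContext G u vert (clawOut vert inner u) := by
  have hlt := cubic_lt u hu
  have hN : ∀ v ∈ nbrs u, v < 10 ∧ v ≠ u := fun v hv =>
    ⟨(mem_nbrs.1 hv).1, ne_of_mem_nbrs u hu v hv⟩
  refine ⟨hu, ⟨_, hM.home (keepClaw_ownership u u)⟩, ?_, ?_⟩
  · rintro p (⟨w, hw, rfl⟩ | ⟨i, j, hij, hp⟩) hpv
    · refine ⟨_, w, hM.home (keepClaw_ownership u u), ⟨hw, Or.inl rfl⟩, hw.1, hw.2, ?_⟩
      by_contra h
      exact hpv w (mem_nbrs.2 ⟨hw.1, by simpa using h⟩) rfl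
    · by_cases hui : adjF u i = true
      · refine ⟨_, j, hM.home (keepClaw_ownership u j), ⟨⟨hij.1.2.2, hij.2.2⟩,
          Or.inr ⟨i, ⟨hij.1.symm, hij.2.2, hij.2.1⟩, Or.inl rfl, ?_⟩⟩, hij.1.2.2, hij.2.2, ?_⟩
        · rw [hM.rev i j hij.1]; simpa using hp
        · by_contra h
          have := adjF_triangle_free u hlt i hij.1.2.1 j hij.1.2.2 hui (by simpa using h)
          simp [hij.1.1] at this
      · exact ⟨_, i, hM.home (keepClaw_ownership u i), ⟨⟨hij.1.2.1, hij.2.1⟩,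
          Or.inr ⟨j, hij, Or.inl rfl, hp⟩⟩, hij.1.2.1, hij.2.1, by simpa using hui⟩
  · obtain ⟨w, hw, w', hw', hne, h1, h2, h3, h4⟩ := exists_two_far u hu
    have h5 : ∀ w < 10, adjF u w = false → ∀ v ∈ nbrs u, vert w ≠ vert v := by
      intro w hw h v hv heq
      obtain rfl := hM.inj w hw v (hN v hv).1 heq
      have := (mem_nbrs.1 hv).2
      simp_all
    exact ⟨vert w, Or.inl ⟨w, ⟨hw, h1⟩, rfl⟩, vert w', Or.inl ⟨w', ⟨hw', h2⟩, rfl⟩,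
      fun h => hne (hM.inj w hw w' hw' h), h5 w hw h3, h5 w' hw' h4⟩

/-- The segment from `u` to `v`, listed without its first vertex, is a leg of a claw at `u`. -/
lemma IsModel.isLeg (hM : IsModel G vert inner) {u v : ℕ} (h : IsEdge u v) :
    IsLeg G (clawOut vert inner u) (vert u) (vert v) (inner u v ++ [vert v]) := by
  refine ⟨(hM.path u v h), by simp, ?_⟩
  intro y hy ho
  rcases List.mem_append.1 hy with hy | hy
  · rcases ho with ⟨w, hw, rfl⟩ | ⟨i, j, hij, hp⟩
    · exact absurd hy (hM.vert_notMem w hw.1 u v h)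
    · rcases hM.disj u v h i j hij.1 y hy hp with ⟨h1, -⟩ | ⟨h1, -⟩
      · exact absurd h1.symm hij.2.1
      · exact absurd h1.symm hij.2.2
  · simpa using hy

/-- The vertex set of a subdivision. -/
abbrev modelVerts (vert : ℕ → V) (inner : ℕ → ℕ → List V) : Set V :=
  modelPart vert inner (fun i => i < 10) IsEdge

lemma IsModel.vert_notMem_clawOut (hM : IsModel G vert inner) {u : ℕ} (hu : u < 10) :
    vert u ∉ clawOut vert inner u := by
  rintro (⟨w, hw, h⟩ | ⟨i, j, hij, hp⟩)
  · exact hw.2 (hM.inj u hu w hw.1 h).symm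
  · exact hM.vert_notMem u hu i j hij.1 hp

lemma clawOut_subset {u : ℕ} : clawOut vert inner u ⊆ modelVerts vert inner := by
  rintro x (⟨i, hi, rfl⟩ | ⟨i, j, hij, hx⟩)
  · exact Or.inl ⟨i, hi.1, rfl⟩
  · exact Or.inr ⟨i, j, hij.1, hx⟩

/-- The segments at a branch vertex of degree three form a claw. -/
lemma IsModel.isClaw (hM : IsModel G vert inner) {u v₀ v₁ v₂ : ℕ} (hu : u ∈ cubic)
    (hv : IsNbrs u v₀ v₁ v₂) {bs : List V} (hbs : IsCore G (modelVerts vert inner) (lset bs))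
    (hnd : bs.Nodup) :
    IsClaw G u vert (clawOut vert inner u) v₀ v₁ v₂ (vert u) (inner u v₀ ++ [vert v₀])
      (inner u v₁ ++ [vert v₁]) (inner u v₂ ++ [vert v₂]) bs := by
  have hlt := cubic_lt u hu
  have he : ∀ v ∈ nbrs u, IsEdge u v := fun v hv => ⟨(mem_nbrs.1 hv).2, hlt, (mem_nbrs.1 hv).1⟩
  have e0 := he v₀ hv.mem₀
  have e1 := he v₁ hv.mem₁
  have e2 := he v₂ hv.mem₂
  refine ⟨hv, hM.isLeg e0, hM.isLeg e1, hM.isLeg e2, hM.vert_notMem_clawOut hlt, ?_, hbs.conn,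
    fun y hy h => hbs.disj y hy (clawOut_subset h)⟩
  have hleg : ∀ v, IsEdge u v → (inner u v ++ [vert v]).Nodup ∧ vert u ∉ inner u v ++ [vert v] ∧
      ∀ x ∈ inner u v ++ [vert v], x ∈ modelVerts vert inner := by
    intro v h
    refine ⟨?_, ?_, ?_⟩
    · rw [List.nodup_append]
      refine ⟨hM.nodup u v h, by simp, ?_⟩
      rintro a ha b hb rfl
      rw [List.mem_singleton] at hb
      exact hM.vert_notMem v h.2.2 u v h (hb ▸ ha)
    · intro ha
      rcases List.mem_append.1 ha with ha | ha
      · exact hM.vert_notMem u h.2.1 u v h ha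
      · rw [List.mem_singleton] at ha
        exact h.ne (hM.inj u h.2.1 v h.2.2 ha)
    · intro x hx
      rcases List.mem_append.1 hx with hx | hx
      · exact Or.inr ⟨u, v, h, hx⟩
      · rw [List.mem_singleton] at hx
        exact Or.inl ⟨v, h.2.2, hx⟩
  have hdis : ∀ v w, IsEdge u v → IsEdge u w → v ≠ w → ∀ x ∈ inner u v ++ [vert v],
      ∀ y ∈ inner u w ++ [vert w], x ≠ y := by
    rintro v w hv hw hne x hx _ hy rfl
    rcases List.mem_append.1 hx with hx | hx <;> rcases List.mem_append.1 hy with hy | hy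
    · rcases hM.disj u v hv u w hw x hx hy with ⟨-, h⟩ | ⟨h, -⟩
      · exact hne h
      · exact hw.ne h
    · rw [List.mem_singleton] at hy
      exact hM.vert_notMem w hw.2.2 u v hv (hy ▸ hx)
    · rw [List.mem_singleton] at hx
      exact hM.vert_notMem v hv.2.2 u w hw (hx ▸ hy)
    · rw [List.mem_singleton] at hx hy
      exact hne (hM.inj v hv.2.2 w hw.2.2 (hx ▸ hy))
  have hb : ∀ v, IsEdge u v → ∀ x ∈ inner u v ++ [vert v], ∀ y ∈ bs, x ≠ y := by
    rintro v hv x hx _ hy rfl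
    exact hbs.disj x hy ((hleg v hv).2.2 x hx)
  have hu' : vert u ∉ bs := fun h => hbs.disj _ h (Or.inl ⟨u, hlt, rfl⟩)
  rw [List.nodup_cons, List.nodup_append, List.nodup_append, List.nodup_append]
  refine ⟨?_, ⟨⟨(hleg v₀ e0).1, (hleg v₁ e1).1, hdis v₀ v₁ e0 e1 hv.ne₀₁⟩, (hleg v₂ e2).1, ?_⟩, hnd,
    ?_⟩
  · have h0 := (hleg v₀ e0).2.1
    have h1 := (hleg v₁ e1).2.1
    have h2 := (hleg v₂ e2).2.1
    simp only [List.mem_append] at *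
    tauto
  · intro a ha
    rcases List.mem_append.1 ha with ha | ha
    · exact hdis v₀ v₂ e0 e2 hv.ne₀₂ a ha
    · exact hdis v₁ v₂ e1 e2 hv.ne₁₂ a ha
  · intro a ha
    rcases List.mem_append.1 ha with ha | ha
    · rcases List.mem_append.1 ha with ha | ha
      · exact hb v₀ e0 a ha
      · exact hb v₁ e1 a ha
    · exact hb v₂ e2 a ha

/-- The segment from `u` to `v`, with its ends. -/
def seg (vert : ℕ → V) (inner : ℕ → ℕ → List V) (u v : ℕ) : List V :=
  vert u :: inner u v ++ [vert v]

/-- A connected set off a subdivision that is attached to two vertices of a segment at a vertex `u`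
of degree three has no other attachments on the segments at `u`. -/
theorem IsModel.notMem_seg_of_cubic [Finite V] (hM : IsModel G vert inner)
    (hG : InternallyFourConnected G) (hcard : 6 < Nat.card V) (hK : ¬ IsMinor K34 G) {u v w : ℕ}
    (hu : u ∈ cubic) (hv : IsEdge u v) (hw : IsEdge u w) (hvw : v ≠ w) {bs : List V}
    (hbs : IsCore G (modelVerts vert inner) (lset bs)) (hnd : bs.Nodup) {t x p : V}
    (ht : t ∈ seg vert inner u v) (hx : x ∈ seg vert inner u v) (htx : t ≠ x)
    (htb : Joined G {t} (lset bs)) (hxb : Joined G {x} (lset bs)) (hpb : Joined G {p} (lset bs)) :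
    p ∉ inner u w ++ [vert w] := by
  intro hp
  obtain ⟨z, hz, hvz, hwz⟩ := exists_third_nbr u hu v (mem_nbrs.2 ⟨hv.2.2, hv.1⟩) w
    (mem_nbrs.2 ⟨hw.2.2, hw.1⟩) hvw
  have hN : IsNbrs u v w z :=
    ⟨mem_nbrs.2 ⟨hv.2.2, hv.1⟩, mem_nbrs.2 ⟨hw.2.2, hw.1⟩, hz, hvw, hvz, hwz⟩
  have hcl := hM.isClaw hu hN hbs hnd
  obtain ⟨A₁, D₁, hA₁⟩ := List.append_of_mem hp
  rw [hA₁] at hcl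
  have hctx := hM.clawContext hu
  -- If `t` is before `x` on the segment, then it is between `x` and `p` in the claw at `u`.
  have main : ∀ x t A₀ D₀, inner u v ++ [vert v] = A₀ ++ x :: D₀ → t ∈ vert u :: A₀ →
      Joined G {x} (lset bs) → Joined G {t} (lset bs) → False := by
    intro x t A₀ D₀ hA hmem hxb htb
    rw [hA] at hcl
    refine Config.false hG hcard hctx hK ⟨hcl, hxb, hpb, htb.mono ?_ subset_rfl⟩
    rw [Set.singleton_subset_iff, mem_lset]
    rw [List.mem_cons] at hmem ⊢
    rw [List.mem_append]
    tauto
  rw [seg, List.cons_append, List.mem_cons] at ht hx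
  rcases ht with rfl | ht
  · rcases hx with rfl | hx
    · exact htx rfl
    · obtain ⟨A₀, D₀, hA⟩ := List.append_of_mem hx
      exact main x _ A₀ D₀ hA (by simp) hxb htb
  · obtain ⟨A₀, D₀, hA⟩ := List.append_of_mem ht
    rcases hx with rfl | hx
    · exact main t _ A₀ D₀ hA (by simp) htb hxb
    · rw [hA, List.mem_append, List.mem_cons] at hx
      rcases hx with hx | rfl | hx
      · exact main t x A₀ D₀ hA (by simp [hx]) htb hxb
      · exact htx rfl
      · obtain ⟨P, Q, rfl⟩ := List.append_of_mem hx
        exact main x t (A₀ ++ t :: P) Q (by rw [hA]; simp) (by simp) hxb htb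

end

/-! ### Attachments on a segment and elsewhere -/

/-- The edges of `F₄` that are not in a list. -/
def keepWithout (L : List (ℕ × ℕ)) (i j : ℕ) : Prop := IsEdge i j ∧ (i, j) ∉ L ∧ (j, i) ∉ L

lemma keepWithout_ownership (L : List (ℕ × ℕ)) {own : ℕ → ℕ → Prop}
    (h : ∀ i j, keepWithout L i j → (own i j ↔ ¬ own j i)) :
    Ownership (fun i => i < 10) (keepWithout L) own :=
  ⟨fun _ hi => hi, fun _ _ h => ⟨h.1, h.1.2.1, h.1.2.2⟩, fun _ _ h => ⟨h.1.symm, h.2.2, h.2.1⟩, h⟩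

/-- The part of a subdivision outside the inner vertices of the segment `a b`. -/
abbrev pathOut (vert : ℕ → V) (inner : ℕ → ℕ → List V) (a b : ℕ) : Set V :=
  modelPart vert inner (fun i => i < 10) (keepWithout [(a, b)])

lemma baseEdges_isEdge : ∀ e ∈ baseEdges, IsEdge e.1 e.2 := by decide

lemma poor_of_not_cubic : ∀ a < 10, a ∉ cubic → ∀ b ∈ nbrs a, ∀ d ∈ nbrs a, d ≠ b →
    poor a b d = false := by decide

section

variable {vert : ℕ → V} {inner : ℕ → ℕ → List V} {a b : ℕ}

lemma IsEdge.mem_nbrs (h : IsEdge a b) : b ∈ nbrs a := GraphF4.mem_nbrs.2 ⟨h.2.2, h.1⟩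

lemma modelPart_mono {alive alive' : ℕ → Prop} {keep keep' : ℕ → ℕ → Prop}
    (h : ∀ i, alive i → alive' i) (h' : ∀ i j, keep i j → keep' i j) :
    modelPart vert inner alive keep ⊆ modelPart vert inner alive' keep' := by
  rintro x (⟨i, hi, rfl⟩ | ⟨i, j, hij, hx⟩)
  · exact Or.inl ⟨i, h i hi, rfl⟩
  · exact Or.inr ⟨i, j, h' i j hij, hx⟩

lemma IsCore.mono {Out Out' S : Set V} (h : IsCore G Out S) (hO : Out' ⊆ Out) :
    IsCore G Out' S := ⟨h.conn, fun y hy hy' => h.disj y hy (hO hy')⟩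

lemma mem_seg_comm (hM : IsModel G vert inner) (h : IsEdge a b) {x : V} :
    x ∈ seg vert inner b a ↔ x ∈ seg vert inner a b := by
  rw [seg, seg, hM.rev a b h]
  simp; tauto

/-- The inner vertices of the segment `a b` are off the rest of the subdivision. -/
lemma IsModel.notMem_pathOut (hM : IsModel G vert inner) (h : IsEdge a b) :
    ∀ y ∈ inner a b, y ∉ pathOut vert inner a b := by
  rintro y hy (⟨w, hw, rfl⟩ | ⟨i, j, hij, hp⟩)
  · exact hM.vert_notMem w hw a b h hy
  · have := hM.disj a b h i j hij.1 y hy hp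
    have := hij.2
    grind

/-- A connected set `B` attached to two vertices of a segment can be made into one joined to both
ends of the segment, by adding the inner part of the segment if necessary. -/
lemma IsModel.exists_core (hM : IsModel G vert inner) (h : IsEdge a b) {B : Set V}
    (hB : IsCore G (modelVerts vert inner) B) {t x : V} (ht : t ∈ seg vert inner a b)
    (hx : x ∈ seg vert inner a b) (htx : t ≠ x) (htb : Joined G {t} B) (hxb : Joined G {x} B) :
    ∃ Z, IsCore G (pathOut vert inner a b) Z ∧ B ⊆ Z ∧ Z ⊆ B ∪ lset (inner a b) ∧
      Joined G {vert a} Z ∧ Joined G {vert b} Z := by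
  have hB' : IsCore G (pathOut vert inner a b) B :=
    hB.mono (modelPart_mono (fun _ h => h) fun _ _ h => h.1)
  by_cases hin : ∃ y ∈ inner a b, Joined G {y} B
  · obtain ⟨y, hy, hyB⟩ := hin
    have hne := List.ne_nil_of_mem hy
    have p := hM.path a b h
    refine ⟨B ∪ lset (inner a b), ⟨?_, ?_⟩, Set.subset_union_left, subset_rfl,
      (p.joined_inner (S := {vert a}) hne rfl).mono subset_rfl Set.subset_union_right,
      (p.joined_inner' (S := {vert b}) hne rfl).mono subset_rfl Set.subset_union_right⟩
    · exact connected_union_of_joined hB.conn (p.connected_inner hne)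
        (hyB.symm.mono subset_rfl (by simpa using hy))
    · rintro z (hz | hz)
      · exact hB'.disj z hz
      · exact hM.notMem_pathOut h z hz
  · push Not at hin
    have hends : ∀ y ∈ seg vert inner a b, Joined G {y} B → y = vert a ∨ y = vert b := by
      intro y hy hyB
      have := fun hy' => hin y hy' hyB
      simp only [seg, List.cons_append, List.mem_cons, List.mem_append, List.not_mem_nil,
        or_false] at hy
      tauto
    refine ⟨B, hB', subset_rfl, Set.subset_union_left, ?_⟩
    rcases hends t ht htb with rfl | rfl <;> rcases hends x hx hxb with rfl | rfl
    · exact absurd rfl htx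
    · exact ⟨htb, hxb⟩
    · exact ⟨hxb, htb⟩
    · exact absurd rfl htx

lemma mem_edgesWithout_base {a b : ℕ} {e : ℕ × ℕ} (h : e ∈ edgesWithout a b baseEdges) :
    keepWithout [(a, b)] e.1 e.2 := by
  rw [mem_edgesWithout] at h
  refine ⟨baseEdges_isEdge e h.1, ?_, ?_⟩
  · have := h.2.1
    simpa using this
  · have := h.2.2
    obtain ⟨i, j⟩ := e
    simp at this ⊢
    tauto

/-- A set joined to both ends of the segment `a b`, and to a vertex that is contracted to a vertex
`w` which is not poor. -/
lemma IsModel.isMinor_of_edge_vertex (hM : IsModel G vert inner) (h : IsEdge a b) {w : ℕ}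
    (hw : w < 10) (hwa : w ≠ a) (hwb : w ≠ b) (hpoor : poor a b w = false) {Z : Set V}
    (hZ : IsCore G (pathOut vert inner a b) Z) (hZa : Joined G {vert a} Z)
    (hZb : Joined G {vert b} Z) {p : V} (hpZ : Joined G {p} Z)
    (hp : p = vert w ∨ ∃ j, keepWithout [(a, b)] w j ∧ p ∈ inner w j) : IsMinor K34 G := by
  have hN := hM.home (keepWithout_ownership [(a, b)] (own := ownAt w) fun i j h => ownAt_iff h.1)
  have hmem : ∀ i < 10, vert i ∈ modelSet vert inner (fun i => i < 10) (keepWithout [(a, b)])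
      (ownAt w) i := fun i hi => ⟨hi, Or.inl rfl⟩
  have hpN : p ∈ modelSet vert inner (fun i => i < 10) (keepWithout [(a, b)]) (ownAt w) w := by
    refine ⟨hw, hp.imp_right ?_⟩
    rintro ⟨j, hj, hpj⟩
    exact ⟨j, hj, Or.inl rfl, hpj⟩
  have key : ∀ i p, p ∈ modelSet vert inner (fun i => i < 10) (keepWithout [(a, b)]) (ownAt w) i →
      Joined G {p} Z → Joined G (modelSet vert inner (fun i => i < 10) (keepWithout [(a, b)])
        (ownAt w) 10 ∪ labelled [(10, Z)] 10) (modelSet vert inner (fun i => i < 10)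
        (keepWithout [(a, b)]) (ownAt w) i ∪ labelled [(10, Z)] i) := fun i p hp hj =>
    Home.joined_labelled_left (by simp)
      (hj.symm.mono subset_rfl (Set.singleton_subset_iff.2 hp))
  refine hN.isMinor_K34 (X := [(10, Z)]) (edgeVertex_cert a h.2.1 b h.mem_nbrs w hw hwa hwb hpoor)
    (by decide) ?_ (by simp) (by simp) (by
      rintro _ (_ | ⟨_, ⟨⟩⟩)
      exact Or.inr ⟨by simp, hZ⟩) ?_
  · intro e he
    have l1 := h.2.1
    have l2 := h.2.2
    simp only [subdivided, List.mem_cons, List.mem_append, List.not_mem_nil, or_false] at he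
    rcases he with rfl | (rfl | rfl) | he
    · dsimp only; omega
    · dsimp only; omega
    · dsimp only; omega
    · exact baseEdges_lt e (mem_edgesWithout.1 he).1
  · intro e he
    simp only [subdivided, List.mem_cons, List.mem_append, List.not_mem_nil, or_false] at he
    rcases he with rfl | (rfl | rfl) | he
    · exact Or.inr (key w p hpN hpZ)
    · exact Or.inr (key a _ (hmem a h.2.1) hZa)
    · exact Or.inr (key b _ (hmem b h.2.2) hZb)
    · exact Or.inl (mem_edgesWithout_base he)

/-- A set joined to both ends of the segment `a b`, and to an inner vertex of a disjoint segment `c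
d` with poor ends. -/
lemma IsModel.isMinor_of_edge_edge (hM : IsModel G vert inner) (h : IsEdge a b) {c d : ℕ}
    (hcd : IsEdge c d) (hca : c ≠ a) (hcb : c ≠ b) (hda : d ≠ a) (hdb : d ≠ b)
    (hc : poor a b c = true) (hd : poor a b d = true) {Z : Set V}
    (hZ : IsCore G (pathOut vert inner a b) Z) (hZa : Joined G {vert a} Z)
    (hZb : Joined G {vert b} Z) {p : V} (hpZ : Joined G {p} Z) (hp : p ∈ inner c d) :
    IsMinor K34 G := by
  have hN := hM.home (keepWithout_ownership [(a, b), (c, d)] (own := ownAt 0)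
    fun i j h => ownAt_iff h.1)
  have hsub : modelPart vert inner (fun i => i < 10) (keepWithout [(a, b), (c, d)]) ⊆
      pathOut vert inner a b := modelPart_mono (fun _ h => h) fun i j h => by
    refine ⟨h.1, ?_, ?_⟩
    · have := h.2.1; simp_all
    · have := h.2.2; simp_all
  have hsub' : modelPart vert inner (fun i => i < 10) (keepWithout [(a, b), (c, d)]) ⊆
      pathOut vert inner c d := modelPart_mono (fun _ h => h) fun i j h => by
    refine ⟨h.1, ?_, ?_⟩
    · have := h.2.1; simp_all
    · have := h.2.2; simp_all
  have hcore : IsCore G (modelPart vert inner (fun i => i < 10) (keepWithout [(a, b), (c, d)]))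
      (lset (inner c d)) := by
    refine ⟨(hM.path c d hcd).connected_inner (List.ne_nil_of_mem hp), fun y hy hy' => ?_⟩
    exact hM.notMem_pathOut hcd y hy (hsub' hy')
  have hin : lset (inner c d) ⊆ pathOut vert inner a b := by
    intro y hy
    exact Or.inr ⟨c, d, ⟨hcd, by simp [hca], by simp [hda]⟩, hy⟩
  have hdis : Disjoint Z (lset (inner c d)) :=
    Set.disjoint_left.2 fun y hy hy' => hZ.disj y hy (hin hy')
  set N := modelSet vert inner (fun i => i < 10) (keepWithout [(a, b), (c, d)]) (ownAt 0) with hNdef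
  have hmem : ∀ i < 10, vert i ∈ N i := fun i hi => ⟨hi, Or.inl rfl⟩
  have key : ∀ i < 10, ∀ k S, (k, S) ∈ [(10, Z), (11, lset (inner c d))] → Joined G {vert i} S →
      Joined G (N k ∪ labelled [(10, Z), (11, lset (inner c d))] k)
        (N i ∪ labelled [(10, Z), (11, lset (inner c d))] i) := fun i hi k S hS hj =>
    Home.joined_labelled_left hS (hj.symm.mono subset_rfl (Set.singleton_subset_iff.2 (hmem i hi)))
  have hpath := hM.path c d hcd
  have hne := List.ne_nil_of_mem hp
  refine hN.isMinor_K34 (X := [(10, Z), (11, lset (inner c d))])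
    (edgeEdge_cert a h.2.1 b h.mem_nbrs c hcd.2.1 hca hcb hc d hcd.mem_nbrs hda hdb hd)
    (by decide) ?_ (by simp) (by simpa using hdis) ?_ ?_
  · intro e he
    have l1 := h.2.1
    have l2 := h.2.2
    have l3 := hcd.2.1
    have l4 := hcd.2.2
    simp only [subdivided, List.mem_cons, List.mem_append, List.not_mem_nil, or_false,
      mem_edgesWithout] at he
    rcases he with (rfl | rfl | rfl) | ⟨(rfl | rfl) | he, -⟩
    all_goals first | exact baseEdges_lt e he.1 | (dsimp only; omega)
  · intro e he
    simp only [List.mem_cons, List.not_mem_nil, or_false] at he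
    rcases he with rfl | rfl
    · exact Or.inr ⟨by simp, hZ.mono hsub⟩
    · exact Or.inr ⟨by simp, hcore⟩
  · intro e he
    simp only [subdivided, List.mem_cons, List.mem_append, List.not_mem_nil, or_false,
      mem_edgesWithout] at he
    rcases he with (rfl | rfl | rfl) | ⟨(rfl | rfl) | he, hcd'⟩
    · exact Or.inr (Home.joined_labelled N (i := 11) (j := 10) (S := lset (inner c d)) (T := Z)
        (by simp) (by simp) (hpZ.mono (by simpa using hp) subset_rfl))
    · exact Or.inr (key c hcd.2.1 11 _ (by simp) (hpath.joined_inner hne rfl))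
    · exact Or.inr (key d hcd.2.2 11 _ (by simp) (hpath.joined_inner' hne rfl))
    · exact Or.inr (key a h.2.1 10 _ (by simp) hZa)
    · exact Or.inr (key b h.2.2 10 _ (by simp) hZb)
    · refine Or.inl ⟨baseEdges_isEdge e he.1, ?_, ?_⟩
      · have := he.2
        obtain ⟨i, j⟩ := e
        simp at this hcd' ⊢
        tauto
      · have := he.2
        obtain ⟨i, j⟩ := e
        simp at this hcd' ⊢
        tauto

/-- A connected set attached to two vertices of the segment `a b` is not attached to an inner vertex
of another segment at `a`. -/
lemma IsModel.false_of_adjacent_seg [Finite V] (hM : IsModel G vert inner)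
    (hG : InternallyFourConnected G) (hcard : 6 < Nat.card V) (hK : ¬ IsMinor K34 G)
    (h : IsEdge a b) {bs : List V}
    (hbs : IsCore G (modelVerts vert inner) (lset bs)) (hnd : bs.Nodup) {t x p : V}
    (ht : t ∈ seg vert inner a b) (hx : x ∈ seg vert inner a b) (htx : t ≠ x)
    (htb : Joined G {t} (lset bs)) (hxb : Joined G {x} (lset bs)) (hpb : Joined G {p} (lset bs))
    {d : ℕ} (hd : IsEdge a d) (hdb : d ≠ b) : p ∉ inner a d := by
  intro hp
  by_cases ha : a ∈ cubic
  · exact hM.notMem_seg_of_cubic hG hcard hK ha h hd hdb.symm hbs hnd ht hx htx htb hxb hpb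
      (by simp [hp])
  · obtain ⟨Z, hZ, hBZ, -, hZa, hZb⟩ := hM.exists_core h hbs ht hx htx htb hxb
    refine hK (hM.isMinor_of_edge_vertex h hd.2.2 hd.ne.symm hdb
      (poor_of_not_cubic a h.2.1 ha b h.mem_nbrs d hd.mem_nbrs hdb) hZ hZa hZb
      (hpb.mono subset_rfl hBZ) (Or.inr ⟨a, ⟨hd.symm, ?_, ?_⟩, ?_⟩))
    · have := h.ne; have := hd.ne; simp; tauto
    · simp [hdb]
    · rw [hM.rev a d hd]; simpa using hp

/-- A connected set attached to two vertices of the segment `a b` is attached to no vertices off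
this segment, except for the exceptional branch vertices. The poor vertices that are not exceptional
are adjacent to an end of degree three; for these there is no minor as in `edgeVertex_cert`, and the
result on claws is used. -/
theorem IsModel.exists_exceptional [Finite V] (hM : IsModel G vert inner)
    (hG : InternallyFourConnected G) (hcard : 6 < Nat.card V) (hK : ¬ IsMinor K34 G)
    (h : IsEdge a b) {bs : List V}
    (hbs : IsCore G (modelVerts vert inner) (lset bs)) (hnd : bs.Nodup) {t x p : V}
    (ht : t ∈ seg vert inner a b) (hx : x ∈ seg vert inner a b) (htx : t ≠ x)
    (htb : Joined G {t} (lset bs)) (hxb : Joined G {x} (lset bs)) (hpb : Joined G {p} (lset bs))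
    (hp : p ∈ pathOut vert inner a b) (hpa : p ≠ vert a) (hpv : p ≠ vert b) :
    ∃ w < 10, p = vert w ∧ exceptional a b w = true := by
  obtain ⟨Z, hZ, hBZ, -, hZa, hZb⟩ := hM.exists_core h hbs ht hx htx htb hxb
  have hpZ := hpb.mono subset_rfl hBZ
  have ht' := (mem_seg_comm hM h).2 ht
  have hx' := (mem_seg_comm hM h).2 hx
  rcases hp with ⟨w, hw, rfl⟩ | ⟨c, d, hcd, hp⟩
  · have hwa : w ≠ a := by rintro rfl; exact hpa rfl
    have hwb : w ≠ b := by rintro rfl; exact hpv rfl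
    refine ⟨w, hw, rfl, ?_⟩
    by_cases hpoor : poor a b w = true
    · simp only [poor, Bool.or_eq_true, Bool.and_eq_true, List.contains_iff_mem] at hpoor
      rcases hpoor with (he | ⟨ha, haw⟩) | ⟨hb, hbw⟩
      · exact he
      · exact absurd (by simp) (hM.notMem_seg_of_cubic hG hcard hK ha h ⟨haw, h.2.1, hw⟩ hwb.symm
          hbs hnd ht hx htx htb hxb hpb)
      · exact absurd (by simp) (hM.notMem_seg_of_cubic hG hcard hK hb h.symm ⟨hbw, h.2.2, hw⟩
          hwa.symm hbs hnd ht' hx' htx htb hxb hpb)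
    · exact absurd (hM.isMinor_of_edge_vertex h hw hwa hwb (by simpa using hpoor) hZ hZa hZb hpZ
        (Or.inl rfl)) hK
  · exfalso
    have hp' : p ∈ inner d c := by rw [hM.rev c d hcd.1]; simpa using hp
    have hcd' := hcd.2
    simp only [List.mem_singleton, Prod.mk.injEq] at hcd'
    by_cases hca : c = a
    · subst hca
      exact hM.false_of_adjacent_seg hG hcard hK h hbs hnd ht hx htx htb hxb hpb hcd.1
        (by tauto) hp
    by_cases hda : d = a
    · subst hda
      exact hM.false_of_adjacent_seg hG hcard hK h hbs hnd ht hx htx htb hxb hpb hcd.1.symm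
        (by tauto) hp'
    by_cases hcb : c = b
    · subst hcb
      exact hM.false_of_adjacent_seg hG hcard hK h.symm hbs hnd ht' hx' htx htb hxb hpb hcd.1
        (by tauto) hp
    by_cases hdb : d = b
    · subst hdb
      exact hM.false_of_adjacent_seg hG hcard hK h.symm hbs hnd ht' hx' htx htb hxb hpb hcd.1.symm
        (by tauto) hp'
    by_cases hc : poor a b c = true
    · by_cases hd : poor a b d = true
      · exact hK (hM.isMinor_of_edge_edge h hcd.1 hca hcb hda hdb hc hd hZ hZa hZb hpZ hp)
      · exact hK (hM.isMinor_of_edge_vertex h hcd.1.2.2 hda hdb (by simpa using hd) hZ hZa hZb hpZ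
          (Or.inr ⟨c, ⟨hcd.1.symm, hcd.2.2, hcd.2.1⟩, hp'⟩))
    · exact hK (hM.isMinor_of_edge_vertex h hcd.1.2.1 hca hcb (by simpa using hc) hZ hZa hZb hpZ
        (Or.inr ⟨d, hcd, hp⟩))

end

/-! ### Varying one segment -/

/-- `Out` and the path `S` form a subdivision of `F₄`, with `S` the segment `a b`, including its
ends. -/
def PathModel (G : SimpleGraph V) (vert : ℕ → V) (a b : ℕ) (Out : Set V) (S : List V) : Prop :=
  ∃ inner, IsModel G vert inner ∧ seg vert inner a b = S ∧ pathOut vert inner a b = Out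

section

variable {vert : ℕ → V} {a b : ℕ} {Out : Set V} {S S' : List V}

lemma IsModel.seg_nodup {inner : ℕ → ℕ → List V} (hM : IsModel G vert inner) (h : IsEdge a b) :
    (seg vert inner a b).Nodup := by
  have h1 := hM.nodup a b h
  have h2 := hM.vert_notMem a h.2.1 a b h
  have h3 := hM.vert_notMem b h.2.2 a b h
  have h4 : vert a ≠ vert b := fun e => h.ne (hM.inj a h.2.1 b h.2.2 e)
  rw [seg, List.cons_append, List.nodup_cons, List.nodup_append]
  refine ⟨by simp [h2, h4], h1, by simp, ?_⟩
  rintro x hx y hy rfl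
  rw [List.mem_singleton] at hy
  exact h3 (hy ▸ hx)

lemma PathModel.chain (h : PathModel G vert a b Out S) (he : IsEdge a b) : S.IsChain G.Adj := by
  obtain ⟨inner, hM, rfl, rfl⟩ := h
  exact hM.path a b he

lemma PathModel.nodup (h : PathModel G vert a b Out S) (he : IsEdge a b) : S.Nodup := by
  obtain ⟨inner, hM, rfl, rfl⟩ := h
  exact hM.seg_nodup he

lemma PathModel.head (h : PathModel G vert a b Out S) : S.head? = some (vert a) := by
  obtain ⟨inner, hM, rfl, rfl⟩ := h
  simp [seg]

lemma PathModel.last (h : PathModel G vert a b Out S) : S.getLast? = some (vert b) := by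
  obtain ⟨inner, hM, rfl, rfl⟩ := h
  rw [seg, List.getLast?_append_of_ne_nil _ (by simp)]
  rfl

lemma PathModel.eq_end (h : PathModel G vert a b Out S) (he : IsEdge a b) :
    ∀ y ∈ S, y ∈ Out → y = vert a ∨ y = vert b := by
  obtain ⟨inner, hM, rfl, rfl⟩ := h
  intro y hy ho
  have := fun hy => hM.notMem_pathOut he y hy ho
  simp only [seg, List.cons_append, List.mem_cons, List.mem_append, List.not_mem_nil,
    or_false] at hy
  tauto

lemma keepWithout_comm (i j : ℕ) :
    keepWithout [(b, a)] i j ↔ keepWithout [(a, b)] i j := by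
  simp only [keepWithout, List.mem_singleton, Prod.mk.injEq]
  tauto

lemma pathOut_comm {inner : ℕ → ℕ → List V} : pathOut vert inner b a = pathOut vert inner a b :=
  Set.Subset.antisymm (modelPart_mono (fun _ h => h) fun i j h => (keepWithout_comm i j).1 h)
    (modelPart_mono (fun _ h => h) fun i j h => (keepWithout_comm i j).2 h)

lemma PathModel.reverse (h : PathModel G vert a b Out S) (he : IsEdge a b) :
    PathModel G vert b a Out S.reverse := by
  obtain ⟨inner, hM, rfl, rfl⟩ := h
  refine ⟨inner, hM, ?_, pathOut_comm⟩
  rw [seg, seg, hM.rev a b he]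
  simp

lemma PathModel.vert_mem (h : PathModel G vert a b Out S) {i : ℕ} (hi : i < 10) :
    vert i ∈ Out := by
  obtain ⟨inner, hM, rfl, rfl⟩ := h
  exact Or.inl ⟨i, hi, rfl⟩

lemma PathModel.inj (h : PathModel G vert a b Out S) : ∀ i < 10, ∀ j < 10, vert i = vert j →
    i = j := by
  obtain ⟨inner, hM, rfl, rfl⟩ := h
  exact hM.inj

lemma PathModel.modelVerts_subset {inner : ℕ → ℕ → List V} (hM : IsModel G vert inner)
    (he : IsEdge a b) : modelVerts vert inner ⊆
      pathOut vert inner a b ∪ lset (seg vert inner a b) := by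
  rintro x (hx | ⟨i, j, hij, hx⟩)
  · exact Or.inl (Or.inl hx)
  · by_cases h1 : i = a ∧ j = b
    · obtain ⟨rfl, rfl⟩ := h1
      exact Or.inr (by simp [seg, hx])
    by_cases h2 : i = b ∧ j = a
    · obtain ⟨rfl, rfl⟩ := h2
      rw [hM.rev _ _ he] at hx
      exact Or.inr (by simp [seg] at hx ⊢; tauto)
    · exact Or.inl (Or.inr ⟨i, j, ⟨hij, by simpa using h1, by simp; tauto⟩, hx⟩)

/-- A segment can be replaced by another path with the same ends that avoids the rest of the
subdivision. -/
lemma PathModel.replace (h : PathModel G vert a b Out S) (he : IsEdge a b)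
    (hc : S'.IsChain G.Adj) (hn : S'.Nodup) (hh : S'.head? = some (vert a))
    (hl : S'.getLast? = some (vert b))
    (hO : ∀ y ∈ S', y ∈ Out → y = vert a ∨ y = vert b) : PathModel G vert a b Out S' := by
  obtain ⟨inner, hM, rfl, rfl⟩ := h
  have hab : vert a ≠ vert b := fun e => he.ne (hM.inj a he.2.1 b he.2.2 e)
  obtain ⟨F, rfl⟩ : ∃ F, S' = vert a :: F ++ [vert b] := by
    cases S' with
    | nil => simp at hh
    | cons s S' =>
      simp only [List.head?_cons, Option.some.injEq] at hh
      subst hh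
      rcases List.eq_nil_or_concat S' with rfl | ⟨F, z, rfl⟩
      · simp at hl
        exact absurd hl hab
      · refine ⟨F, ?_⟩
        rw [List.concat_eq_append, ← List.cons_append,
          List.getLast?_append_of_ne_nil _ (by simp)] at hl
        simp at hl
        simp [hl]
  have hn' : F.Nodup ∧ vert a ∉ F ∧ vert b ∉ F := by
    rw [List.cons_append, List.nodup_cons, List.nodup_append] at hn
    refine ⟨hn.2.1, fun h => hn.1 (by simp [h]), fun h => hn.2.2.2 _ h _ (by simp) rfl⟩
  have hFO : ∀ y ∈ F, y ∉ pathOut vert inner a b := by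
    intro y hy ho
    rcases hO y (by simp [hy]) ho with rfl | rfl
    · exact hn'.2.1 hy
    · exact hn'.2.2 hy
  classical
  let inner' : ℕ → ℕ → List V := fun i j =>
    if i = a ∧ j = b then F else if i = b ∧ j = a then F.reverse else inner i j
  have e1 : inner' a b = F := by simp [inner']
  have e2 : inner' b a = F.reverse := by simp [inner', he.ne]
  have e3 : ∀ i j, keepWithout [(a, b)] i j → inner' i j = inner i j := by
    intro i j h
    have h1 := h.2.1
    have h2 := h.2.2
    simp only [List.mem_singleton, Prod.mk.injEq] at h1 h2
    simp only [inner']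
    rw [if_neg h1, if_neg (by tauto)]
  have hcases : ∀ i j, IsEdge i j → (i = a ∧ j = b) ∨ (i = b ∧ j = a) ∨
      keepWithout [(a, b)] i j := by
    intro i j h
    simp only [keepWithout, List.mem_singleton, Prod.mk.injEq]
    tauto
  have hsym : ∀ i j, keepWithout [(a, b)] i j → keepWithout [(a, b)] j i := fun i j h =>
    ⟨h.1.symm, h.2.2, h.2.1⟩
  have hout : pathOut vert inner' a b = pathOut vert inner a b := by
    ext x
    refine or_congr_right ⟨?_, ?_⟩
    · rintro ⟨i, j, hij, hx⟩
      exact ⟨i, j, hij, e3 i j hij ▸ hx⟩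
    · rintro ⟨i, j, hij, hx⟩
      exact ⟨i, j, hij, (e3 i j hij).symm ▸ hx⟩
  have hF' : ∀ y ∈ F, ∀ i j, keepWithout [(a, b)] i j → y ∉ inner i j := fun y hy i j hij hy' =>
    hFO y hy (Or.inr ⟨i, j, hij, hy'⟩)
  refine ⟨inner', ⟨?_, ?_, ?_, hM.inj, ?_, ?_⟩, by rw [seg, e1], hout⟩
  · intro i j h
    rcases hcases i j h with ⟨rfl, rfl⟩ | ⟨rfl, rfl⟩ | h'
    · rw [e1]; exact hc
    · rw [e2]; exact PathVia.symm hc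
    · rw [e3 i j h']; exact hM.path i j h
  · intro i j h
    rcases hcases i j h with ⟨rfl, rfl⟩ | ⟨rfl, rfl⟩ | h'
    · rw [e1, e2]
    · rw [e1, e2]; simp
    · rw [e3 i j h', e3 j i (hsym i j h')]; exact hM.rev i j h
  · intro i j h
    rcases hcases i j h with ⟨rfl, rfl⟩ | ⟨rfl, rfl⟩ | h'
    · rw [e1]; exact hn'.1
    · rw [e2]; exact List.nodup_reverse.2 hn'.1
    · rw [e3 i j h']; exact hM.nodup i j h
  · intro k hk i j h
    have hkF : vert k ∉ F := fun hm => hFO _ hm (Or.inl ⟨k, hk, rfl⟩)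
    rcases hcases i j h with ⟨rfl, rfl⟩ | ⟨rfl, rfl⟩ | h'
    · rw [e1]; exact hkF
    · rw [e2]; simpa using hkF
    · rw [e3 i j h']; exact hM.vert_notMem k hk i j h
  · intro i j h k l h' x hx hx'
    rcases hcases i j h with ⟨rfl, rfl⟩ | ⟨rfl, rfl⟩ | hk <;>
      rcases hcases k l h' with ⟨rfl, rfl⟩ | ⟨rfl, rfl⟩ | hk'
    · simp
    · simp
    · rw [e1] at hx
      rw [e3 k l hk'] at hx'
      exact absurd hx' (hF' x hx k l hk')
    · simp
    · simp
    · rw [e2, List.mem_reverse] at hx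
      rw [e3 k l hk'] at hx'
      exact absurd hx' (hF' x hx k l hk')
    · rw [e1] at hx'
      rw [e3 i j hk] at hx
      exact absurd hx (hF' x hx' i j hk)
    · rw [e2, List.mem_reverse] at hx'
      rw [e3 i j hk] at hx
      exact absurd hx (hF' x hx' i j hk)
    · rw [e3 i j hk] at hx
      rw [e3 k l hk'] at hx'
      exact hM.disj i j h k l h' x hx hx'

end

/-- A segment `a b` of a subdivision and a connected set `bs` off it that is attached to the
vertices `t` and `x` of the segment. -/
structure PathConfig (G : SimpleGraph V) (vert : ℕ → V) (a b : ℕ) (Out : Set V) (X : List V) (t : V)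
    (Y : List V) (x : V) (Z bs : List V) : Prop where
  edge : IsEdge a b
  model : PathModel G vert a b Out (X ++ t :: (Y ++ x :: Z))
  core : IsCore G Out (lset bs)
  nodup : (X ++ t :: (Y ++ x :: Z) ++ bs).Nodup
  att₀ : Joined G {t} (lset bs)
  att₁ : Joined G {x} (lset bs)

/-- No set attached as in `PathConfig`, and also to the vertices in `W`, has more than `n`
vertices. -/
def PathBound (G : SimpleGraph V) (vert : ℕ → V) (a b : ℕ) (Out W : Set V) (n : ℕ) : Prop :=
  ∀ X t Y x Z bs, PathConfig G vert a b Out X t Y x Z bs → (∀ w ∈ W, Joined G {w} (lset bs)) →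
    bs.length ≤ n

section

variable {vert : ℕ → V} {a b : ℕ} {Out W : Set V} {X Y Z bs js : List V} {t x z p : V}

lemma PathConfig.reverse (h : PathConfig G vert a b Out X t Y x Z bs) :
    PathConfig G vert b a Out Z.reverse x Y.reverse t X.reverse bs := by
  classical
  refine ⟨h.edge.symm, ?_, h.core, nodup_of_count h.nodup fun c => ?_, h.att₁, h.att₀⟩
  · simpa using h.model.reverse h.edge
  · simp only [List.count_append, List.count_cons, List.count_reverse]
    omega

lemma PathBound.reverse {n : ℕ} (h : PathBound G vert a b Out W n) :
    PathBound G vert b a Out W n :=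
  fun _ _ _ _ _ _ hc hw => h _ _ _ _ _ _ hc.reverse hw

/-- `IsModel.exists_exceptional` for a configuration. -/
lemma PathConfig.exists_exceptional [Finite V] (h : PathConfig G vert a b Out X t Y x Z bs)
    (hG : InternallyFourConnected G) (hcard : 6 < Nat.card V) (hK : ¬ IsMinor K34 G)
    (hpb : Joined G {p} (lset bs)) (hp : p ∈ Out) (hpS : p ∉ X ++ t :: (Y ++ x :: Z)) :
    ∃ w < 10, p = vert w ∧ exceptional a b w = true := by
  have hnd := h.nodup
  rw [List.nodup_append] at hnd
  have hS := h.model.head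
  have hS' := h.model.last
  have hpa : p ≠ vert a := fun e => hpS (e ▸ List.mem_of_head? hS)
  have hpv : p ≠ vert b := fun e => hpS (e ▸ List.mem_of_getLast? hS')
  obtain ⟨inner, hM, hseg, rfl⟩ := h.model
  have hcore : IsCore G (modelVerts vert inner) (lset bs) := by
    refine ⟨h.core.conn, fun y hy hy' => ?_⟩
    rcases PathModel.modelVerts_subset hM h.edge hy' with hy' | hy'
    · exact h.core.disj y hy hy'
    · rw [hseg] at hy'
      exact hnd.2.2 y hy' y hy rfl
  have htx : t ≠ x := by
    rintro rfl
    have := hnd.1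
    rw [List.nodup_append, List.nodup_cons] at this
    exact this.2.1.1 (by simp)
  exact hM.exists_exceptional hG hcard hK h.edge hcore hnd.2.1 (t := t) (x := x)
    (by rw [hseg]; simp) (by rw [hseg]; simp) htx h.att₀ h.att₁ hpb hp hpa hpv

lemma head?_append_cons {X Y Z : List V} {z : V} :
    (X ++ z :: Y).head? = (X ++ z :: Z).head? := by
  cases X <;> simp

lemma getLast?_append_cons {X Y Z : List V} {z : V} :
    (X ++ z :: Z).getLast? = (Y ++ z :: Z).getLast? := by
  rw [List.getLast?_append_of_ne_nil _ (by simp), List.getLast?_append_of_ne_nil _ (by simp)]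

/-- Neither end of the segment is an inner vertex of the path between `t` and `x`. -/
lemma PathConfig.inner_notMem (h : PathConfig G vert a b Out X t Y x Z bs) :
    ∀ y ∈ Y, y ∉ Out := by
  classical
  intro y hy ho
  have hnd := h.nodup
  have h1 : ((X ++ [t]) ++ (Y ++ x :: Z)).Nodup := nodup_of_count hnd fun c => by
    simp only [List.count_append, List.count_cons, List.count_nil]; omega
  have h2 : ((X ++ t :: Y) ++ (x :: Z)).Nodup := nodup_of_count hnd fun c => by
    simp only [List.count_append, List.count_cons]; omega
  rw [List.nodup_append] at h1 h2
  rcases h.model.eq_end h.edge y (by simp [hy]) ho with rfl | rfl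
  · refine h1.2.2 (vert a) (List.mem_of_head? ?_) (vert a) (by simp [hy]) rfl
    rw [← h.model.head]
    exact head?_append_cons
  · refine h2.2.2 (vert b) (by simp [hy]) (vert b) (List.mem_of_getLast? ?_) rfl
    rw [← h.model.last, ← List.cons_append, ← List.append_assoc,
      List.getLast?_append_of_ne_nil _ (by simp)]

/-- All vertices of a configuration. -/
abbrev pathVerts (Out : Set V) (X : List V) (t : V) (Y : List V) (x : V) (Z bs : List V) : Set V :=
  Out ∪ lset (X ++ t :: (Y ++ x :: Z) ++ bs)

lemma PathConfig.nodup_jump (h : PathConfig G vert a b Out X t Y x Z bs)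
    (hj : IsJump G (pathVerts Out X t Y x Z bs) z js p) :
    (X ++ t :: (Y ++ x :: Z) ++ bs ++ js).Nodup := by
  rw [List.nodup_append]
  refine ⟨h.nodup, hj.nodup, ?_⟩
  rintro c hc _ hb rfl
  exact hj.avoid c hb (Or.inr hc)

/-- By maximality, a path from `bs` to the configuration has no inner vertices: these could be added
to `bs`. -/
lemma PathConfig.joined_of_jump (h : PathConfig G vert a b Out X t Y x Z bs)
    (hb : PathBound G vert a b Out W bs.length) (hW : ∀ w ∈ W, Joined G {w} (lset bs))
    (hz : z ∈ bs) (hj : IsJump G (pathVerts Out X t Y x Z bs) z js p) :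
    Joined G {p} (lset bs) := by
  have hsub : lset bs ⊆ lset (bs ++ js) := by intro c; simp; tauto
  have h1 := hb X t Y x Z (bs ++ js) ⟨h.edge, h.model, ⟨?_, ?_⟩, by simpa using h.nodup_jump hj,
    h.att₀.mono subset_rfl hsub, h.att₁.mono subset_rfl hsub⟩
    fun w hw => (hW w hw).mono subset_rfl hsub
  · have h2 : js = [] := by
      rw [← List.length_eq_zero_iff]
      rw [List.length_append] at h1
      omega
    subst h2
    have := hj.chain
    simp at this
    exact ⟨p, rfl, z, hz, this.symm⟩
  · have e : lset (bs ++ js) = lset bs ∪ lset (z :: js) := by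
      ext c; simp only [lset_append, Set.mem_union, mem_lset, List.mem_cons]; grind
    rw [e]
    exact connected_union_of_mem h.core.conn (PathVia.connected_left hj.chain) hz (by simp)
  · intro c hc ho
    rcases List.mem_append.1 hc with hc | hc
    · exact h.core.disj c hc ho
    · exact hj.avoid c hc (Or.inl ho)

/-- A path from a vertex between `t` and `x` to the segment behind `x` can replace a part of the
segment that contains `x`; then `bs` can be made larger. -/
lemma PathConfig.no_jump_behind (h : PathConfig G vert a b Out X t Y x Z bs)
    (hb : PathBound G vert a b Out W bs.length) (hW : ∀ w ∈ W, Joined G {w} (lset bs))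
    (hz : z ∈ Y) (hj : IsJump G (pathVerts Out X t Y x Z bs) z js p) : p ∉ Z := by
  classical
  intro hp
  obtain ⟨Y₁, Y₂, rfl⟩ := List.append_of_mem hz
  obtain ⟨Z₁, Z₂, rfl⟩ := List.append_of_mem hp
  have hnd := h.nodup_jump hj
  have hc := h.model.chain h.edge
  have e : X ++ t :: (Y₁ ++ z :: Y₂ ++ x :: (Z₁ ++ p :: Z₂)) =
      (X ++ t :: Y₁) ++ z :: ((Y₂ ++ x :: Z₁) ++ p :: Z₂) := by simp
  have hsplit := List.isChain_split.1 (e ▸ hc)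
  have hsplit' : PathVia G z (Y₂ ++ x :: Z₁) p ∧ (p :: Z₂).IsChain G.Adj := by
    have := hsplit.2
    rw [← List.cons_append, List.isChain_split] at this
    exact this
  have hinner : ∀ c ∈ Y₂ ++ x :: Z₁, c ∉ Out := by
    intro c hc' ho
    have h1 : ((X ++ t :: Y₁ ++ [z]) ++ ((Y₂ ++ x :: Z₁) ++ p :: Z₂)).Nodup :=
      nodup_of_count h.nodup fun c => by
        simp only [List.count_append, List.count_cons, List.count_nil]; omega
    have h2 := List.nodup_append.1 h1
    rcases h.model.eq_end h.edge c (by rw [e]; simp at hc' ⊢; tauto) ho with rfl | rfl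
    · refine h2.2.2 (vert a) (List.mem_of_head? ?_) (vert a)
        (List.mem_append.2 (Or.inl hc')) rfl
      rw [← h.model.head, e]
      exact head?_append_cons
    · refine (List.nodup_append.1 h2.2.1).2.2 (vert b) hc' (vert b) (List.mem_of_getLast? ?_) rfl
      rw [← h.model.last, e, ← List.cons_append, ← List.append_assoc,
        List.getLast?_append_of_ne_nil _ (by simp)]
  have hne : Y₂ ++ x :: Z₁ ≠ [] := by simp
  have hx : Joined G (lset (Y₂ ++ x :: Z₁)) (lset bs) := h.att₁.mono (by simp) subset_rfl
  have eB : lset (bs ++ (Y₂ ++ x :: Z₁)) = lset bs ∪ lset (Y₂ ++ x :: Z₁) := lset_append _ _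
  have hj' : PathVia G z js p := hj.chain
  have := hb (X ++ t :: Y₁) z js p Z₂ (bs ++ (Y₂ ++ x :: Z₁)) ⟨h.edge,
    h.model.replace h.edge ?_ ?_ ?_ ?_ ?_, ⟨?_, ?_⟩, ?_, ?_, ?_⟩
    (fun w hw => (hW w hw).mono subset_rfl (by simp [eB]))
  · rw [List.length_append] at this
    exact hne (List.length_eq_zero_iff.1 (by omega))
  · refine List.isChain_split.2 ⟨hsplit.1, ?_⟩
    rw [← List.cons_append, List.isChain_split]
    exact ⟨hj', hsplit'.2⟩
  · refine nodup_of_count hnd fun c => ?_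
    simp only [List.count_append, List.count_cons]
    omega
  · rw [← h.model.head, e]
    exact head?_append_cons
  · rw [← h.model.last, e, ← List.cons_append, ← List.cons_append, ← List.append_assoc,
      ← List.append_assoc]
    exact getLast?_append_cons
  · intro y hy ho
    have hjy : y ∉ js := fun hm => hj.avoid y hm (Or.inl ho)
    refine h.model.eq_end h.edge y ?_ ho
    rw [e]
    simp at hy ⊢
    tauto
  · rw [eB]
    exact connected_union_of_joined h.core.conn (hsplit'.1.connected_inner hne) hx.symm
  · intro c hc' ho
    rcases List.mem_append.1 hc' with hc' | hc'
    · exact h.core.disj c hc' ho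
    · exact hinner c hc' ho
  · refine nodup_of_count hnd fun c => ?_
    simp only [List.count_append, List.count_cons]
    omega
  · exact (hsplit'.1.joined_inner (S := {z}) hne rfl).mono subset_rfl (by simp [eB])
  · exact (hsplit'.1.joined_inner' (S := {p}) hne rfl).mono subset_rfl (by simp [eB])

/-- If a path from a vertex between `t` and `x` ends in `Out`, then the segment can be led through
`bs`, and the part of the old one between `t` and `x`, together with the path, takes the role of
`bs`. -/
lemma PathConfig.reroute (h : PathConfig G vert a b Out X t Y x Z bs) (hz : z ∈ Y)
    (hj : IsJump G (pathVerts Out X t Y x Z bs) z js p) :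
    ∃ ls, PathConfig G vert a b Out X t ls x Z (Y ++ js) ∧ Joined G {p} (lset (Y ++ js)) := by
  classical
  obtain ⟨ls, hls, hlsn, hlsb⟩ := exists_path_through h.core.conn h.att₀ h.att₁
  have hls : PathVia G t ls x := hls
  have hnd := h.nodup_jump hj
  have hc := h.model.chain h.edge
  have hsplit := List.isChain_split.1 hc
  have hsplit' : PathVia G t Y x ∧ (x :: Z).IsChain G.Adj := by
    have := hsplit.2
    rw [← List.cons_append, List.isChain_split] at this
    exact this
  have hYne := List.ne_nil_of_mem hz
  have hpj : PathVia G z js p := hj.chain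
  have eB : lset (Y ++ js) = lset Y ∪ lset (z :: js) := by
    ext c; simp only [lset_append, Set.mem_union, mem_lset, List.mem_cons]; grind
  have hnd' : (X ++ t :: (ls ++ x :: Z) ++ (Y ++ js)).Nodup := by
    have h1 : ((X ++ t :: x :: Z ++ (Y ++ js)) ++ bs).Nodup := nodup_of_count hnd fun c => by
      simp only [List.count_append, List.count_cons]; omega
    rw [List.nodup_append] at h1
    have h2 : ((X ++ t :: x :: Z ++ (Y ++ js)) ++ ls).Nodup := by
      rw [List.nodup_append]
      exact ⟨h1.1, hlsn, fun c hc d hd => h1.2.2 c hc d (hlsb d hd)⟩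
    refine nodup_of_count h2 fun c => ?_
    simp only [List.count_append, List.count_cons]
    omega
  refine ⟨ls, ⟨h.edge, h.model.replace h.edge ?_ (List.nodup_append.1 hnd').1 ?_ ?_ ?_, ⟨?_, ?_⟩,
    hnd', ?_, ?_⟩, ?_⟩
  · refine List.isChain_split.2 ⟨hsplit.1, ?_⟩
    rw [← List.cons_append, List.isChain_split]
    exact ⟨hls, hsplit'.2⟩
  · rw [← h.model.head]
    exact head?_append_cons
  · rw [← h.model.last, ← List.cons_append, ← List.cons_append, ← List.append_assoc,
      ← List.append_assoc]
    exact getLast?_append_cons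
  · intro y hy ho
    have : y ∉ ls := fun hm => h.core.disj y (hlsb y hm) ho
    refine h.model.eq_end h.edge y ?_ ho
    simp at hy ⊢
    tauto
  · rw [eB]
    exact connected_union_of_mem (hsplit'.1.connected_inner hYne) hpj.connected_left (x := z) hz
      (by simp)
  · intro c hc' ho
    rcases List.mem_append.1 hc' with hc' | hc'
    · exact h.inner_notMem c hc' ho
    · exact hj.avoid c hc' (Or.inl ho)
  · exact (hsplit'.1.joined_inner (S := {t}) hYne rfl).mono subset_rfl (by simp [eB])
  · exact (hsplit'.1.joined_inner' (S := {x}) hYne rfl).mono subset_rfl (by simp [eB])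
  · exact (hpj.joined_left (by simp) (by simp +contextual) (by simp) : Joined G (lset (z :: js))
      {p}).symm.mono subset_rfl (by simp [eB])

end

/-! ### No set is attached to two vertices of a segment -/

set_option synthInstance.maxSize 100000 in
set_option synthInstance.maxHeartbeats 400000 in
lemma exists_two_others : ∀ a < 10, ∀ b < 10, ∀ w < 10, ∃ k < 10, ∃ k' < 10, k ≠ k' ∧ k ≠ a ∧
    k ≠ b ∧ k ≠ w ∧ k' ≠ a ∧ k' ≠ b ∧ k' ≠ w := by decide

set_option synthInstance.maxSize 100000 in
set_option synthInstance.maxHeartbeats 400000 in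
lemma exceptional_ne : ∀ a < 10, ∀ b < 10, ∀ w < 10, exceptional a b w = true → w ≠ a ∧ w ≠ b := by
  decide

section

variable {vert : ℕ → V} {a b w : ℕ} {Out W : Set V} {X Y Z bs js A B : List V} {t x z p : V}

lemma PathConfig.pathVia (h : PathConfig G vert a b Out X t Y x Z bs) : PathVia G t Y x := by
  have := (List.isChain_split.1 (h.model.chain h.edge)).2
  rw [← List.cons_append, List.isChain_split] at this
  exact this.1

/-- A vertex between `t` and `x`, or in `bs`, is the start of a path to a vertex of the
configuration other than `t`, `x` and `s`. Here `s` is a branch vertex off the segment, or `s = t`,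
in which case it is no further restriction. -/
lemma PathConfig.exists_jump [Finite V] (hG : InternallyFourConnected G) (hcard : 6 < Nat.card V)
    (h : PathConfig G vert a b Out X t Y x Z bs) {s : V}
    (hs : s = t ∨ ∃ w < 10, w ≠ a ∧ w ≠ b ∧ s = vert w) :
    ∃ z, (z ∈ Y ∨ z ∈ bs) ∧ ∃ p ∈ pathVerts Out X t Y x Z bs, p ∉ Y ∧ p ∉ bs ∧ p ≠ s ∧ p ≠ t ∧
      p ≠ x ∧ ∃ js, IsJump G (pathVerts Out X t Y x Z bs) z js p := by
  have hend := h.model.eq_end h.edge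
  have hinj := h.model.inj
  have ha := h.edge.2.1
  have hb := h.edge.2.2
  have hnd : ((X ++ t :: (Y ++ x :: Z)) ++ bs).Nodup := h.nodup
  rw [List.nodup_append] at hnd
  have hvt : ∀ k < 10, k ≠ a → k ≠ b → vert k ∉ X ++ t :: (Y ++ x :: Z) := by
    intro k hk hka hkb hm
    rcases hend _ hm (h.model.vert_mem hk) with e | e
    · exact hka (hinj k hk a ha e)
    · exact hkb (hinj k hk b hb e)
  have hvb : ∀ k < 10, vert k ∉ bs := fun k hk hm => h.core.disj _ hm (h.model.vert_mem hk)
  obtain ⟨w, hw, hsw⟩ : ∃ w < 10, s = t ∨ (s = vert w ∧ w ≠ a ∧ w ≠ b) := by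
    rcases hs with rfl | ⟨w, hw, h1, h2, rfl⟩
    · exact ⟨a, ha, Or.inl rfl⟩
    · exact ⟨w, hw, Or.inr ⟨rfl, h1, h2⟩⟩
  obtain ⟨k, hk, k', hk', hkk, hka, hkb, hkw, hka', hkb', hkw'⟩ := exists_two_others a ha b hb w hw
  have hsD : s ∉ lset (Y ++ bs) := by
    intro hm
    rcases hsw with rfl | ⟨rfl, h1, h2⟩
    · simp only [mem_lset, List.mem_append] at hm
      rcases hm with hm | hm
      · have := hnd.1
        rw [List.nodup_append, List.nodup_cons] at this
        exact this.2.1.1 (by simp [hm])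
      · exact hnd.2.2 s (by simp) s hm rfl
    · simp only [mem_lset, List.mem_append] at hm
      rcases hm with hm | hm
      · exact hvt w hw h1 h2 (by simp [hm])
      · exact hvb w hw hm
  have htD : t ∉ lset (Y ++ bs) := by
    intro hm
    simp only [mem_lset, List.mem_append] at hm
    rcases hm with hm | hm
    · have := hnd.1
      rw [List.nodup_append, List.nodup_cons] at this
      exact this.2.1.1 (by simp [hm])
    · exact hnd.2.2 t (by simp) t hm rfl
  have hxD : x ∉ lset (Y ++ bs) := by
    intro hm
    simp only [mem_lset, List.mem_append] at hm
    rcases hm with hm | hm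
    · have := hnd.1
      rw [List.nodup_append, List.nodup_cons, List.nodup_append] at this
      exact this.2.1.2.2.2 x hm x (by simp) rfl
    · exact hnd.2.2 x (by simp) x hm rfl
  have hother : ∀ k < 10, k ≠ a → k ≠ b → k ≠ w → vert k ∉ lset (Y ++ bs) ∧
      vert k ∉ ({s, t, x} : Set V) := by
    intro k hk hka hkb hkw
    have h1 := hvt k hk hka hkb
    have h2 := hvb k hk
    simp only [List.mem_append, List.mem_cons, not_or] at h1
    refine ⟨by simp [h1, h2], ?_⟩
    simp only [Set.mem_insert_iff, Set.mem_singleton_iff, not_or]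
    refine ⟨?_, h1.2.1, h1.2.2.2.1⟩
    rcases hsw with rfl | ⟨rfl, -, -⟩
    · exact h1.2.1
    · exact fun e => hkw (hinj k hk w hw e)
  have hbne : bs ≠ [] := h.att₀.symm.ne_nil
  obtain ⟨c, hc⟩ := List.exists_mem_of_ne_nil bs hbne
  have hdis : Disjoint ({s, t, x} : Set V) (lset (Y ++ bs)) := by
    rw [Set.disjoint_left]
    rintro y (rfl | rfl | rfl)
    exacts [hsD, htD, hxD]
  have htwo : (∃ c ∈ ({s, t, x} : Set V), ∃ d ∈ ({s, t, x} : Set V), G.Adj c d) ∨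
      ∃ c ∈ lset (Y ++ bs), ∃ d ∈ lset (Y ++ bs), c ≠ d := by
    rcases eq_or_ne Y [] with rfl | hY
    · have := h.pathVia
      simp only [PathVia, List.cons_append, List.nil_append, List.isChain_cons_cons] at this
      exact Or.inl ⟨t, by simp, x, by simp, this.1⟩
    · obtain ⟨y, hy⟩ := List.exists_mem_of_ne_nil Y hY
      exact Or.inr ⟨y, by simp [hy], c, by simp [hc], hnd.2.2 y (by simp [hy]) c hc⟩
  obtain ⟨z, hz, p, hp, hpD, hpS, js, hj⟩ := GraphF4.exists_jump hG hcard (S := {s, t, x})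
    (D := lset (Y ++ bs)) (K := pathVerts Out X t Y x Z bs) (ncard_triple_le s t x) hdis
    ⟨c, by simp [hc]⟩ htwo ⟨vert k, Or.inl (h.model.vert_mem hk), vert k',
      Or.inl (h.model.vert_mem hk'), fun e => hkk (hinj k hk k' hk' e),
      (hother k hk hka hkb hkw).1, (hother k' hk' hka' hkb' hkw').1,
      (hother k hk hka hkb hkw).2, (hother k' hk' hka' hkb' hkw').2⟩
  simp only [Set.mem_insert_iff, Set.mem_singleton_iff, not_or] at hpS
  simp only [mem_lset, List.mem_append, not_or] at hz hpD
  exact ⟨z, hz, p, hp, hpD.1, hpD.2, hpS.1, hpS.2.1, hpS.2.2, js,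
    hj.mono fun j hjj hjK => hj.avoid j hjj (Or.inl (Or.inl hjK))⟩

/-- The vertices `t` and `x` can be chosen as the first and the last attachment on the segment. -/
lemma PathConfig.exists_extremal (h : PathConfig G vert a b Out X t Y x Z bs) :
    ∃ X' t' Y' x' Z', PathConfig G vert a b Out X' t' Y' x' Z' bs ∧
      (∀ y ∈ X', ¬ Joined G {y} (lset bs)) ∧ ∀ y ∈ Z', ¬ Joined G {y} (lset bs) := by
  have hnd := (List.nodup_append.1 h.nodup).1
  obtain ⟨X', t', B, hS, ht', hX'⟩ := exists_first (l := X ++ t :: (Y ++ x :: Z))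
    (P := fun y => Joined G {y} (lset bs)) ⟨t, by simp, h.att₀⟩
  have hB : ∃ y ∈ B, Joined G {y} (lset bs) := by
    have hm : ∀ y ∈ X ++ t :: (Y ++ x :: Z), Joined G {y} (lset bs) → y = t' ∨ y ∈ B := by
      intro y hy hj
      rw [hS] at hy
      simp only [List.mem_append, List.mem_cons] at hy
      rcases hy with hy | hy
      · exact absurd hj (hX' y hy)
      · exact hy
    rcases hm t (by simp) h.att₀ with rfl | ht
    · rcases hm x (by simp) h.att₁ with rfl | hx
      · rw [List.nodup_append, List.nodup_cons] at hnd
        exact absurd (by simp) hnd.2.1.1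
      · exact ⟨x, hx, h.att₁⟩
    · exact ⟨t, ht, h.att₀⟩
  obtain ⟨Y', x', Z', rfl, hx', hZ'⟩ := exists_last hB
  exact ⟨X', t', Y', x', Z', ⟨h.edge, hS ▸ h.model, h.core, hS ▸ h.nodup, ht', hx'⟩, hX', hZ'⟩

/-- If `bs` is as large as possible, then there is an exceptional branch vertex, other than a given
one, to which `bs` is attached or which is the end of a path from a vertex between `t` and `x`. -/
lemma PathConfig.exists_exceptional_jump [Finite V] (hG : InternallyFourConnected G)
    (hcard : 6 < Nat.card V) (hK : ¬ IsMinor K34 G)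
    (h : PathConfig G vert a b Out X t Y x Z bs)
    (hb : PathBound G vert a b Out W bs.length) (hW : ∀ w ∈ W, Joined G {w} (lset bs))
    (hX : ∀ y ∈ X, ¬ Joined G {y} (lset bs)) (hZ : ∀ y ∈ Z, ¬ Joined G {y} (lset bs))
    {s : V} (hs : s = t ∨ ∃ w < 10, w ≠ a ∧ w ≠ b ∧ s = vert w) :
    ∃ w < 10, exceptional a b w = true ∧ vert w ≠ s ∧ (Joined G {vert w} (lset bs) ∨
      ∃ z ∈ Y, ∃ js, IsJump G (pathVerts Out X t Y x Z bs) z js (vert w)) := by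
  obtain ⟨z, hz, p, hp, hpY, hpb, hps, hpt, hpx, js, hj⟩ := h.exists_jump hG hcard hs
  rcases hz with hz | hz
  · have hpZ := h.no_jump_behind hb hW hz hj
    have hpX : p ∉ X := by
      have := h.reverse.no_jump_behind hb.reverse hW (z := z) (js := js) (p := p)
        (by simpa using hz) (hj.mono fun j hjj hjK => hj.avoid j hjj ?_)
      · simpa using this
      · rcases hjK with hjK | hjK
        · exact Or.inl hjK
        · right; simp at hjK ⊢; tauto
    have hpS : p ∉ X ++ t :: (Y ++ x :: Z) := by simp [*]
    have hpO : p ∈ Out := by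
      rcases hp with hp | hp
      · exact hp
      · simp at hp hpS; tauto
    obtain ⟨ls, h', hp'⟩ := h.reroute hz hj
    obtain ⟨w, hw, rfl, he⟩ := h'.exists_exceptional hG hcard hK hp' hpO (by
      have : p ∉ ls := fun hm => h'.inner_notMem p hm hpO
      simp [*])
    exact ⟨w, hw, he, hps, Or.inr ⟨z, hz, js, hj⟩⟩
  · have hpj := h.joined_of_jump hb hW hz hj
    have hpS : p ∉ X ++ t :: (Y ++ x :: Z) := by
      have h1 : p ∉ X := fun hm => hX p hm hpj
      have h2 : p ∉ Z := fun hm => hZ p hm hpj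
      simp [*]
    have hpO : p ∈ Out := by
      rcases hp with hp | hp
      · exact hp
      · simp at hp hpS; tauto
    obtain ⟨w, hw, rfl, he⟩ := h.exists_exceptional hG hcard hK hpj hpO hpS
    exact ⟨w, hw, he, hps, Or.inl hpj⟩

/-- An initial part of a segment meets the rest of the subdivision only in its end. -/
lemma PathModel.isTail (h : PathModel G vert a b Out (A ++ B)) (he : IsEdge a b) (hA : A ≠ [])
    (hB : B ≠ []) : IsTail G Out (vert a) (lset A) := by
  have hc := h.chain he
  have hn := h.nodup he
  have hh := h.head
  have hl := h.last
  rw [List.head?_append_of_ne_nil _ hA] at hh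
  rw [List.getLast?_append_of_ne_nil _ hB] at hl
  refine ⟨connected_lset (List.isChain_append.1 hc).1 hA, List.mem_of_head? hh, fun y hy ho => ?_⟩
  rcases h.eq_end he y (List.mem_append_left _ hy) ho with e | rfl
  · exact e
  · exact absurd rfl ((List.nodup_append.1 hn).2.2 _ hy _ (List.mem_of_getLast? hl))

lemma PathModel.isTail' (h : PathModel G vert a b Out (A ++ B)) (he : IsEdge a b) (hA : A ≠ [])
    (hB : B ≠ []) : IsTail G Out (vert b) (lset B) := by
  have h1 := h.reverse he
  rw [List.reverse_append] at h1
  have h2 := h1.isTail he.symm (by simpa using hB) (by simpa using hA)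
  have e : lset B.reverse = lset B := by ext; simp
  rwa [e] at h2

/-- The contraction of the subdivision without the segment `a b`. -/
lemma PathModel.exists_home (h : PathModel G vert a b Out A) : ∃ N,
    Home G (fun i => i < 10) (keepWithout [(a, b)]) vert Out N := by
  obtain ⟨inner, hM, -, rfl⟩ := h
  exact ⟨_, hM.home (keepWithout_ownership [(a, b)] (own := ownAt 0) fun i j h => ownAt_iff h.1)⟩

/-- A set attached to two vertices of a segment and to both exceptional vertices. -/
lemma PathConfig.isMinor_of_four (h : PathConfig G vert a b Out X t Y x Z bs) (hw : w < 10)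
    (hex : exceptional a b w = true) (hwj : Joined G {vert w} (lset bs)) {w' : ℕ} (hw' : w' < 10)
    (hex' : exceptional a b w' = true) (hne : w' ≠ w) (hwj' : Joined G {vert w'} (lset bs)) :
    IsMinor K34 G := by
  obtain ⟨N, hN⟩ := h.model.exists_home
  have ha := h.edge.2.1
  have hb := h.edge.2.2
  have hab := h.edge.ne
  have eS : X ++ t :: (Y ++ x :: Z) = (X ++ t :: Y) ++ (x :: Z) := by simp
  have hTa := (eS ▸ h.model).isTail h.edge (by simp) (by simp)
  have hTb := (eS ▸ h.model).isTail' h.edge (by simp) (by simp)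
  have hnd := h.nodup
  rw [eS, List.nodup_append, List.nodup_append] at hnd
  have d : ∀ {l l' : List V}, (∀ c ∈ l, ∀ d ∈ l', c ≠ d) → Disjoint (lset l) (lset l') :=
    fun h => Set.disjoint_left.2 fun y hy hy' => h y hy y hy' rfl
  have jab : Joined G (lset (X ++ t :: Y)) (lset (x :: Z)) :=
    h.pathVia.joined_left (by simp) (by simp +contextual) (by simp)
  set L : List (ℕ × Set V) := [(a, lset (X ++ t :: Y)), (b, lset (x :: Z)), (10, lset bs)] with hL
  have hv : ∀ i < 10, vert i ∈ N i := hN.vert_mem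
  refine hN.isMinor_K34 (X := L) (pathFour_cert a ha b h.edge.mem_nbrs w hw hex w' hw' hne hex')
    (by decide) ?_ (by simp [hL, hab]; omega) ?_ ?_ ?_
  · intro e he
    simp only [List.mem_append, List.mem_cons, List.not_mem_nil, or_false] at he
    rcases he with (rfl | rfl | rfl | rfl) | he
    all_goals first | exact baseEdges_lt e he | (dsimp only; omega)
  · simp only [hL, List.map_cons, List.map_nil, List.pairwise_cons, List.mem_cons,
      List.not_mem_nil, or_false, forall_eq_or_imp, forall_eq, List.Pairwise.nil, and_true,
      false_imp_iff, implies_true]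
    exact ⟨⟨d hnd.1.2.2, d fun c hc => hnd.2.2 c (by simp at hc ⊢; tauto)⟩,
      d fun c hc => hnd.2.2 c (by simp at hc ⊢; tauto)⟩
  · intro e he
    simp only [hL, List.mem_cons, List.not_mem_nil, or_false] at he
    rcases he with rfl | rfl | rfl
    · exact Or.inl ⟨ha, hTa⟩
    · exact Or.inl ⟨hb, hTb⟩
    · exact Or.inr ⟨by simp, h.core⟩
  · intro e he
    simp only [List.mem_append, List.mem_cons, List.not_mem_nil, or_false] at he
    rcases he with (rfl | rfl | rfl | rfl) | he
    · exact Or.inr (Home.joined_labelled N (S := lset bs) (T := lset (X ++ t :: Y)) (by simp [hL])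
        (by simp [hL]) (h.att₀.symm.mono subset_rfl (by simp)))
    · exact Or.inr (Home.joined_labelled N (S := lset bs) (T := lset (x :: Z)) (by simp [hL])
        (by simp [hL]) (h.att₁.symm.mono subset_rfl (by simp)))
    · exact Or.inr (Home.joined_labelled_left (S := lset bs) (by simp [hL])
        (hwj.symm.mono subset_rfl (by simpa using hv w hw)))
    · exact Or.inr (Home.joined_labelled_left (S := lset bs) (by simp [hL])
        (hwj'.symm.mono subset_rfl (by simpa using hv w' hw')))
    · obtain ⟨i, j⟩ := e
      by_cases h1 : (i, j) = (a, b)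
      · simp only [Prod.mk.injEq] at h1
        obtain ⟨rfl, rfl⟩ := h1
        exact Or.inr (Home.joined_labelled N (by simp [hL]) (by simp [hL]) jab)
      by_cases h2 : (j, i) = (a, b)
      · simp only [Prod.mk.injEq] at h2
        obtain ⟨rfl, rfl⟩ := h2
        exact Or.inr (Home.joined_labelled N (by simp [hL]) (by simp [hL]) jab.symm)
      · exact Or.inl ⟨baseEdges_isEdge _ he, by simpa using h1, by simpa using h2⟩

/-- A set attached to two vertices of a segment and to one exceptional vertex, and a path between
the other exceptional vertex and a vertex between these two. -/
lemma PathConfig.isMinor_of_jump (h : PathConfig G vert a b Out X t Y x Z bs) (hw : w < 10)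
    (hex : exceptional a b w = true) (hwj : Joined G {vert w} (lset bs)) {w' : ℕ} (hw' : w' < 10)
    (hex' : exceptional a b w' = true) (hne : w' ≠ w) (hz : z ∈ Y)
    (hj : IsJump G (pathVerts Out X t Y x Z bs) z js (vert w')) : IsMinor K34 G := by
  obtain ⟨N, hN⟩ := h.model.exists_home
  have ha := h.edge.2.1
  have hb := h.edge.2.2
  have hab := h.edge.ne
  have eS : X ++ t :: (Y ++ x :: Z) = (X ++ [t]) ++ (Y ++ x :: Z) := by simp
  have eS' : X ++ t :: (Y ++ x :: Z) = (X ++ t :: Y) ++ (x :: Z) := by simp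
  have hTa := (eS ▸ h.model).isTail h.edge (by simp) (by simp)
  have hTb := (eS' ▸ h.model).isTail' h.edge (by simp) (by simp)
  have hYne := List.ne_nil_of_mem hz
  have hpj : PathVia G z js (vert w') := hj.chain
  have eY : lset (Y ++ js) = lset Y ∪ lset (z :: js) := by
    ext c; simp only [lset_append, Set.mem_union, mem_lset, List.mem_cons]; grind
  have hY : IsCore G Out (lset (Y ++ js)) := by
    refine ⟨?_, fun c hc ho => ?_⟩
    · rw [eY]
      exact connected_union_of_mem (h.pathVia.connected_inner hYne) hpj.connected_left (x := z) hz
        (by simp)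
    · rcases List.mem_append.1 hc with hc | hc
      · exact h.inner_notMem c hc ho
      · exact hj.avoid c hc (Or.inl ho)
  have hnd : ((X ++ [t]) ++ ((x :: Z) ++ (bs ++ (Y ++ js)))).Nodup := by
    classical
    exact nodup_of_count (h.nodup_jump hj) fun c => by
      simp only [List.count_append, List.count_cons, List.count_nil]; omega
  replace hnd := List.nodup_append.1 hnd
  have hnd₂ := List.nodup_append.1 hnd.2.1
  have hnd₃ := List.nodup_append.1 hnd₂.2.1
  have d : ∀ {l l' : List V}, (∀ c ∈ l, ∀ d ∈ l', c ≠ d) → Disjoint (lset l) (lset l') :=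
    fun h => Set.disjoint_left.2 fun y hy hy' => h y hy y hy' rfl
  set L : List (ℕ × Set V) := [(a, lset (X ++ [t])), (b, lset (x :: Z)), (10, lset bs),
    (11, lset (Y ++ js))] with hL
  have hv : ∀ i < 10, vert i ∈ N i := hN.vert_mem
  refine hN.isMinor_K34 (X := L) (pathJump_cert a ha b h.edge.mem_nbrs w hw hex w' hw' hne hex')
    (by decide) ?_ (by simp [hL, hab]; omega) ?_ ?_ ?_
  · intro e he
    simp only [subdivided, List.mem_append, List.mem_cons, List.not_mem_nil, or_false] at he
    rcases he with (rfl | rfl | rfl | rfl) | (rfl | rfl) | he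
    all_goals first | exact baseEdges_lt e (mem_edgesWithout.1 he).1 | (dsimp only; omega)
  · simp only [hL, List.map_cons, List.map_nil, List.pairwise_cons, List.mem_cons,
      List.not_mem_nil, or_false, forall_eq_or_imp, forall_eq, List.Pairwise.nil, and_true,
      false_imp_iff, implies_true]
    exact ⟨⟨d fun c hc e he => hnd.2.2 c hc e (List.mem_append_left _ he),
      d fun c hc e he => hnd.2.2 c hc e (List.mem_append_right _ (List.mem_append_left _ he)),
      d fun c hc e he => hnd.2.2 c hc e (List.mem_append_right _ (List.mem_append_right _ he))⟩,
      ⟨d fun c hc e he => hnd₂.2.2 c hc e (List.mem_append_left _ he),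
      d fun c hc e he => hnd₂.2.2 c hc e (List.mem_append_right _ he)⟩, d hnd₃.2.2⟩
  · intro e he
    simp only [hL, List.mem_cons, List.not_mem_nil, or_false] at he
    rcases he with rfl | rfl | rfl | rfl
    · exact Or.inl ⟨ha, hTa⟩
    · exact Or.inl ⟨hb, hTb⟩
    · exact Or.inr ⟨by simp, h.core⟩
    · exact Or.inr ⟨by simp, hY⟩
  · intro e he
    simp only [subdivided, List.mem_append, List.mem_cons, List.not_mem_nil, or_false] at he
    rcases he with (rfl | rfl | rfl | rfl) | (rfl | rfl) | he
    · exact Or.inr (Home.joined_labelled N (S := lset (Y ++ js)) (T := lset (X ++ [t]))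
        (by simp [hL]) (by simp [hL])
        ((h.pathVia.joined_inner hYne (S := {t}) rfl).symm.mono (by simp [eY]) (by simp)))
    · exact Or.inr (Home.joined_labelled N (S := lset (Y ++ js)) (T := lset (x :: Z))
        (by simp [hL]) (by simp [hL])
        ((h.pathVia.joined_inner' hYne (S := {x}) rfl).symm.mono (by simp [eY]) (by simp)))
    · exact Or.inr (Home.joined_labelled_left (S := lset (Y ++ js)) (by simp [hL])
        ((hpj.joined_left (S := lset (z :: js)) (T := N w') (by simp) (by simp +contextual)
          (hv w' hw')).mono (by simp [eY]) subset_rfl))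
    · exact Or.inr (Home.joined_labelled_left (S := lset bs) (by simp [hL])
        (hwj.symm.mono subset_rfl (by simpa using hv w hw)))
    · exact Or.inr (Home.joined_labelled N (S := lset bs) (T := lset (X ++ [t])) (by simp [hL])
        (by simp [hL]) (h.att₀.symm.mono subset_rfl (by simp)))
    · exact Or.inr (Home.joined_labelled N (S := lset bs) (T := lset (x :: Z)) (by simp [hL])
        (by simp [hL]) (h.att₁.symm.mono subset_rfl (by simp)))
    · exact Or.inl (mem_edgesWithout_base he)

/-- There is a largest choice of `bs`; its attachments `t` and `x` can be chosen extremal. -/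
lemma PathConfig.exists_bound [Finite V] (h : PathConfig G vert a b Out X t Y x Z bs)
    (hW : ∀ w ∈ W, Joined G {w} (lset bs)) :
    ∃ X' t' Y' x' Z' bs', PathConfig G vert a b Out X' t' Y' x' Z' bs' ∧
      (∀ w ∈ W, Joined G {w} (lset bs')) ∧ PathBound G vert a b Out W bs'.length ∧
      (∀ y ∈ X', ¬ Joined G {y} (lset bs')) ∧ ∀ y ∈ Z', ¬ Joined G {y} (lset bs') := by
  classical
  have := Fintype.ofFinite V
  set P : ℕ → Prop := fun n => ∃ X t Y x Z bs, PathConfig G vert a b Out X t Y x Z bs ∧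
    (∀ w ∈ W, Joined G {w} (lset bs)) ∧ bs.length = n with hP
  have hle : ∀ n, P n → n ≤ Fintype.card V := by
    rintro n ⟨X, t, Y, x, Z, bs, h, -, rfl⟩
    exact (List.nodup_append.1 h.nodup).2.1.length_le_card
  have h0 : P bs.length := ⟨X, t, Y, x, Z, bs, h, hW, rfl⟩
  obtain ⟨X', t', Y', x', Z', bs', h', hW', e⟩ := Nat.findGreatest_spec (hle _ h0) h0
  obtain ⟨X₁, t₁, Y₁, x₁, Z₁, h₁, h₂, h₃⟩ := h'.exists_extremal
  refine ⟨X₁, t₁, Y₁, x₁, Z₁, bs', h₁, hW', fun X t Y x Z bs h hW => ?_, h₂, h₃⟩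
  have hp : P bs.length := ⟨X, t, Y, x, Z, bs, h, hW, rfl⟩
  rw [e]
  exact Nat.le_findGreatest (hle _ hp) hp

/-- No connected set off a subdivision of `F₄` is attached to two vertices of one segment. -/
theorem PathConfig.false [Finite V] (hG : InternallyFourConnected G) (hcard : 6 < Nat.card V)
    (hK : ¬ IsMinor K34 G) (h : PathConfig G vert a b Out X t Y x Z bs) : False := by
  have ha := h.edge.2.1
  have hb := h.edge.2.2
  obtain ⟨w, hw, hex, X, t, Y, x, Z, bs, h, hwj⟩ : ∃ w < 10, exceptional a b w = true ∧
      ∃ X t Y x Z bs, PathConfig G vert a b Out X t Y x Z bs ∧ Joined G {vert w} (lset bs) := by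
    obtain ⟨X, t, Y, x, Z, bs, h, hW, hbd, hX, hZ⟩ := h.exists_bound (W := ∅) (by simp)
    obtain ⟨w, hw, hex, -, hj | ⟨z, hz, js, hj⟩⟩ :=
      h.exists_exceptional_jump hG hcard hK hbd hW hX hZ (s := t) (Or.inl rfl)
    · exact ⟨w, hw, hex, X, t, Y, x, Z, bs, h, hj⟩
    · obtain ⟨ls, h', hp⟩ := h.reroute hz hj
      exact ⟨w, hw, hex, X, t, ls, x, Z, _, h', hp⟩
  -- The set is chosen anew, as large as possible among those attached to `vert w`.
  obtain ⟨X, t, Y, x, Z, bs, h, hW, hbd, hX, hZ⟩ :=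
    h.exists_bound (W := {vert w}) (by simpa using hwj)
  have hwj : Joined G {vert w} (lset bs) := hW _ rfl
  have hne := exceptional_ne a ha b hb w hw hex
  obtain ⟨w', hw', hex', hne', hj⟩ := h.exists_exceptional_jump hG hcard hK hbd hW hX hZ
    (s := vert w) (Or.inr ⟨w, hw, hne.1, hne.2, rfl⟩)
  have hww : w' ≠ w := fun e => hne' (e ▸ rfl)
  rcases hj with hj | ⟨z, hz, js, hj⟩
  · exact hK (h.isMinor_of_four hw hex hwj hw' hex' hww hj)
  · exact hK (h.isMinor_of_jump hw hex hwj hw' hex' hww hz hj)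

end

/-! ### Attachments in general position -/

section

variable {vert : ℕ → V} {inner : ℕ → ℕ → List V} {a b : ℕ} {M : Set V} {bs : List V}

/-- The vertices of `M` that are adjacent to the set of entries of `bs`. -/
abbrev attached (G : SimpleGraph V) (M : Set V) (bs : List V) : Set V :=
  {x | x ∈ M ∧ Joined G {x} (lset bs)}

/-- If `M` misses a vertex, then its complement has a component, listed as `bs`. -/
lemma exists_maximal_core [Finite V] {v : V} (hv : v ∉ M) : ∃ bs : List V, bs.Nodup ∧
    IsCore G M (lset bs) ∧ ∀ x ∈ bs, ∀ y, G.Adj x y → y ∈ bs ∨ y ∈ M := by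
  classical
  obtain ⟨B, hB⟩ := (Set.toFinite {B : Set V | IsCore G M B}).exists_maximal
    ⟨{v}, induce_singleton_connected v, by rintro y rfl; exact hv⟩
  have hl : lset (Set.toFinite B).toFinset.toList = B := by ext; simp
  refine ⟨(Set.toFinite B).toFinset.toList, Finset.nodup_toList _, by rw [hl]; exact hB.1, ?_⟩
  intro x hx y hxy
  simp only [Finset.mem_toList, Set.Finite.mem_toFinset] at hx ⊢
  by_contra! hy
  have h1 : IsCore G M (B ∪ {y}) := by
    refine ⟨connected_union_of_joined hB.1.conn (induce_singleton_connected y)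
      ⟨x, hx, y, rfl, hxy⟩, ?_⟩
    rintro z (hz | rfl)
    · exact hB.1.disj z hz
    · exact hy.2
  exact hy.1 (hB.2 h1 Set.subset_union_left (Or.inr rfl))

/-- The attachments of a component of the complement of `M` separate it from the rest of `M`. -/
lemma le_ncard_attached {k : ℕ} (hk : KConnected k G) (hbs : IsCore G M (lset bs))
    (hcl : ∀ x ∈ bs, ∀ y, G.Adj x y → y ∈ bs ∨ y ∈ M) {m : V} (hm : m ∈ M)
    (hm' : m ∉ attached G M bs) : k ≤ (attached G M bs).ncard := by
  by_contra! hlt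
  have hT := not_not.1 (hk.2 _ hlt)
  obtain ⟨⟨c, hc⟩⟩ := hbs.conn.nonempty
  have hcT : c ∈ (attached G M bs)ᶜ := fun h => hbs.disj c hc h.1
  have hmb : m ∉ lset bs := fun h => hbs.disj m h hm
  obtain ⟨z, hz, p, -, hpb, hpT, js, hj, -⟩ := exists_jump_of_reachable (K := (lset bs)ᶜ)
    (hT ⟨c, hcT⟩ ⟨m, hm'⟩) hc hmb hmb
  have hjs : js = [] := List.eq_nil_iff_forall_not_mem.2 fun j hjj => hj.avoid j hjj (by simp)
  subst hjs
  have hzp : G.Adj z p := by simpa using hj.chain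
  rcases hcl z hz p hzp with h | h
  · exact hpb h
  · exact hpT ⟨h, p, rfl, z, hz, hzp.symm⟩

/-- A component of the complement of a subdivision is attached to at most one vertex of each
segment. -/
lemma IsModel.eq_of_attached [Finite V] (hM : IsModel G vert inner)
    (hG : InternallyFourConnected G) (hcard : 6 < Nat.card V) (hK : ¬ IsMinor K34 G)
    (hbs : IsCore G (modelVerts vert inner) (lset bs)) (hnd : bs.Nodup) (h : IsEdge a b) {t x : V}
    (ht : t ∈ seg vert inner a b) (hx : x ∈ seg vert inner a b) (htb : Joined G {t} (lset bs))
    (hxb : Joined G {x} (lset bs)) : t = x := by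
  by_contra htx
  have key : ∀ {t x : V} {X Y Z : List V}, seg vert inner a b = X ++ t :: (Y ++ x :: Z) →
      Joined G {t} (lset bs) → Joined G {x} (lset bs) → False := by
    intro t x X Y Z e htb hxb
    refine PathConfig.false hG hcard hK (vert := vert) (a := a) (b := b) (X := X) (t := t) (Y := Y)
      (x := x) (Z := Z) (bs := bs) ⟨h, ⟨inner, hM, e, rfl⟩,
      hbs.mono (modelPart_mono (fun _ h => h) fun _ _ h => h.1), ?_, htb, hxb⟩
    rw [← e, List.nodup_append]
    refine ⟨hM.seg_nodup h, hnd, ?_⟩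
    rintro y hy _ hb rfl
    refine hbs.disj y hb ?_
    simp only [seg, List.cons_append, List.mem_cons, List.mem_append, List.not_mem_nil,
      or_false] at hy
    rcases hy with rfl | hy | rfl
    · exact Or.inl ⟨a, h.2.1, rfl⟩
    · exact Or.inr ⟨a, b, h, hy⟩
    · exact Or.inl ⟨b, h.2.2, rfl⟩
  obtain ⟨X, R, e⟩ := List.append_of_mem ht
  rw [e] at hx
  simp only [List.mem_append, List.mem_cons] at hx
  rcases hx with hx | rfl | hx
  · obtain ⟨X, Y, rfl⟩ := List.append_of_mem hx
    exact key (X := X) (Y := Y) (Z := R) (by rw [e]; simp) hxb htb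
  · exact htx rfl
  · obtain ⟨Y, Z, rfl⟩ := List.append_of_mem hx
    exact key e htb hxb

/-- A vertex off the segment `a b` that is joined to a set on this segment is a poor branch vertex,
or on a segment between a poor branch vertex and `a` or `b`. -/
lemma IsModel.exists_poor (hM : IsModel G vert inner) (hK : ¬ IsMinor K34 G) (h : IsEdge a b)
    {Z : Set V} (hZ : IsCore G (pathOut vert inner a b) Z) (hZa : Joined G {vert a} Z)
    (hZb : Joined G {vert b} Z) {q : V} (hqZ : Joined G {q} Z) (hq : q ∈ modelVerts vert inner)
    (hqs : q ∉ seg vert inner a b) : ∃ w < 10, w ≠ a ∧ w ≠ b ∧ poor a b w = true ∧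
      (q = vert w ∨ ∃ c, (c = a ∨ c = b) ∧ IsEdge w c ∧ q ∈ inner w c) := by
  have hpoor : ∀ w < 10, w ≠ a → w ≠ b → (q = vert w ∨ ∃ j, keepWithout [(a, b)] w j ∧
      q ∈ inner w j) → poor a b w = true := by
    intro w hw hwa hwb hq
    by_contra hp
    exact hK (hM.isMinor_of_edge_vertex h hw hwa hwb (by simpa using hp) hZ hZa hZb hqZ hq)
  have hne : ∀ c d, q ∈ inner c d → ¬ (c = a ∧ d = b) := by
    rintro c d hq ⟨rfl, rfl⟩
    exact hqs (by simp [seg, hq])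
  rcases hq with ⟨w, hw, rfl⟩ | ⟨c, d, hcd, hq⟩
  · have hwa : w ≠ a := by rintro rfl; exact hqs (by simp [seg])
    have hwb : w ≠ b := by rintro rfl; exact hqs (by simp [seg])
    exact ⟨w, hw, hwa, hwb, hpoor w hw hwa hwb (Or.inl rfl), Or.inl rfl⟩
  · have hq' : q ∈ inner d c := by rw [hM.rev c d hcd]; simpa using hq
    have hcd1 := hne c d hq
    have hcd2 := hne d c hq'
    have hk : keepWithout [(a, b)] c d := ⟨hcd, by simpa using hcd1, by simpa using hcd2⟩
    have hk' : keepWithout [(a, b)] d c := ⟨hcd.symm, by simpa using hcd2, by simpa using hcd1⟩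
    have hnecd := hcd.ne
    by_cases hc : c = a ∨ c = b
    · have hda : d ≠ a := by grind
      have hdb : d ≠ b := by grind
      exact ⟨d, hcd.2.2, hda, hdb, hpoor d hcd.2.2 hda hdb (Or.inr ⟨c, hk', hq'⟩),
        Or.inr ⟨c, hc, hcd.symm, hq'⟩⟩
    · rw [not_or] at hc
      have hpc := hpoor c hcd.2.1 hc.1 hc.2 (Or.inr ⟨d, hk, hq⟩)
      by_cases hd : d = a ∨ d = b
      · exact ⟨c, hcd.2.1, hc.1, hc.2, hpc, Or.inr ⟨d, hd, hcd, hq⟩⟩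
      · rw [not_or] at hd
        have hpd := hpoor d hcd.2.2 hd.1 hd.2 (Or.inr ⟨c, hk', hq'⟩)
        exact absurd (hM.isMinor_of_edge_edge h hcd hc.1 hc.2 hd.1 hd.2 hpc hpd hZ hZa hZb hqZ hq)
          hK

/-- A set attached to an inner vertex of the segment `a b` and to vertices that can be contracted to
two different poor branch vertices. -/
lemma IsModel.isMinor_of_edge_two_vertices (hM : IsModel G vert inner) (h : IsEdge a b)
    (hbs : IsCore G (modelVerts vert inner) (lset bs)) {p : V} (hp : p ∈ inner a b)
    (hpb : Joined G {p} (lset bs)) {w w' : ℕ} (hw : w < 10) (hwa : w ≠ a) (hwb : w ≠ b)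
    (hpw : poor a b w = true) (hw' : w' < 10) (hwa' : w' ≠ a) (hwb' : w' ≠ b)
    (hpw' : poor a b w' = true) (hne : w' ≠ w) {q q' : V}
    (hq : q = vert w ∨ ∃ c, (c = a ∨ c = b) ∧ IsEdge w c ∧ q ∈ inner w c)
    (hqb : Joined G {q} (lset bs))
    (hq' : q' = vert w' ∨ ∃ c, (c = a ∨ c = b) ∧ IsEdge w' c ∧ q' ∈ inner w' c)
    (hqb' : Joined G {q'} (lset bs)) : IsMinor K34 G := by
  have ha := h.2.1
  have hb := h.2.2
  -- Inner vertices of a segment at `a` or `b` are contracted to the other end.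
  set own : ℕ → ℕ → Prop := fun i j => (i ≠ a ∧ i ≠ b) ∧ ((j = a ∨ j = b) ∨ i < j) with hown
  have hN := hM.home (keepWithout_ownership [(a, b)] (own := own) fun i j hij => by
    have h1 := hij.1.ne
    have h2 := hij.2
    simp only [List.mem_singleton, Prod.mk.injEq] at h2
    simp only [hown]
    by_cases i = a <;> by_cases i = b <;> by_cases j = a <;> by_cases j = b <;>
      (simp_all; try omega))
  set N := modelSet vert inner (fun i => i < 10) (keepWithout [(a, b)]) own with hNdef
  have hv : ∀ i < 10, vert i ∈ N i := hN.vert_mem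
  have hmem : ∀ w < 10, w ≠ a → w ≠ b → ∀ q,
      (q = vert w ∨ ∃ c, (c = a ∨ c = b) ∧ IsEdge w c ∧ q ∈ inner w c) → q ∈ N w := by
    rintro w hw hwa hwb q (rfl | ⟨c, hc, hwc, hq⟩)
    · exact hv w hw
    · refine ⟨hw, Or.inr ⟨c, ⟨hwc, by simp [hwa], by simp [hwb]⟩, ⟨⟨hwa, hwb⟩, Or.inl hc⟩, hq⟩⟩
  have hcore : IsCore G (pathOut vert inner a b) (lset (inner a b)) :=
    ⟨(hM.path a b h).connected_inner (List.ne_nil_of_mem hp), hM.notMem_pathOut h⟩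
  have hbs' : IsCore G (pathOut vert inner a b) (lset bs) :=
    hbs.mono (modelPart_mono (fun _ h => h) fun _ _ h => h.1)
  have hdis : Disjoint (lset (inner a b)) (lset bs) :=
    Set.disjoint_left.2 fun y hy hy' => hbs.disj y hy' (Or.inr ⟨a, b, h, hy⟩)
  have hpath := hM.path a b h
  have hne' := List.ne_nil_of_mem hp
  set L : List (ℕ × Set V) := [(10, lset (inner a b)), (11, lset bs)] with hL
  refine hN.isMinor_K34 (X := L)
    (edgeTwoVertices_cert a ha b h.mem_nbrs w hw hwa hwb hpw w' hw' hwa' hwb' hne hpw')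
    (by decide) ?_ (by simp [hL]) (by simpa [hL] using hdis) ?_ ?_
  · intro e he
    simp only [subdivided, List.mem_append, List.mem_cons, List.not_mem_nil, or_false] at he
    rcases he with (rfl | rfl | rfl) | (rfl | rfl) | he
    all_goals first | exact baseEdges_lt e (mem_edgesWithout.1 he).1 | (dsimp only; omega)
  · intro e he
    simp only [hL, List.mem_cons, List.not_mem_nil, or_false] at he
    rcases he with rfl | rfl
    · exact Or.inr ⟨by simp, hcore⟩
    · exact Or.inr ⟨by simp, hbs'⟩
  · intro e he
    simp only [subdivided, List.mem_append, List.mem_cons, List.not_mem_nil, or_false] at he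
    rcases he with (rfl | rfl | rfl) | (rfl | rfl) | he
    · exact Or.inr (Home.joined_labelled N (S := lset bs) (T := lset (inner a b)) (by simp [hL])
        (by simp [hL]) (hpb.symm.mono subset_rfl (by simpa using hp)))
    · exact Or.inr (Home.joined_labelled_left (S := lset bs) (by simp [hL])
        (hqb.symm.mono subset_rfl (by simpa using hmem w hw hwa hwb q hq)))
    · exact Or.inr (Home.joined_labelled_left (S := lset bs) (by simp [hL])
        (hqb'.symm.mono subset_rfl (by simpa using hmem w' hw' hwa' hwb' q' hq')))
    · exact Or.inr (Home.joined_labelled_left (S := lset (inner a b)) (by simp [hL])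
        (hpath.joined_inner hne' (hv a ha)).symm)
    · exact Or.inr (Home.joined_labelled_left (S := lset (inner a b)) (by simp [hL])
        (hpath.joined_inner' hne' (hv b hb)).symm)
    · exact Or.inl (mem_edgesWithout_base he)

/-- If each segment has at most one attachment, and an inner vertex of a segment is an attachment,
then there are at most two attachments. -/
lemma IsModel.false_of_inner_attached (hM : IsModel G vert inner) (hK : ¬ IsMinor K34 G)
    (hbs : IsCore G (modelVerts vert inner) (lset bs))
    (hone : ∀ a b, IsEdge a b → ∀ t ∈ seg vert inner a b, ∀ x ∈ seg vert inner a b,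
      Joined G {t} (lset bs) → Joined G {x} (lset bs) → t = x)
    (h : IsEdge a b) {p : V} (hp : p ∈ inner a b) (hpb : Joined G {p} (lset bs)) {q q' : V}
    (hq : q ∈ attached G (modelVerts vert inner) bs)
    (hq' : q' ∈ attached G (modelVerts vert inner) bs) (hqp : q ≠ p) (hqp' : q' ≠ p)
    (hne : q ≠ q') : False := by
  have hps : p ∈ seg vert inner a b := by simp [seg, hp]
  have hne' := List.ne_nil_of_mem hp
  have hpath := hM.path a b h
  have hZ : IsCore G (pathOut vert inner a b) (lset (inner a b) ∪ lset bs) := by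
    refine ⟨connected_union_of_joined (hpath.connected_inner hne') hbs.conn
      (hpb.mono (by simpa using hp) subset_rfl), ?_⟩
    rintro y (hy | hy)
    · exact hM.notMem_pathOut h y hy
    · exact (hbs.mono (modelPart_mono (fun _ h => h) fun _ _ h => h.1)).disj y hy
  have hZa : Joined G {vert a} (lset (inner a b) ∪ lset bs) :=
    (hpath.joined_inner hne' (S := {vert a}) rfl).mono subset_rfl Set.subset_union_left
  have hZb : Joined G {vert b} (lset (inner a b) ∪ lset bs) :=
    (hpath.joined_inner' hne' (S := {vert b}) rfl).mono subset_rfl Set.subset_union_left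
  have key : ∀ q ∈ attached G (modelVerts vert inner) bs, q ≠ p → ∃ w < 10, w ≠ a ∧ w ≠ b ∧
      poor a b w = true ∧ (q = vert w ∨ ∃ c, (c = a ∨ c = b) ∧ IsEdge w c ∧ q ∈ inner w c) :=
    fun q hq hqp => hM.exists_poor hK h hZ hZa hZb (hq.2.mono subset_rfl Set.subset_union_right)
      hq.1 fun hqs => hqp (hone a b h q hqs p hps hq.2 hpb)
  obtain ⟨w, hw, hwa, hwb, hpw, hqw⟩ := key q hq hqp
  obtain ⟨w', hw', hwa', hwb', hpw', hqw'⟩ := key q' hq' hqp'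
  by_cases hww : w' = w
  · subst hww
    -- A vertex adjacent to both `a` and `b` would give a triangle.
    have htri : ∀ c c', (c = a ∨ c = b) → (c' = a ∨ c' = b) → IsEdge w' c → IsEdge w' c' →
        c = c' := by
      intro c c' hc hc' h1 h2
      by_contra hcc
      have h3 := adjF_triangle_free w' hw' c h1.2.2 c' h2.2.2 h1.1 h2.1
      have h4 : adjF c c' = true := by
        rcases hc with rfl | rfl <;> rcases hc' with rfl | rfl
        · exact absurd rfl hcc
        · exact h.1
        · exact h.symm.1
        · exact absurd rfl hcc
      simp [h3] at h4
    rcases hqw with rfl | ⟨c, hc, hwc, hqc⟩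
    · rcases hqw' with rfl | ⟨c', hc', hwc', hqc'⟩
      · exact hne rfl
      · exact hne (hone w' c' hwc' _ (by simp [seg]) _ (by simp [seg, hqc']) hq.2 hq'.2)
    · rcases hqw' with rfl | ⟨c', hc', hwc', hqc'⟩
      · exact hne (hone w' c hwc _ (by simp [seg, hqc]) _ (by simp [seg]) hq.2 hq'.2)
      · obtain rfl := htri c c' hc hc' hwc hwc'
        exact hne (hone w' c hwc _ (by simp [seg, hqc]) _ (by simp [seg, hqc']) hq.2 hq'.2)
  · exact hK (hM.isMinor_of_edge_two_vertices h hbs hp hpb hw hwa hwb hpw hw' hwa' hwb' hpw' hww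
      hqw hq.2 hqw' hq'.2)

end

/-! ### Attachments at branch vertices only -/

/-- Branch sets for `Qplus` in the graph `F₄` with a new vertex `10` joined to `1`, `4` and `5`. -/
def qplusSets : Fin 4 ⊕ Fin 5 → List ℕ :=
  Sum.elim ![[5], [8], [3, 4], [0, 1]] ![[2], [10], [9], [6], [7]]

section

variable {vert : ℕ → V} {inner : ℕ → ℕ → List V} {bs : List V}

/-- `F₄` with a new vertex joined to `1`, `4` and `5`, or to the images of these vertices under an
automorphism `σ`, has a `Qplus` minor. -/
lemma BranchSets.isMinor_Qplus {σ : ℕ → ℕ} (hσ : ∀ i, σ (σ i) = i) {μ : ℕ → Set V}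
    {E : List (ℕ × ℕ)} (h : BranchSets G E μ) (hE : ∀ e ∈ E, σ e.1 < 16 ∧ σ e.2 < 16)
    (hadj : ∀ (i : Fin 4) (j : Fin 5), i.val ≠ min j.val 3 → ∃ x ∈ qplusSets (.inl i),
      ∃ y ∈ qplusSets (.inr j), adjM (code σ E) x y = true)
    (hlink : ∀ u, linked (code σ E) (qplusSets u) = true) : IsMinor Qplus G := by
  have hlt : ∀ u, ∀ x ∈ qplusSets u, x < 16 := by decide
  have hK : ∀ (i : Fin 4) (j : Fin 5), i.val ≠ min j.val 3 →
      ∃ x ∈ unionOver (μ ∘ σ) (qplusSets (.inl i)),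
        ∃ y ∈ unionOver (μ ∘ σ) (qplusSets (.inr j)), G.Adj x y := by
    intro i j hij
    obtain ⟨x, hx, y, hy, hxy⟩ := hadj i j hij
    obtain ⟨v, hv, w, hw, hvw⟩ := h.exists_adj hσ hE (hlt _ y hy) hxy
    exact ⟨v, ⟨x, hx, hv⟩, w, ⟨y, hy, hw⟩, hvw⟩
  refine ⟨fun u => unionOver (μ ∘ σ) (qplusSets u), fun u => ?_, fun u w huw => ?_, ?_⟩
  · refine h.connected_of_linked hσ hE (hlt u) (hlink u) ?_
    rcases u with i | j
    · obtain ⟨j, hj⟩ : ∃ j : Fin 5, i.val ≠ min j.val 3 := by revert i; decide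
      obtain ⟨x, hx, -⟩ := hK i j hj
      exact ⟨x, hx⟩
    · obtain ⟨i, hi⟩ : ∃ i : Fin 4, i.val ≠ min j.val 3 := by revert j; decide
      obtain ⟨x, hx, y, hy, -⟩ := hK i j hi
      exact ⟨y, hy⟩
  · rw [Set.disjoint_left]
    rintro v ⟨x, hx, hvx⟩ ⟨y, hy, hvy⟩
    have key : ∀ u w, u ≠ w → ∀ x ∈ qplusSets u, x ∉ qplusSets w := by decide
    have hxy : x ≠ y := by rintro rfl; exact key u w huw x hx hy
    exact Set.disjoint_left.1 (h.disj (σ x) (σ y) fun he => hxy (by rw [← hσ x, he, hσ])) hvx hvy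
  · rintro u w huw
    rw [Qplus, SimpleGraph.fromRel_adj] at huw
    rcases huw.2 with ⟨i, j, rfl, rfl, hij⟩ | ⟨i, j, rfl, rfl, hij⟩
    · exact hK i j hij
    · obtain ⟨x, hx, y, hy, hxy⟩ := hK i j hij
      exact ⟨y, hy, x, hx, hxy.symm⟩

/-- A set attached to three branch vertices. -/
lemma IsModel.branchSets_of_triple (hM : IsModel G vert inner)
    (hbs : IsCore G (modelVerts vert inner) (lset bs)) {i j k : ℕ} (hi : i < 10) (hj : j < 10)
    (hk : k < 10) (hib : Joined G {vert i} (lset bs)) (hjb : Joined G {vert j} (lset bs))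
    (hkb : Joined G {vert k} (lset bs)) :
    ∃ μ, BranchSets G ([(10, i), (10, j), (10, k)] ++ baseEdges) μ := by
  have hN := hM.home (alive := (· < 10)) (keep := IsEdge) (own := ownAt 0)
    ⟨fun _ h => h, fun _ _ h => ⟨h, h.2.1, h.2.2⟩, fun _ _ h => h.symm, fun _ _ h => ownAt_iff h⟩
  have hv := hN.vert_mem
  refine ⟨_, hN.branchSets (X := [(10, lset bs)]) (by simp) (by simp) ?_ ?_⟩
  · rintro _ (_ | ⟨_, ⟨⟩⟩)
    exact Or.inr ⟨by simp, hbs⟩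
  · intro e he
    have key : ∀ i < 10, Joined G {vert i} (lset bs) → _ := fun i hi hib =>
      Home.joined_labelled_left (i := 10) (j := i) (S := lset bs) (X := [(10, lset bs)]) (by simp)
        (hib.symm.mono subset_rfl (by simpa using hv i hi))
    simp only [List.mem_append, List.mem_cons, List.not_mem_nil, or_false] at he
    rcases he with (rfl | rfl | rfl) | he
    · exact Or.inr (key i hi hib)
    · exact Or.inr (key j hj hjb)
    · exact Or.inr (key k hk hkb)
    · exact Or.inl (baseEdges_isEdge e he)

/-- A set attached to the branch vertices of an exceptional triple gives a `Qplus` minor. -/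
lemma IsModel.isMinor_Qplus (hM : IsModel G vert inner)
    (hbs : IsCore G (modelVerts vert inner) (lset bs))
    (h : (∀ i ∈ [1, 4, 5], Joined G {vert i} (lset bs)) ∨
      ∀ i ∈ [6, 9, 0], Joined G {vert i} (lset bs)) : IsMinor Qplus G := by
  rcases h with h | h
  · obtain ⟨μ, hμ⟩ := hM.branchSets_of_triple hbs (i := 1) (j := 4) (k := 5) (by simp) (by simp)
      (by simp) (h _ (by simp)) (h _ (by simp)) (h _ (by simp))
    exact hμ.isMinor_Qplus (σ := id) (fun _ => rfl) (by decide) (by decide +kernel)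
      (by decide +kernel)
  · obtain ⟨μ, hμ⟩ := hM.branchSets_of_triple hbs (i := 6) (j := 9) (k := 0) (by simp) (by simp)
      (by simp) (h _ (by simp)) (h _ (by simp)) (h _ (by simp))
    refine hμ.isMinor_Qplus (σ := autSwap) (fun i => ?_) (by decide) (by decide +kernel)
      (by decide +kernel)
    rcases lt_or_ge i 10 with hi | hi
    · revert i; decide
    · simp [autSwap, Nat.ble_eq_true_of_le hi]

/-- A set attached to three pairwise non-adjacent branch vertices gives a `K_{3,4}` minor, except
for two triples. -/
lemma IsModel.triple_exceptional (hM : IsModel G vert inner) (hK : ¬ IsMinor K34 G)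
    (hbs : IsCore G (modelVerts vert inner) (lset bs))
    (hone : ∀ a b, IsEdge a b → ∀ t ∈ seg vert inner a b, ∀ x ∈ seg vert inner a b,
      Joined G {t} (lset bs) → Joined G {x} (lset bs) → t = x)
    {i j k : ℕ} (hi : i < 10) (hj : j < 10)
    (hk : k < 10) (hib : Joined G {vert i} (lset bs)) (hjb : Joined G {vert j} (lset bs))
    (hkb : Joined G {vert k} (lset bs)) (hij : i ≠ j) (hik : i ≠ k) (hjk : j ≠ k) :
    ∃ x ∈ [[1, 4, 5], [6, 9, 0]], ∀ y ∈ [i, j, k], y ∈ x := by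
  by_contra! hx
  have hadj : ∀ i < 10, ∀ j < 10, Joined G {vert i} (lset bs) → Joined G {vert j} (lset bs) →
      i ≠ j → adjF i j = false := by
    intro i hi j hj hib hjb hij
    by_contra hadj
    exact hij (hM.inj i hi j hj (hone i j ⟨by simpa using hadj, hi, hj⟩ _ (by simp [seg]) _
      (by simp [seg]) hib hjb))
  obtain ⟨μ, hμ⟩ := hM.branchSets_of_triple hbs hi hj hk hib hjb hkb
  refine hK (isMinor_K34_of_hasCert hμ ?_ (by decide) (triple_cert i hi j hj hij
    (hadj i hi j hj hib hjb hij) k hk hik hjk (hadj i hi k hk hib hkb hik)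
    (hadj j hj k hk hjb hkb hjk) hx))
  intro e he
  simp only [List.mem_append, List.mem_cons, List.not_mem_nil, or_false] at he
  rcases he with (rfl | rfl | rfl) | he
  all_goals first | exact baseEdges_lt e he | (dsimp only; omega)

/-- If `G` has no `Qplus` minor or is `4`-connected, then a subdivision of `F₄` covers every
vertex. -/
theorem IsModel.spanning [Finite V] (hM : IsModel G vert inner) (hG : InternallyFourConnected G)
    (hK : ¬ IsMinor K34 G) (hQ : ¬ IsMinor Qplus G ∨ KConnected 4 G) (v : V) :
    v ∈ modelVerts vert inner := by
  by_contra hv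
  have hinj : Set.InjOn vert (Set.Iio 10) := fun i hi j hj h => hM.inj i hi j hj h
  have himg : (vert '' Set.Iio 10).ncard = 10 := by
    rw [hinj.ncard_image]
    simp [← Finset.coe_Iio, Set.ncard_coe_finset]
  have hcard : 6 < Nat.card V := by
    have := Set.ncard_le_card (vert '' Set.Iio 10)
    omega
  obtain ⟨bs, hnd, hbs, hcl⟩ := exists_maximal_core (G := G) hv
  have hone : ∀ a b, IsEdge a b → ∀ t ∈ seg vert inner a b, ∀ x ∈ seg vert inner a b,
      Joined G {t} (lset bs) → Joined G {x} (lset bs) → t = x := fun a b h t ht x hx htb hxb =>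
    hM.eq_of_attached hG hcard hK hbs hnd h ht hx htb hxb
  set T := attached G (modelVerts vert inner) bs with hT
  have hsize : ∀ k ≤ 10, KConnected k G → k ≤ T.ncard := by
    intro k hk10 hk
    by_contra! hlt
    obtain ⟨m, ⟨i, hi, rfl⟩, hm⟩ := Set.exists_mem_notMem_of_ncard_lt_ncard
      (s := T) (t := vert '' Set.Iio 10) (by omega)
    exact hlt.not_ge (le_ncard_attached hk hbs hcl (Or.inl ⟨i, hi, rfl⟩) hm)
  have h3 := hsize 3 (by norm_num) hG.1
  by_cases hin : ∃ a b p, IsEdge a b ∧ p ∈ inner a b ∧ p ∈ T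
  · obtain ⟨a, b, p, hab, hp, hpT⟩ := hin
    have h2 : 1 < (T \ {p}).ncard := by
      rw [Set.ncard_sdiff_singleton_of_mem hpT]
      omega
    obtain ⟨q, q', hq, hq', hne⟩ := (Set.one_lt_ncard_iff).1 h2
    exact hM.false_of_inner_attached hK hbs hone hab hp hpT.2 hq.1 hq'.1 hq.2 hq'.2 hne
  · have hbr : ∀ q ∈ T, ∃ i < 10, q = vert i := by
      rintro q hq
      rcases hq.1 with h | ⟨a, b, hab, h⟩
      · exact h
      · exact absurd ⟨a, b, q, hab, h, hq⟩ hin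
    obtain ⟨p, q, r, hp, hq, hr, hpq, hpr, hqr⟩ := (Set.two_lt_ncard_iff).1 h3
    have hpqr := ncard_triple_le p q r
    obtain ⟨i, hi, rfl⟩ := hbr p hp
    obtain ⟨j, hj, rfl⟩ := hbr q hq
    obtain ⟨k, hk, rfl⟩ := hbr r hr
    have hij : i ≠ j := fun e => hpq (e ▸ rfl)
    have hik : i ≠ k := fun e => hpr (e ▸ rfl)
    have hjk : j ≠ k := fun e => hqr (e ▸ rfl)
    obtain ⟨x, hx, hxm⟩ := hM.triple_exceptional hK hbs hone hi hj hk hp.2 hq.2 hr.2 hij hik hjk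
    rcases hQ with hQ | h4
    · -- The three attachments are all of the exceptional triple.
      have hall : ∀ y ∈ x, y = i ∨ y = j ∨ y = k := by
        simp only [List.mem_cons, List.not_mem_nil, or_false, forall_eq_or_imp, forall_eq] at hx hxm
        rcases hx with rfl | rfl <;> simp at hxm ⊢ <;> omega
      have hatt : ∀ y ∈ x, Joined G {vert y} (lset bs) := by
        intro y hy
        rcases hall y hy with rfl | rfl | rfl
        exacts [hp.2, hq.2, hr.2]
      refine hQ (hM.isMinor_Qplus hbs ?_)
      simp only [List.mem_cons, List.not_mem_nil, or_false] at hx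
      rcases hx with rfl | rfl
      · exact Or.inl hatt
      · exact Or.inr hatt
    · have := hsize 4 (by norm_num) h4
      obtain ⟨s, hs, hs'⟩ := Set.exists_mem_notMem_of_ncard_lt_ncard
        (s := {vert i, vert j, vert k}) (t := T) (by omega)
      obtain ⟨l, hl, rfl⟩ := hbr s hs
      simp only [Set.mem_insert_iff, Set.mem_singleton_iff, not_or] at hs'
      have hil : i ≠ l := fun e => hs'.1 (e ▸ rfl)
      have hjl : j ≠ l := fun e => hs'.2.1 (e ▸ rfl)
      have hkl : k ≠ l := fun e => hs'.2.2 (e ▸ rfl)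
      obtain ⟨y, hy, hym⟩ := hM.triple_exceptional hK hbs hone hi hj hl hp.2 hq.2 hs.2 hij hil hjl
      -- The exceptional triples are disjoint, so both triples are the same one, which would have
      -- four elements.
      simp only [List.mem_cons, List.not_mem_nil, or_false, forall_eq_or_imp, forall_eq]
        at hx hy hxm hym
      rcases hx with rfl | rfl <;> rcases hy with rfl | rfl <;> simp at hxm hym <;> omega

end

/-! ### Numbering the vertices of `F₄` -/

/-- The vertex of `F₄` with a given number, inverse to `(i, j) ↦ 5 * i + j`; junk from `10` on. -/
def label (i : ℕ) : Fin 2 × Fin 5 := (Fin.ofNat 2 (i / 5), Fin.ofNat 5 i)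

set_option synthInstance.maxSize 100000 in
set_option synthInstance.maxHeartbeats 400000 in
lemma F4_adj_label : ∀ i < 10, ∀ j < 10, F4.Adj (label i) (label j) ↔ adjF i j = true := by
  simp only [F4, SimpleGraph.fromRel_adj]
  decide +kernel

lemma label_injective : ∀ i < 10, ∀ j < 10, label i = label j → i = j := by decide

lemma exists_label : ∀ u : Fin 2 × Fin 5, ∃ i < 10, label i = u := by decide

lemma support_eq_inner {u v : V} (p : G.Walk u v) (h : u ≠ v) :
    p.support = u :: p.support.tail.dropLast ++ [v] := by
  cases p with
  | nil => exact absurd rfl h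
  | cons hadj q =>
    have := List.dropLast_append_getLast q.support_ne_nil
    rw [SimpleGraph.Walk.getLast_support] at this
    simp [this]

open Classical in
/-- The inner vertices of the segment between two labels; no vertices if they are not adjacent. -/
noncomputable def Subdivision.inner (η : Subdivision F4 G) (i j : ℕ) : List V :=
  if h : F4.Adj (label i) (label j) then (η.seg h).support.tail.dropLast else []

lemma Subdivision.support_seg (η : Subdivision F4 G) {i j : ℕ}
    (h : F4.Adj (label i) (label j)) :
    (η.seg h).support = η.vert (label i) :: η.inner i j ++ [η.vert (label j)] := by
  rw [Subdivision.inner, dif_pos h]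
  exact support_eq_inner _ fun e => h.ne (η.vert_injective e)

/-- A subdivision, with the vertices of `F₄` numbered, is a model. -/
lemma Subdivision.isModel (η : Subdivision F4 G) :
    IsModel G (fun i => η.vert (label i)) η.inner := by
  have hadj : ∀ {i j}, IsEdge i j → F4.Adj (label i) (label j) := fun {i j} h =>
    (F4_adj_label i h.2.1 j h.2.2).2 h.1
  have hnd : ∀ {i j}, IsEdge i j →
      (η.vert (label i) :: η.inner i j ++ [η.vert (label j)]).Nodup := fun {i j} h => by
    rw [← η.support_seg (hadj h)]
    exact (η.seg_isPath _).support_nodup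
  have hvn : ∀ k < 10, ∀ i j, IsEdge i j → η.vert (label k) ∉ η.inner i j := by
    intro k hk i j h hm
    have h1 := hnd h
    have h2 := η.eq_or_eq_of_vert_mem (hadj h) (w := label k) (by
      rw [η.support_seg (hadj h)]; simp [hm])
    rw [List.cons_append, List.nodup_cons, List.nodup_append] at h1
    rcases h2 with e | e
    · rw [e] at hm
      exact h1.1 (by simp [hm])
    · rw [e] at hm
      exact h1.2.2.2 _ hm _ (by simp) rfl
  refine ⟨fun i j h => ?_, fun i j h => ?_, fun i j h => ?_, fun i hi j hj h => ?_, hvn, ?_⟩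
  · rw [PathVia, ← η.support_seg (hadj h)]
    exact (η.seg (hadj h)).isChain_adj_support
  · have h1 := η.support_seg (hadj h).symm
    rw [η.seg_symm (hadj h), SimpleGraph.Walk.support_reverse, η.support_seg (hadj h)] at h1
    simpa using h1.symm
  · have h1 := hnd h
    rw [List.cons_append, List.nodup_cons, List.nodup_append] at h1
    exact h1.2.1
  · exact label_injective i hi j hj (η.vert_injective h)
  · intro i j h k l h' x hx hx'
    by_cases e : s(label i, label j) = s(label k, label l)
    · rw [Sym2.eq_iff] at e
      refine e.imp ?_ ?_
      · exact fun e => ⟨label_injective i h.2.1 k h'.2.1 e.1, label_injective j h.2.2 l h'.2.2 e.2⟩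
      · exact fun e => ⟨label_injective i h.2.1 l h'.2.2 e.1, label_injective j h.2.2 k h'.2.1 e.2⟩
    · obtain ⟨u, rfl⟩ := η.mem_range_of_mem_of_mem (hadj h) (hadj h') e (x := x)
        (by rw [η.support_seg]; simp [hx]) (by rw [η.support_seg]; simp [hx'])
      obtain ⟨m, hm, rfl⟩ := exists_label u
      exact absurd hx (hvn m hm i j h)

lemma Subdivision.modelVerts_subset (η : Subdivision F4 G) :
    modelVerts (fun i => η.vert (label i)) η.inner ⊆ η.image.verts := by
  rintro x (⟨i, -, rfl⟩ | ⟨i, j, h, hx⟩)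
  · simp only [Subdivision.image, SimpleGraph.Subgraph.verts_sup, SimpleGraph.Subgraph.verts_iSup]
    exact Or.inl (Set.mem_iUnion.2 ⟨label i, rfl⟩)
  · have hadj := (F4_adj_label i h.2.1 j h.2.2).2 h.1
    simp only [Subdivision.image, SimpleGraph.Subgraph.verts_sup, SimpleGraph.Subgraph.verts_iSup]
    refine Or.inr
      (Set.mem_iUnion.2 ⟨label i, Set.mem_iUnion.2 ⟨label j, Set.mem_iUnion.2 ⟨hadj, ?_⟩⟩⟩)
    rw [SimpleGraph.Walk.mem_verts_toSubgraph, η.support_seg]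
    simp [hx]

end

end GraphF4

theorem mainTheorem4 {V : Type*} [Finite V] (G : SimpleGraph V)
    (hG : GraphF4.InternallyFourConnected G)
    (hK : ¬ GraphF4.IsMinor GraphF4.K34 G)
    (hQ : ¬ GraphF4.IsMinor GraphF4.Qplus G ∨ GraphF4.KConnected 4 G)
    (η : GraphF4.Subdivision GraphF4.F4 G) (hη : η.IsJT) :
    η.image.IsSpanning :=
  fun v => η.modelVerts_subset (η.isModel.spanning hG hK hQ v)
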